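/- Let $\phi=\frac{1+\sqrt5}{2}$ be the golden ratio and let $\mathrm{Li}_s(z)=\sum_{n\ge1}\frac{z^n}{n^s}$ denote the polylogarithm. Then $$\sum_{n=0}^{\infty}\frac{(-1)^n}{(2n+1)^3\binom{2n}{n}}=-\frac{4}{3}\,\mathrm{Li}_3\!\left(\frac1{\phi^3}\right)-4\,\mathrm{Li}_2\!\left(\frac1{\phi^3}\right)\log\phi+\mathrm{Li}_3\!\left(\frac1\phi\right)-\frac{25}{3}\log^3\phi+6\log 2\,\log^2\phi+\frac{\pi^2}{10}\log\phi+\frac{12}{5}\zeta(3)-\frac{\pi^2}{3}\log 2 ,$$ and this number lies in $\mathfrak Z_3(10)$. Here, for positive integers $k$ and $N$, $\mathfrak Z_k(N)$ is the $\mathbb Q$-linear subspace of $\mathbb C$ spanned by the sums of the convergent series $$\mathrm{Li}_{s_1,\dots,s_m}(z_1,\dots,z_m)=\sum_{n_1>\cdots>n_m\ge1}\frac{z_1^{n_1}\cdots z_m^{n_m}}{n_1^{s_1}\cdots n_m^{s_m}}=\lim_{M\to\infty}\ \sum_{M>n_1>\cdots>n_m\ge1}\frac{z_1^{n_1}\cdots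 z_m^{n_m}}{n_1^{s_1}\cdots n_m^{s_m}},$$ where $m\ge1$ and $s_1,\dots,s_m$ are positive integers with $s_1+\cdots+s_m=k$, and $z_1,\dots,z_m$ are complex numbers with $z_1^N=\cdots=z_m^N=1$ and $(s_1,z_1)\ne(1,1)$. -/

import Mathlib

/-- The polylogarithm `Li_s(z) = ∑_{n ≥ 1} z ^ n / n ^ s`, as the sum of its defining series
(absolutely convergent for `‖z‖ < 1`, and for `‖z‖ ≤ 1` when `s > 1`). -/
noncomputable def polylog (s : ℕ) (z : ℂ) : ℂ :=
  ∑' n : ℕ, z ^ (n + 1) / ((n : ℂ) + 1) ^ s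

/-- The truncated multiple polylogarithm with index list `[(s₁, z₁), …, (s_m, z_m)]`:
`∑_{M > n₁ > ⋯ > n_m ≥ 1} z₁ ^ n₁ ⋯ z_m ^ n_m / (n₁ ^ s₁ ⋯ n_m ^ s_m)`. -/
noncomputable def multiPolylogTrunc : List (ℕ × ℂ) → ℕ → ℂ
  | [], _ => 1
  | p :: l, M => ∑ n ∈ Finset.Ico 1 M, p.2 ^ n / (n : ℂ) ^ p.1 * multiPolylogTrunc l n

/-- The multiple polylogarithm series `Li_{s₁,…,s_m}(z₁,…,z_m)` converges with sum `x`. Since the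
series may converge only conditionally (when `s₁ = 1`), its sum is the limit of the truncations
`n₁ < M` as `M → ∞`. -/
def HasMultiPolylog (l : List (ℕ × ℂ)) (x : ℂ) : Prop :=
  Filter.Tendsto (multiPolylogTrunc l) Filter.atTop (nhds x)

/-- The `ℚ`-vector space spanned by the cyclotomic multiple zeta values of weight `k` and level
`N` (for `N ≥ 1`): the values `Li_{s₁,…,s_m}(z₁,…,z_m)` with positive integers `s_j` adding up to
`k`, with `z_j ^ N = 1`, and with `(s₁, z₁) ≠ (1, 1)`. For `k = 0` only the empty list
qualifies, with value `1`, so that the space is `ℚ`. -/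
noncomputable def cmzvSpace (k N : ℕ) : Submodule ℚ ℂ :=
  Submodule.span ℚ {x : ℂ | ∃ l : List (ℕ × ℂ),
    (∀ p ∈ l, 1 ≤ p.1 ∧ p.2 ^ N = 1) ∧
    l.head? ≠ some (1, 1) ∧
    (l.map Prod.fst).sum = k ∧
    HasMultiPolylog l x}

/-! Put B_j(w) = ∑ (-1)^n w^(2n+1) / ((2n+1)^j C(2n,n)) (`binomSum`); the number in question is
B_3(1). One has w B_{j+1}' = B_j, and the recursion of the central binomials makes B_1 solve a
first-order linear equation (`binomSum_ode`). The substitution w = 4x/(1-x²) turns 1 + w²/4 into a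
square and yields B_2(w) = 4 χ_2(x), with χ_j the odd part of Li_j (`binomSum_two_eq_chi`). Hence
dB_3 = 4 χ_2(x) dlog(x/(1-x²)). The point w = 1 is x = c with c² + 4c = 1, c > 0, that is c = √5 - 2
= φ⁻³: this is how the golden ratio enters.

Closed form: integrating by parts expresses B_3(1) through Li_2 and Li_3 at ±c, 1-c and 1/(1+c)
(`binomSum_three_one`). With u = 1/φ one has c = u³, 1-c = 2u², 1+c = 2u. Kummer's equation at u,
where 1+u+u² = 2, trades Li_3(2u²) - Li_3(1/(2u)) for Li_3(±u³) and Li_3(1/2) (`pl_three_kummer`);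
the χ_3 equation removes Li_3(-u³) (`pl_three_chi`); Landen's formula and duplication evaluate
Li_3(u²) and Li_3(1/2). Each functional equation is proved by differentiating, cancelling
dilogarithms through relations of the same kind one weight lower, and comparing limits at 0.

Membership: let ζ be a primitive fifth root of unity with positive real part. The Möbius map `segX
ζ` sends 1 to 0 and ζ to c, and takes the values ∞, -1, 1 at tenth roots of unity, so dlog X and
dlog(1 ± X) pull back to combinations of forms a ds/(1-as) with a^10 = 1. Then B_3(1) is an integral
along the chord from 1 to ζ. A primitive built from iterated integrals based at 0 has limits at both
ends in the span of values Li_{1,1,1} at tenth roots of unity, provided the outermost form is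
regular at 1 and at ζ. The offending form dlog X is moved inward by two integrations by parts
(`partsRemainder`). The boundary term containing χ_2(c) carries the factor log w, which vanishes at
w = 1 (`iterValue_fifth_root_relation` fixes the branch); the other boundary terms at ζ are products
of logarithms, covered by shuffle products. -/

/-! ### Power series with bounded coefficients over `ℝ` and `ℂ`; polylogarithms. -/

section PowerSums

open Filter Topology

variable {𝕜 : Type*} [RCLike 𝕜]

/-- The sum of the power series with coefficients `a`. -/
noncomputable def powerSum (a : ℕ → 𝕜) (x : 𝕜) : 𝕜 := ∑' n : ℕ, a n * x ^ n

lemma summable_norm_powerSum {a : ℕ → 𝕜} {C : ℝ} (ha : ∀ n, ‖a n‖ ≤ C) {x : 𝕜} (hx : ‖x‖ < 1) :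
    Summable fun n => ‖a n * x ^ n‖ := by
  refine Summable.of_nonneg_of_le (fun n => norm_nonneg _) (fun n => ?_)
    ((summable_geometric_of_lt_one (norm_nonneg x) hx).mul_left C)
  rw [norm_mul, norm_pow]
  exact mul_le_mul_of_nonneg_right (ha n) (by positivity)

lemma powerSum_zero (a : ℕ → 𝕜) : powerSum a 0 = a 0 := by
  unfold powerSum
  rw [tsum_eq_single 0 (fun n hn => by simp [hn])]
  simp

lemma powerSum_one (x : 𝕜) (hx : ‖x‖ < 1) : powerSum (fun _ => 1) x = (1 - x)⁻¹ := by
  simp [powerSum, tsum_geometric_of_norm_lt_one hx]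

/-- Termwise differentiation on a ball of radius `r` strictly between `‖x‖` and `1`, dominated by
the series of C n r^(n-1). The derived coefficients `b` are left free so that each use can supply
them in simplified form. -/
lemma hasDerivAt_powerSum {a b : ℕ → 𝕜} {C : ℝ} (ha : ∀ n, ‖a n‖ ≤ C)
    (hb : ∀ n, b n = ((n : 𝕜) + 1) * a (n + 1)) {x : 𝕜} (hx : ‖x‖ < 1) :
    HasDerivAt (powerSum a) (powerSum b x) x := by
  obtain ⟨r, hxr, hr1⟩ := exists_between hx
  have hr0 : 0 ≤ r := (norm_nonneg x).trans hxr.le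
  have hC : 0 ≤ C := (norm_nonneg _).trans (ha 0)
  have hu : Summable fun n : ℕ => C * ((n : ℝ) * r ^ (n - 1)) := by
    refine Summable.mul_left _ ((summable_nat_add_iff 1).mp ?_)
    have h1 := summable_pow_mul_geometric_of_norm_lt_one 1 (r := r)
      (by rwa [Real.norm_of_nonneg hr0])
    have h2 := summable_geometric_of_lt_one hr0 hr1
    refine (h1.add h2).congr fun n => ?_
    simp
    ring
  have h := hasDerivAt_tsum_of_isPreconnected (g := fun n y => a n * y ^ n)
    (g' := fun n y => a n * ((n : 𝕜) * y ^ (n - 1))) hu (t := Metric.ball 0 r) Metric.isOpen_ball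
    (convex_ball (0 : 𝕜) r).isPreconnected
    (fun n y _ => (hasDerivAt_pow n y).const_mul (a n))
    (fun n y hy => ?_) (y₀ := x) (y := x) (by simpa using hxr)
    (summable_norm_powerSum ha hx).of_norm (by simpa using hxr)
  · have e : powerSum b x = ∑' n : ℕ, a n * ((n : 𝕜) * x ^ (n - 1)) := by
      unfold powerSum
      have hs : Summable fun n : ℕ => a n * ((n : 𝕜) * x ^ (n - 1)) := by
        refine Summable.of_norm_bounded hu fun n => ?_
        rw [norm_mul, norm_mul, norm_pow, RCLike.norm_natCast]
        gcongr
        exact ha n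
      rw [hs.tsum_eq_zero_add]
      simp only [hb]
      simp
      congr 1
      ext n
      ring
    rw [e]
    exact h
  · have hy' : ‖y‖ ≤ r := by simpa using (Metric.mem_ball.mp hy).le
    rw [norm_mul, norm_mul, norm_pow, RCLike.norm_natCast]
    gcongr
    exact ha n

lemma continuousAt_powerSum {a : ℕ → 𝕜} {C : ℝ} (ha : ∀ n, ‖a n‖ ≤ C) {x : 𝕜} (hx : ‖x‖ < 1) :
    ContinuousAt (powerSum a) x :=
  (hasDerivAt_powerSum ha (b := fun n => ((n : 𝕜) + 1) * a (n + 1)) (fun _ => rfl) hx).continuousAt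

lemma continuousOn_powerSum {a : ℕ → 𝕜} (ha : Summable fun n => ‖a n‖) :
    ContinuousOn (powerSum a) (Metric.closedBall 0 1) := by
  refine continuousOn_tsum (fun n => by fun_prop) ha fun n x hx => ?_
  rw [norm_mul, norm_pow]
  have hx' : ‖x‖ ≤ 1 := by simpa using hx
  exact mul_le_of_le_one_right (norm_nonneg _) (pow_le_one₀ (norm_nonneg _) hx')

lemma mul_powerSum_succ {a b : ℕ → 𝕜} {x : 𝕜} (hb0 : b 0 = 0) (hab : ∀ n, b (n + 1) = a n)
    (hs : Summable fun n => a n * x ^ n) : x * powerSum a x = powerSum b x := by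
  unfold powerSum
  rw [((summable_nat_add_iff 1).mp ((hs.mul_left x).congr fun n => by
    rw [hab, pow_succ]; ring) : Summable fun n => b n * x ^ n).tsum_eq_zero_add, ← tsum_mul_left]
  simp only [hb0, hab]
  simp
  congr 1
  ext n
  ring

/-- The polylogarithm of order `j` as a power series over `ℝ` or `ℂ`. -/
noncomputable def pl (j : ℕ) : 𝕜 → 𝕜 := powerSum fun n => 1 / (n : 𝕜) ^ j

lemma norm_pl_coeff_le (j n : ℕ) : ‖1 / (n : 𝕜) ^ j‖ ≤ 1 := by
  rcases Nat.eq_zero_or_pos n with rfl | hn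
  · rcases Nat.eq_zero_or_pos j with rfl | hj
    · simp
    · simp [hj.ne']
  · rw [norm_div, norm_pow, RCLike.norm_natCast, norm_one]
    have : (1 : ℝ) ≤ n := by exact_mod_cast hn
    exact div_le_one_of_le₀ (one_le_pow₀ this) (by positivity)

lemma summable_pl_coeff {j : ℕ} (hj : 2 ≤ j) : Summable fun n : ℕ => ‖1 / (n : 𝕜) ^ j‖ := by
  refine (Real.summable_one_div_nat_pow.mpr (by omega : 1 < j)).congr fun n => ?_
  simp

/-- Division by zero makes the constant coefficient `1 / 0 ^ j` vanish once `j ≥ 1`, so the series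
effectively starts at 1. -/
lemma pl_zero {j : ℕ} (hj : 1 ≤ j) : pl j (0 : 𝕜) = 0 := by
  rw [pl, powerSum_zero]
  simp [show j ≠ 0 by omega]

lemma continuousOn_pl {j : ℕ} (hj : 2 ≤ j) :
    ContinuousOn (pl j : 𝕜 → 𝕜) (Metric.closedBall 0 1) :=
  continuousOn_powerSum (summable_pl_coeff hj)

lemma continuousAt_pl (j : ℕ) {x : 𝕜} (hx : ‖x‖ < 1) : ContinuousAt (pl j) x :=
  continuousAt_powerSum (norm_pl_coeff_le j) hx

lemma hasDerivAt_pl_one {x : 𝕜} (hx : ‖x‖ < 1) : HasDerivAt (pl 1) (1 - x)⁻¹ x := by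
  rw [← powerSum_one x hx]
  refine hasDerivAt_powerSum (norm_pl_coeff_le 1) (fun n => ?_) hx
  have : (n : 𝕜) + 1 ≠ 0 := by exact_mod_cast n.succ_ne_zero
  push_cast
  field_simp

lemma hasDerivAt_pl_succ {j : ℕ} (hj : 1 ≤ j) {x : 𝕜} (hx : ‖x‖ < 1) (hx0 : x ≠ 0) :
    HasDerivAt (pl (j + 1)) (pl j x / x) x := by
  have h := hasDerivAt_powerSum (norm_pl_coeff_le (𝕜 := 𝕜) (j + 1))
    (b := fun n => 1 / ((n : 𝕜) + 1) ^ j) (fun n => ?_) hx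
  · have e : pl j x / x = powerSum (fun n : ℕ => 1 / ((n : 𝕜) + 1) ^ j) x := by
      rw [div_eq_iff hx0, mul_comm]
      refine (mul_powerSum_succ ?_ ?_ ?_).symm
      · simp [show j ≠ 0 by omega]
      · intro n; push_cast; rfl
      · refine (summable_norm_powerSum (C := 1) (fun n => ?_) hx).of_norm
        exact_mod_cast norm_pl_coeff_le (𝕜 := 𝕜) j (n + 1)
    rw [e]
    exact h
  · have : (n : 𝕜) + 1 ≠ 0 := by exact_mod_cast n.succ_ne_zero
    push_cast
    field_simp
    ring

/-- The odd terms cancel, and an even index 2k contributes 2/(2k)^j. The case `j ≥ 2` is absolutely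
convergent up to the unit circle, so `x = 1` is allowed; this gives the values at -1. -/
lemma pl_add_pl_neg {j : ℕ} (hj : 2 ≤ j) {x : 𝕜} (hx : ‖x‖ ≤ 1) :
    pl j x + pl j (-x) = 2 / 2 ^ j * pl j (x ^ 2) := by
  have key : ∀ y : 𝕜, ‖y‖ ≤ 1 → Summable fun n : ℕ => 1 / (n : 𝕜) ^ j * y ^ n := fun y hy => by
    refine Summable.of_norm_bounded (summable_pl_coeff (𝕜 := 𝕜) hj) fun n => ?_
    rw [norm_mul, norm_pow]
    exact mul_le_of_le_one_right (norm_nonneg _) (pow_le_one₀ (norm_nonneg _) hy)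
  have h1 := key x hx
  have h2 := key (-x) (by simpa)
  have h3 := h1.add h2
  have he : Summable fun k : ℕ => 1 / ((2 * k : ℕ) : 𝕜) ^ j * x ^ (2 * k)
      + 1 / ((2 * k : ℕ) : 𝕜) ^ j * (-x) ^ (2 * k) :=
    h3.comp_injective (i := fun k : ℕ => 2 * k) (mul_right_injective₀ two_ne_zero)
  have ho : ∀ k : ℕ, 1 / ((2 * k + 1 : ℕ) : 𝕜) ^ j * x ^ (2 * k + 1)
      + 1 / ((2 * k + 1 : ℕ) : 𝕜) ^ j * (-x) ^ (2 * k + 1) = 0 := fun k => by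
    rw [Odd.neg_pow ⟨k, rfl⟩]; ring
  have h4 := tsum_even_add_odd (f := fun n : ℕ => 1 / (n : 𝕜) ^ j * x ^ n
    + 1 / (n : 𝕜) ^ j * (-x) ^ n) he (by simp only [ho]; exact summable_zero)
  have h5 : pl j x + pl j (-x)
      = ∑' n : ℕ, (1 / (n : 𝕜) ^ j * x ^ n + 1 / (n : 𝕜) ^ j * (-x) ^ n) := (h1.tsum_add h2).symm
  rw [h5, ← h4]
  simp only [ho, tsum_zero, add_zero]
  unfold pl powerSum
  rw [← tsum_mul_left]
  refine tsum_congr fun k => ?_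
  rw [Even.neg_pow (even_two_mul k)]
  push_cast
  rw [mul_pow, pow_mul]
  by_cases hk : (k : 𝕜) ^ j = 0
  · simp [hk]
  · field_simp; ring

end PowerSums

/-! ### Comparison of `pl` with `polylog`, the zeta function and the logarithm. -/

lemma polylog_ofReal {s : ℕ} (hs : 2 ≤ s) {x : ℝ} (hx : |x| ≤ 1) :
    polylog s (x : ℂ) = ((pl s x : ℝ) : ℂ) := by
  have h : Summable fun n : ℕ => 1 / (n : ℝ) ^ s * x ^ n := by
    refine Summable.of_norm_bounded (summable_pl_coeff (𝕜 := ℝ) hs) fun n => ?_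
    rw [norm_mul, norm_pow]
    exact mul_le_of_le_one_right (norm_nonneg _) (pow_le_one₀ (norm_nonneg _) hx)
  unfold polylog pl powerSum
  rw [h.tsum_eq_zero_add, Complex.ofReal_add, Complex.ofReal_tsum]
  simp [show s ≠ 0 by omega]
  congr 1; ext n
  ring

lemma pl_one_eq_riemannZeta {s : ℕ} (hs : 2 ≤ s) : ((pl s (1 : ℝ) : ℝ) : ℂ) = riemannZeta s := by
  rw [zeta_nat_eq_tsum_of_gt_one (by omega : 1 < s)]
  unfold pl powerSum
  rw [Complex.ofReal_tsum]
  simp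

lemma pl_two_one : pl 2 (1 : ℝ) = Real.pi ^ 2 / 6 := by
  rw [← hasSum_zeta_two.tsum_eq]
  simp [pl, powerSum]

lemma pl_one_eq_neg_log {x : ℝ} (hx : |x| < 1) : pl 1 x = -Real.log (1 - x) := by
  rw [← (Real.hasSum_pow_div_log_of_abs_lt_one hx).tsum_eq]
  have h : Summable fun n : ℕ => 1 / (n : ℝ) ^ 1 * x ^ n :=
    (summable_norm_powerSum (norm_pl_coeff_le (𝕜 := ℝ) 1) hx).of_norm
  unfold pl powerSum
  rw [h.tsum_eq_zero_add]
  simp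
  congr 1; ext n; ring

/-! ### Reflection and Landen formulas for the real dilogarithm and trilogarithm. -/

section RealPolylogs

open Filter Topology

/-- The derivative of `g` is presented as `g u * p`, so that `p` is its logarithmic derivative. For
arguments that are products of powers of a few fixed polynomials, `p` is then a linear form in the
logarithmic derivatives of these, which makes the cancellations below polynomial. -/
lemma hasDerivAt_pl_two_comp {g : ℝ → ℝ} {p u : ℝ} (hg : HasDerivAt g (g u * p) u)
    (h1 : |g u| < 1) (h0 : g u ≠ 0) :
    HasDerivAt (fun v => pl 2 (g v)) (-Real.log (1 - g u) * p) u := by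
  have h := (hasDerivAt_pl_succ (𝕜 := ℝ) le_rfl h1 h0).comp u hg
  rw [pl_one_eq_neg_log h1] at h
  refine h.congr_deriv ?_
  field_simp

lemma hasDerivAt_pl_three_comp {g : ℝ → ℝ} {p u : ℝ} (hg : HasDerivAt g (g u * p) u)
    (h1 : |g u| < 1) (h0 : g u ≠ 0) :
    HasDerivAt (fun v => pl 3 (g v)) (pl 2 (g u) * p) u := by
  have h := (hasDerivAt_pl_succ (𝕜 := ℝ) one_le_two h1 h0).comp u hg
  refine h.congr_deriv ?_
  field_simp

lemma tendsto_pl {j : ℕ} (hj : 2 ≤ j) {α : Type*} {l : Filter α} {g : α → ℝ} {y : ℝ}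
    (hg : Tendsto g l (𝓝 y)) (h1 : ∀ᶠ u in l, |g u| ≤ 1) (hy : |y| ≤ 1) :
    Tendsto (fun v => pl j (g v)) l (𝓝 (pl j y)) := by
  have h := (continuousOn_pl (𝕜 := ℝ) hj).continuousWithinAt (x := y) (by simpa using hy)
  refine h.tendsto.comp (tendsto_nhdsWithin_iff.mpr ⟨hg, ?_⟩)
  filter_upwards [h1] with u hu
  simpa using hu

/-- A function with vanishing derivative on `(0, b)` is constant, equal to its limit at `0`. -/
lemma eq_of_hasDerivAt_zero {f : ℝ → ℝ} {b c : ℝ} (hd : ∀ x ∈ Set.Ioo 0 b, HasDerivAt f 0 x)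
    (hl : Tendsto f (𝓝[>] 0) (𝓝 c)) {x : ℝ} (hx : x ∈ Set.Ioo 0 b) : f x = c := by
  have h1 : ∀ y ∈ Set.Ioo 0 b, f y = f x := fun y hy =>
    (convex_Ioo 0 b).is_const_of_fderivWithin_eq_zero (𝕜 := ℝ)
      (fun z hz => (hd z hz).differentiableAt.differentiableWithinAt)
      (fun z hz => by
        rw [fderivWithin_of_isOpen isOpen_Ioo hz]
        ext
        simp [(hd z hz).deriv]) hy hx
  refine tendsto_nhds_unique (tendsto_const_nhds.congr' ?_) hl
  filter_upwards [Ioo_mem_nhdsGT (hx.1.trans hx.2)] with y hy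
  exact (h1 y hy).symm

/-- Factor as (u log u) · (g(u)/u): the first factor tends to 0, the second to g'(0). -/
lemma tendsto_log_mul_nhdsGT_zero {g : ℝ → ℝ} (hg : DifferentiableAt ℝ g 0) (h0 : g 0 = 0) :
    Tendsto (fun u => Real.log u * g u) (𝓝[>] 0) (𝓝 0) := by
  have h1 : Tendsto (fun u => Real.log u * u) (𝓝[>] 0) (𝓝 0) := by
    simpa using tendsto_log_mul_rpow_nhdsGT_zero one_pos
  have h2 : Tendsto (fun u => u⁻¹ * g u) (𝓝[>] 0) (𝓝 (deriv g 0)) := by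
    have := hg.hasDerivAt.tendsto_slope_zero_right
    simpa [h0] using this
  have h3 := h1.mul h2
  rw [zero_mul] at h3
  refine h3.congr' ?_
  filter_upwards [self_mem_nhdsWithin] with u hu
  have : u ≠ 0 := ne_of_gt hu
  field_simp

/-- Euler's reflection formula for the dilogarithm. -/
lemma pl_two_reflection {x : ℝ} (h0 : 0 < x) (h1 : x < 1) :
    pl 2 (1 - x) = Real.pi ^ 2 / 6 - Real.log x * Real.log (1 - x) - pl 2 x := by
  have key := eq_of_hasDerivAt_zero (b := 1)
    (f := fun x : ℝ => pl 2 x + pl 2 (1 - x) + Real.log x * Real.log (1 - x))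
    (c := pl 2 (0 : ℝ) + pl 2 (1 : ℝ) + 0) (fun u hu => ?_) ?_ ⟨h0, h1⟩
  · rw [pl_zero (by norm_num), pl_two_one] at key
    linarith
  · obtain ⟨hu0, hu1⟩ := hu
    have hu2 : (1 - u) ≠ 0 := by linarith
    have e1 := hasDerivAt_pl_two_comp (g := fun v => v) (p := 1 / u) (u := u)
      ((hasDerivAt_id' u).congr_deriv (by field_simp)) (by rw [abs_of_pos hu0]; exact hu1) hu0.ne'
    have e0 : HasDerivAt (fun v : ℝ => 1 - v) (-1) u := by
      simpa using (hasDerivAt_id u).const_sub 1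
    have e2 := hasDerivAt_pl_two_comp (g := fun v => 1 - v) (p := -1 / (1 - u)) (u := u)
      (e0.congr_deriv (by field_simp)) (by rw [abs_of_pos] <;> linarith) hu2
    have e3 := (Real.hasDerivAt_log hu0.ne').mul (e0.log hu2)
    refine ((e1.add e2).add e3).congr_deriv ?_
    simp only [sub_sub_cancel]
    field_simp
    ring
  · refine ((tendsto_pl le_rfl ?_ ?_ ?_).add (tendsto_pl le_rfl ?_ ?_ ?_)).add
      (tendsto_log_mul_nhdsGT_zero ?_ ?_)
    · exact tendsto_nhdsWithin_of_tendsto_nhds tendsto_id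
    · filter_upwards [Ioo_mem_nhdsGT one_pos] with u hu
      rw [abs_of_pos hu.1]; exact hu.2.le
    · simp
    · refine tendsto_nhdsWithin_of_tendsto_nhds ?_
      have : ContinuousAt (fun u : ℝ => 1 - u) 0 := by fun_prop
      simpa using this.tendsto
    · filter_upwards [Ioo_mem_nhdsGT one_pos] with u hu
      rw [abs_of_pos] <;> linarith [hu.1, hu.2]
    · simp
    · exact DifferentiableAt.log (by fun_prop) (by norm_num)
    · simp

/-- Landen's formula for the dilogarithm. -/
lemma pl_two_landen {x : ℝ} (h0 : 0 < x) (h1 : x < 1 / 2) :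
    pl 2 (-(x / (1 - x))) = -pl 2 x - Real.log (1 - x) ^ 2 / 2 := by
  -- The bound 1/2 is where x/(1-x) reaches 1, so the series at its negative is differentiable up to
  -- there.
  have key := eq_of_hasDerivAt_zero (b := 1 / 2)
    (f := fun x : ℝ => pl 2 x + pl 2 (-(x / (1 - x))) + Real.log (1 - x) ^ 2 / 2)
    (c := pl 2 (0 : ℝ) + pl 2 (0 : ℝ) + 0) (fun u hu => ?_) ?_ ⟨h0, h1⟩
  · rw [pl_zero (by norm_num)] at key
    linarith
  · obtain ⟨hu0, hu1⟩ := hu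
    have hu2 : 0 < 1 - u := by linarith
    have hu3 := hu2.ne'
    have e1 := hasDerivAt_pl_two_comp (g := fun v => v) (p := 1 / u) (u := u)
      ((hasDerivAt_id' u).congr_deriv (by field_simp)) (by rw [abs_of_pos hu0]; linarith) hu0.ne'
    have e0 : HasDerivAt (fun v : ℝ => 1 - v) (-1) u := by
      simpa using (hasDerivAt_id u).const_sub 1
    have e2 := hasDerivAt_pl_two_comp (g := fun v => -(v / (1 - v))) (p := 1 / u + 1 / (1 - u))
      (u := u) (((hasDerivAt_id' u).fun_div e0 hu3).fun_neg.congr_deriv (by field_simp; ring))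
      (by rw [abs_neg, abs_of_pos (by positivity), div_lt_one hu2]; linarith)
      (neg_ne_zero.mpr (by positivity))
    have e3 := ((e0.log hu3).pow 2).div_const 2
    have hl : Real.log (1 - -(u / (1 - u))) = -Real.log (1 - u) := by
      rw [← Real.log_inv]; congr 1; field_simp; ring
    refine ((e1.add e2).add e3).congr_deriv ?_
    rw [hl]
    simp
    field_simp
    ring
  · refine ((tendsto_pl le_rfl ?_ ?_ ?_).add (tendsto_pl le_rfl ?_ ?_ ?_)).add ?_
    · exact tendsto_nhdsWithin_of_tendsto_nhds tendsto_id
    · filter_upwards [Ioo_mem_nhdsGT one_pos] with u hu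
      rw [abs_of_pos hu.1]; exact hu.2.le
    · simp
    · refine tendsto_nhdsWithin_of_tendsto_nhds ?_
      have : ContinuousAt (fun u : ℝ => -(u / (1 - u))) 0 :=
        (continuousAt_id.div (by fun_prop) (by norm_num)).neg
      simpa using this.tendsto
    · filter_upwards [Ioo_mem_nhdsGT (show (0 : ℝ) < 1 / 2 by norm_num)] with u hu
      have h2 : 0 < 1 - u := by linarith [hu.2]
      have := hu.1
      rw [abs_neg, abs_of_pos (by positivity), div_le_one h2]; linarith [hu.2]
    · simp
    · refine tendsto_nhdsWithin_of_tendsto_nhds ?_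
      have : ContinuousAt (fun u : ℝ => Real.log (1 - u) ^ 2 / 2) 0 :=
        ((ContinuousAt.log (by fun_prop) (by norm_num)).pow 2).div_const 2
      simpa using this.tendsto

/-- In the derivative, Landen's formula and reflection reduce all dilogarithms to Li_2(x), which
then cancels. -/
lemma pl_three_landen_of_lt {x : ℝ} (h0 : 0 < x) (h1 : x < 1 / 2) :
    pl 3 (-(x / (1 - x))) + pl 3 x + pl 3 (1 - x) = pl 3 1 + Real.pi ^ 2 / 6 * Real.log (1 - x)
      + Real.log (1 - x) ^ 3 / 6 - Real.log x * Real.log (1 - x) ^ 2 / 2 := by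
  have key := eq_of_hasDerivAt_zero (b := 1 / 2)
    (f := fun x : ℝ => pl 3 x + pl 3 (-(x / (1 - x))) + pl 3 (1 - x)
      + (-Real.pi ^ 2 / 6 * Real.log (1 - x) - Real.log (1 - x) ^ 3 / 6)
      + Real.log x * (Real.log (1 - x) ^ 2 / 2))
    (c := pl 3 (0 : ℝ) + pl 3 (0 : ℝ) + pl 3 1 + 0 + 0) (fun u hu => ?_) ?_ ⟨h0, h1⟩
  · rw [pl_zero (by norm_num)] at key
    linarith
  · obtain ⟨hu0, hu1⟩ := hu
    have hu2 : 0 < 1 - u := by linarith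
    have hu3 := hu2.ne'
    have e1 := hasDerivAt_pl_three_comp (g := fun v => v) (p := 1 / u) (u := u)
      ((hasDerivAt_id' u).congr_deriv (by field_simp)) (by rw [abs_of_pos hu0]; linarith) hu0.ne'
    have e0 : HasDerivAt (fun v : ℝ => 1 - v) (-1) u := by
      simpa using (hasDerivAt_id u).const_sub 1
    have e2 := hasDerivAt_pl_three_comp (g := fun v => -(v / (1 - v))) (p := 1 / u + 1 / (1 - u))
      (u := u) (((hasDerivAt_id' u).fun_div e0 hu3).fun_neg.congr_deriv (by field_simp; ring))
      (by rw [abs_neg, abs_of_pos (by positivity), div_lt_one hu2]; linarith)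
      (neg_ne_zero.mpr (by positivity))
    have e3 := hasDerivAt_pl_three_comp (g := fun v => 1 - v) (p := -1 / (1 - u)) (u := u)
      (e0.congr_deriv (by field_simp)) (by rw [abs_of_pos] <;> linarith) hu3
    have e4 := ((e0.log hu3).const_mul (-Real.pi ^ 2 / 6)).sub (((e0.log hu3).pow 3).div_const 6)
    have e5 := (Real.hasDerivAt_log hu0.ne').mul (((e0.log hu3).pow 2).div_const 2)
    refine ((((e1.add e2).add e3).add e4).add e5).congr_deriv ?_
    simp only [pl_two_landen hu0 hu1, pl_two_reflection hu0 (by linarith : u < 1)]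
    simp
    field_simp
    ring
  · refine ((((tendsto_pl (by norm_num) ?_ ?_ ?_).add (tendsto_pl (by norm_num) ?_ ?_ ?_)).add
      (tendsto_pl (by norm_num) ?_ ?_ ?_)).add ?_).add (tendsto_log_mul_nhdsGT_zero ?_ ?_)
    · exact tendsto_nhdsWithin_of_tendsto_nhds tendsto_id
    · filter_upwards [Ioo_mem_nhdsGT one_pos] with u hu
      rw [abs_of_pos hu.1]; exact hu.2.le
    · simp
    · refine tendsto_nhdsWithin_of_tendsto_nhds ?_
      have : ContinuousAt (fun u : ℝ => -(u / (1 - u))) 0 :=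
        (continuousAt_id.div (by fun_prop) (by norm_num)).neg
      simpa using this.tendsto
    · filter_upwards [Ioo_mem_nhdsGT (show (0 : ℝ) < 1 / 2 by norm_num)] with u hu
      have h2 : 0 < 1 - u := by linarith [hu.2]
      have := hu.1
      rw [abs_neg, abs_of_pos (by positivity), div_le_one h2]; linarith [hu.2]
    · simp
    · refine tendsto_nhdsWithin_of_tendsto_nhds ?_
      have : ContinuousAt (fun u : ℝ => 1 - u) 0 := by fun_prop
      simpa using this.tendsto
    · filter_upwards [Ioo_mem_nhdsGT one_pos] with u hu
      rw [abs_of_pos] <;> linarith [hu.1, hu.2]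
    · simp
    · refine tendsto_nhdsWithin_of_tendsto_nhds ?_
      have h : ContinuousAt (fun u : ℝ => Real.log (1 - u)) 0 :=
        ContinuousAt.log (by fun_prop) (by norm_num)
      have : ContinuousAt (fun u : ℝ => -Real.pi ^ 2 / 6 * Real.log (1 - u)
        - Real.log (1 - u) ^ 3 / 6) 0 := by fun_prop
      simpa using this.tendsto
    · have h : DifferentiableAt ℝ (fun u : ℝ => Real.log (1 - u)) 0 :=
        DifferentiableAt.log (by fun_prop) (by norm_num)
      fun_prop
    · simp

/-- Landen's formula for the trilogarithm. -/
lemma pl_three_landen {x : ℝ} (h0 : 0 < x) (h1 : x ≤ 1 / 2) :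
    pl 3 (-(x / (1 - x))) + pl 3 x + pl 3 (1 - x) = pl 3 1 + Real.pi ^ 2 / 6 * Real.log (1 - x)
      + Real.log (1 - x) ^ 3 / 6 - Real.log x * Real.log (1 - x) ^ 2 / 2 := by
  rcases h1.lt_or_eq with h1 | h1
  · exact pl_three_landen_of_lt h0 h1
  -- At x = 1/2 the argument -x/(1-x) is -1, on the boundary of the disc, so this case is a left
  -- limit; it is the one that evaluates Li_3(1/2).
  have hx : 1 - x ≠ 0 := by linarith
  have t : ∀ {f : ℝ → ℝ}, ContinuousAt f x → Tendsto f (𝓝[<] x) (𝓝 (f x)) := fun h =>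
    h.tendsto.mono_left nhdsWithin_le_nhds
  have hm : ∀ᶠ u in 𝓝[<] x, u ∈ Set.Ioo 0 x := Ioo_mem_nhdsLT h0
  refine tendsto_nhds_unique (f := fun x : ℝ => pl 3 (-(x / (1 - x))) + pl 3 x + pl 3 (1 - x))
    (l := 𝓝[<] x) (((tendsto_pl (by norm_num) (t (f := fun x => -(x / (1 - x))) ?_) ?_ ?_).add
    (tendsto_pl (by norm_num) (t (f := fun x => x) ?_) ?_ ?_)).add
    (tendsto_pl (by norm_num) (t (f := fun x => 1 - x) ?_) ?_ ?_)) ?_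
  · exact (continuousAt_id.div (by fun_prop) hx).neg
  · filter_upwards [hm] with u hu
    have h2 : 0 < 1 - u := by linarith [hu.2]
    have := hu.1
    rw [abs_neg, abs_of_pos (by positivity), div_le_one h2]; linarith [hu.2]
  · subst h1; norm_num
  · fun_prop
  · filter_upwards [hm] with u hu
    rw [abs_of_pos hu.1]; linarith [hu.2]
  · subst h1; norm_num
  · fun_prop
  · filter_upwards [hm] with u hu
    rw [abs_of_pos] <;> linarith [hu.1, hu.2]
  · subst h1; norm_num
  · have h : ContinuousAt (fun u : ℝ => Real.log (1 - u)) x :=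
      ContinuousAt.log (by fun_prop) hx
    have h' : ContinuousAt (fun u : ℝ => Real.log u) x := Real.continuousAt_log h0.ne'
    refine Tendsto.congr' ?_ (t (f := fun x => pl 3 1 + Real.pi ^ 2 / 6 * Real.log (1 - x)
      + Real.log (1 - x) ^ 3 / 6 - Real.log x * Real.log (1 - x) ^ 2 / 2) (by fun_prop))
    filter_upwards [hm] with u hu
    exact (pl_three_landen_of_lt hu.1 (by linarith [hu.2])).symm

end RealPolylogs

/-! ### One-variable specialisations of the five-term relation and of Kummer's equation. -/

section KummerRelations

open Filter Topology

lemma tendsto_pl_nhdsGT_zero {j : ℕ} (hj : 2 ≤ j) {g : ℝ → ℝ} {y b : ℝ} (hg : ContinuousAt g 0)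
    (hy : g 0 = y) (hb : 0 < b) (h : ∀ u, 0 < u → u < b → |g u| ≤ 1) :
    Tendsto (fun v => pl j (g v)) (𝓝[>] 0) (𝓝 (pl j y)) := by
  have h1 : Tendsto g (𝓝[>] 0) (𝓝 y) := hy ▸ hg.tendsto.mono_left nhdsWithin_le_nhds
  have h2 : ∀ᶠ u in 𝓝[>] 0, |g u| ≤ 1 := by
    filter_upwards [Ioo_mem_nhdsGT hb] with u hu using h u hu.1 hu.2
  exact tendsto_pl hj h1 h2 (le_of_tendsto h1.abs h2)

lemma tendsto_nhdsGT_zero {g : ℝ → ℝ} {y : ℝ} (hg : ContinuousAt g 0) (hy : g 0 = y) :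
    Tendsto g (𝓝[>] 0) (𝓝 y) := hy ▸ hg.tendsto.mono_left nhdsWithin_le_nhds

/-- A specialisation of the five-term relation for the dilogarithm. -/
lemma pl_two_five_term {u : ℝ} (h0 : 0 < u) :
    pl 2 (1 / (1 + u + u ^ 2)) + pl 2 (u / (1 + u) ^ 2) - pl 2 ((1 + u) / (1 + u + u ^ 2))
      = Real.log u * (2 * Real.log (1 + u) - Real.log (1 + u + u ^ 2))
        + (Real.log (1 + u) * Real.log (1 + u + u ^ 2) - 2 * Real.log (1 + u) ^ 2) := by
  -- The relation holds for all positive arguments, so any right end beyond `u` serves.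
  have key := eq_of_hasDerivAt_zero (b := u + 1)
    (f := fun u : ℝ => pl 2 (1 / (1 + u + u ^ 2)) + pl 2 (u / (1 + u) ^ 2)
      - pl 2 ((1 + u) / (1 + u + u ^ 2))
      - Real.log u * (2 * Real.log (1 + u) - Real.log (1 + u + u ^ 2))
      - (Real.log (1 + u) * Real.log (1 + u + u ^ 2) - 2 * Real.log (1 + u) ^ 2))
    (c := pl 2 (1 : ℝ) + pl 2 (0 : ℝ) - pl 2 1 - 0 - 0) (fun u hu => ?_) ?_
    ⟨h0, lt_add_one u⟩
  · rw [pl_zero (by norm_num)] at key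
    linarith
  · have hu0 := hu.1
    have hB : 0 < 1 + u := by positivity
    have hQ : 0 < 1 + u + u ^ 2 := by positivity
    have dB : HasDerivAt (fun v : ℝ => 1 + v) 1 u := (hasDerivAt_id' u).const_add 1
    have dQ : HasDerivAt (fun v : ℝ => 1 + v + v ^ 2) (1 + 2 * u) u :=
      (dB.fun_add (hasDerivAt_pow 2 u)).congr_deriv (by simp)
    have e1 := hasDerivAt_pl_two_comp (g := fun v => 1 / (1 + v + v ^ 2))
      (p := -((1 + 2 * u) / (1 + u + u ^ 2))) (u := u)
      (((hasDerivAt_const u (1 : ℝ)).fun_div dQ hQ.ne').congr_deriv (by field_simp; ring))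
      (by rw [abs_of_pos (by positivity), div_lt_one hQ]; nlinarith) (by positivity)
    have e2 := hasDerivAt_pl_two_comp (g := fun v => v / (1 + v) ^ 2)
      (p := 1 / u - 2 * (1 / (1 + u))) (u := u)
      (((hasDerivAt_id' u).fun_div (dB.fun_pow 2) (by positivity)).congr_deriv
        (by field_simp; simp; ring))
      (by rw [abs_of_pos (by positivity), div_lt_one (by positivity)]; nlinarith) (by positivity)
    have e3 := hasDerivAt_pl_two_comp (g := fun v => (1 + v) / (1 + v + v ^ 2))
      (p := 1 / (1 + u) - (1 + 2 * u) / (1 + u + u ^ 2)) (u := u)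
      ((dB.fun_div dQ hQ.ne').congr_deriv (by field_simp))
      (by rw [abs_of_pos (by positivity), div_lt_one (by positivity)]; nlinarith) (by positivity)
    have lB := dB.log hB.ne'
    have lQ := dQ.log hQ.ne'
    have l1 : Real.log (1 - 1 / (1 + u + u ^ 2))
        = Real.log u + Real.log (1 + u) - Real.log (1 + u + u ^ 2) := by
      rw [← Real.log_mul (by positivity) (by positivity),
        ← Real.log_div (by positivity) (by positivity)]
      congr 1; field_simp; ring
    have l2 : Real.log (1 - u / (1 + u) ^ 2)
        = Real.log (1 + u + u ^ 2) - 2 * Real.log (1 + u) := by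
      rw [show 2 * Real.log (1 + u) = Real.log ((1 + u) ^ 2) by simp,
        ← Real.log_div (by positivity) (by positivity)]
      congr 1; field_simp; ring
    have l3 : Real.log (1 - (1 + u) / (1 + u + u ^ 2))
        = 2 * Real.log u - Real.log (1 + u + u ^ 2) := by
      rw [show 2 * Real.log u = Real.log (u ^ 2) by simp,
        ← Real.log_div (by positivity) (by positivity)]
      congr 1; field_simp; ring
    refine ((((e1.add e2).sub e3).sub ((Real.hasDerivAt_log hu0.ne').mul
      ((lB.const_mul 2).sub lQ))).sub ((lB.mul lQ).sub ((lB.pow 2).const_mul 2))).congr_deriv ?_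
    rw [l1, l2, l3]
    simp only [Pi.sub_apply]
    -- With B = 1+u and Q = 1+u+u², every logarithm here is a linear form in log u, log B, log Q,
    -- and every `p` one in their derivatives. Abstracting these six quantities leaves a polynomial
    -- identity.
    generalize Real.log u = a
    generalize Real.log (1 + u) = b
    generalize Real.log (1 + u + u ^ 2) = q
    generalize 1 / (1 + u) = b'
    generalize (1 + 2 * u) / (1 + u + u ^ 2) = q'
    rw [one_div]
    generalize u⁻¹ = a'
    push_cast
    ring
  · have hb : (0 : ℝ) < 1 := one_pos
    refine ((((tendsto_pl_nhdsGT_zero le_rfl ?_ (by norm_num) hb ?_).add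
      (tendsto_pl_nhdsGT_zero le_rfl ?_ (by norm_num) hb ?_)).sub
      (tendsto_pl_nhdsGT_zero le_rfl ?_ (by norm_num) hb ?_)).sub
      (tendsto_log_mul_nhdsGT_zero ?_ (by norm_num))).sub (tendsto_nhdsGT_zero ?_ (by norm_num))
    · exact ContinuousAt.div (by fun_prop) (by fun_prop) (by norm_num)
    · intro u hu _
      rw [abs_of_pos (by positivity), div_le_one (by positivity)]; nlinarith
    · exact ContinuousAt.div (by fun_prop) (by fun_prop) (by norm_num)
    · intro u hu _
      rw [abs_of_pos (by positivity), div_le_one (by positivity)]; nlinarith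
    · exact ContinuousAt.div (by fun_prop) (by fun_prop) (by norm_num)
    · intro u hu _
      rw [abs_of_pos (by positivity), div_le_one (by positivity)]; nlinarith
    · have h1 : DifferentiableAt ℝ (fun u : ℝ => Real.log (1 + u)) 0 :=
        DifferentiableAt.log (by fun_prop) (by norm_num)
      have h2 : DifferentiableAt ℝ (fun u : ℝ => Real.log (1 + u + u ^ 2)) 0 :=
        DifferentiableAt.log (by fun_prop) (by norm_num)
      fun_prop
    · have h1 : ContinuousAt (fun u : ℝ => Real.log (1 + u)) 0 :=
        ContinuousAt.log (by fun_prop) (by norm_num)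
      have h2 : ContinuousAt (fun u : ℝ => Real.log (1 + u + u ^ 2)) 0 :=
        ContinuousAt.log (by fun_prop) (by norm_num)
      fun_prop

/-- A specialisation of Kummer's functional equation for the trilogarithm. -/
lemma pl_three_kummer {u : ℝ} (h0 : 0 < u) (h1 : u < 1) :
    -3 * pl 3 ((1 + u) / (1 + u + u ^ 2)) + 3 * pl 3 ((1 + u + u ^ 2) / (1 + u) ^ 2)
      + 2 * pl 3 (u / (1 + u) ^ 2) - pl 3 (-(u ^ 2 / (1 + u))) + pl 3 (1 / (1 + u + u ^ 2))
      - 2 * pl 3 (u * (1 + u) / (1 + u + u ^ 2))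
      = pl 3 1 + Real.pi ^ 2 / 6 * (5 * Real.log (1 + u + u ^ 2) - 9 * Real.log (1 + u))
        + Real.log u * (Real.log (1 + u + u ^ 2) ^ 2 - 3 * Real.log (1 + u) ^ 2)
        + (13 / 2 * Real.log (1 + u) ^ 3 - 6 * (Real.log (1 + u) ^ 2 * Real.log (1 + u + u ^ 2))
          + 5 / 2 * (Real.log (1 + u) * Real.log (1 + u + u ^ 2) ^ 2)
          - 2 / 3 * Real.log (1 + u + u ^ 2) ^ 3) := by
  have key := eq_of_hasDerivAt_zero (b := 1)
    (f := fun u : ℝ => -3 * pl 3 ((1 + u) / (1 + u + u ^ 2))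
      + 3 * pl 3 ((1 + u + u ^ 2) / (1 + u) ^ 2)
      + 2 * pl 3 (u / (1 + u) ^ 2) - pl 3 (-(u ^ 2 / (1 + u))) + pl 3 (1 / (1 + u + u ^ 2))
      - 2 * pl 3 (u * (1 + u) / (1 + u + u ^ 2))
      - Real.pi ^ 2 / 6 * (5 * Real.log (1 + u + u ^ 2) - 9 * Real.log (1 + u))
      - Real.log u * (Real.log (1 + u + u ^ 2) ^ 2 - 3 * Real.log (1 + u) ^ 2)
      - (13 / 2 * Real.log (1 + u) ^ 3 - 6 * (Real.log (1 + u) ^ 2 * Real.log (1 + u + u ^ 2))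
          + 5 / 2 * (Real.log (1 + u) * Real.log (1 + u + u ^ 2) ^ 2)
          - 2 / 3 * Real.log (1 + u + u ^ 2) ^ 3))
    (c := -3 * pl 3 (1 : ℝ) + 3 * pl 3 (1 : ℝ) + 2 * pl 3 (0 : ℝ) - pl 3 (0 : ℝ) + pl 3 (1 : ℝ)
      - 2 * pl 3 (0 : ℝ) - 0 - 0 - 0) (fun u hu => ?_) ?_ ⟨h0, h1⟩
  · rw [pl_zero (by norm_num)] at key
    linarith
  · have hu0 := hu.1
    have hu1 := hu.2
    have hB : 0 < 1 + u := by positivity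
    have hQ : 0 < 1 + u + u ^ 2 := by positivity
    have dB : HasDerivAt (fun v : ℝ => 1 + v) 1 u := (hasDerivAt_id' u).const_add 1
    have dQ : HasDerivAt (fun v : ℝ => 1 + v + v ^ 2) (1 + 2 * u) u :=
      (dB.fun_add (hasDerivAt_pow 2 u)).congr_deriv (by simp)
    have e1 := hasDerivAt_pl_three_comp (g := fun v => (1 + v) / (1 + v + v ^ 2))
      (p := 1 / (1 + u) - (1 + 2 * u) / (1 + u + u ^ 2)) (u := u)
      ((dB.fun_div dQ hQ.ne').congr_deriv (by field_simp))
      (by rw [abs_of_pos (by positivity), div_lt_one (by positivity)]; nlinarith) (by positivity)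
    have e2 := hasDerivAt_pl_three_comp (g := fun v => (1 + v + v ^ 2) / (1 + v) ^ 2)
      (p := (1 + 2 * u) / (1 + u + u ^ 2) - 2 * (1 / (1 + u))) (u := u)
      ((dQ.fun_div (dB.fun_pow 2) (by positivity)).congr_deriv (by field_simp; simp; ring))
      (by rw [abs_of_pos (by positivity), div_lt_one (by positivity)]; nlinarith) (by positivity)
    have e3 := hasDerivAt_pl_three_comp (g := fun v => v / (1 + v) ^ 2)
      (p := 1 / u - 2 * (1 / (1 + u))) (u := u)
      (((hasDerivAt_id' u).fun_div (dB.fun_pow 2) (by positivity)).congr_deriv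
        (by field_simp; simp; ring))
      (by rw [abs_of_pos (by positivity), div_lt_one (by positivity)]; nlinarith) (by positivity)
    have e4 := hasDerivAt_pl_three_comp (g := fun v => -(v ^ 2 / (1 + v)))
      (p := 2 * (1 / u) - 1 / (1 + u)) (u := u)
      (((hasDerivAt_pow 2 u).fun_div dB hB.ne').fun_neg.congr_deriv
        (by simp; field_simp))
      (by rw [abs_neg, abs_of_pos (by positivity), div_lt_one (by positivity)]; nlinarith)
      (neg_ne_zero.mpr (by positivity))
    have e5 := hasDerivAt_pl_three_comp (g := fun v => 1 / (1 + v + v ^ 2))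
      (p := -((1 + 2 * u) / (1 + u + u ^ 2))) (u := u)
      (((hasDerivAt_const u (1 : ℝ)).fun_div dQ hQ.ne').congr_deriv (by field_simp; ring))
      (by rw [abs_of_pos (by positivity), div_lt_one hQ]; nlinarith) (by positivity)
    have e6 := hasDerivAt_pl_three_comp (g := fun v => v * (1 + v) / (1 + v + v ^ 2))
      (p := 1 / u + 1 / (1 + u) - (1 + 2 * u) / (1 + u + u ^ 2)) (u := u)
      ((((hasDerivAt_id' u).fun_mul dB).fun_div dQ hQ.ne').congr_deriv (by field_simp))
      (by rw [abs_of_pos (by positivity), div_lt_one (by positivity)]; nlinarith) (by positivity)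
    have lB := dB.log hB.ne'
    have lQ := dQ.log hQ.ne'
    -- Six dilogarithms occur in the derivative. Reflection removes Q/B² and uB/Q, Landen followed
    -- by reflection reduces -u²/B to B/Q, and the five-term relation removes 1/Q; the coefficients
    -- of the remaining Li_2(u/B²) and Li_2(B/Q) are zero.
    have r1 := pl_two_reflection (x := u / (1 + u) ^ 2) (by positivity)
      (by rw [div_lt_one (by positivity)]; nlinarith)
    have r2 := pl_two_reflection (x := 1 / (1 + u + u ^ 2)) (by positivity)
      (by rw [div_lt_one (by positivity)]; nlinarith)
    have r3 := pl_two_landen (x := u ^ 2 / (1 + u + u ^ 2)) (by positivity)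
      (by rw [div_lt_iff₀ (by positivity)]; nlinarith)
    have r4 := pl_two_reflection (x := (1 + u) / (1 + u + u ^ 2)) (by positivity)
      (by rw [div_lt_one (by positivity)]; nlinarith)
    have r5 := pl_two_five_term hu0
    rw [show 1 - u / (1 + u) ^ 2 = (1 + u + u ^ 2) / (1 + u) ^ 2 by field_simp; ring,
      Real.log_div (by positivity) (by positivity), Real.log_div (by positivity) (by positivity),
      Real.log_pow] at r1
    rw [show 1 - 1 / (1 + u + u ^ 2) = u * (1 + u) / (1 + u + u ^ 2) by field_simp; ring,
      Real.log_div (by positivity) (by positivity), Real.log_div (by positivity) (by positivity),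
      Real.log_mul (by positivity) (by positivity), Real.log_one] at r2
    rw [show 1 - u ^ 2 / (1 + u + u ^ 2) = (1 + u) / (1 + u + u ^ 2) by field_simp; ring,
      show u ^ 2 / (1 + u + u ^ 2) / ((1 + u) / (1 + u + u ^ 2)) = u ^ 2 / (1 + u) by field_simp,
      Real.log_div (by positivity) (by positivity)] at r3
    rw [show 1 - (1 + u) / (1 + u + u ^ 2) = u ^ 2 / (1 + u + u ^ 2) by field_simp; ring,
      Real.log_div (by positivity) (by positivity), Real.log_div (by positivity) (by positivity),
      Real.log_pow] at r4
    refine (((((((((e1.const_mul (-3)).add (e2.const_mul 3)).add (e3.const_mul 2)).sub e4).add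
      e5).sub (e6.const_mul 2)).sub (((lQ.const_mul 5).sub (lB.const_mul 9)).const_mul
      (Real.pi ^ 2 / 6))).sub ((Real.hasDerivAt_log hu0.ne').mul
      ((lQ.pow 2).sub ((lB.pow 2).const_mul 3)))).sub
      (((((lB.pow 3).const_mul (13 / 2)).sub (((lB.pow 2).mul lQ).const_mul 6)).add
      ((lB.mul (lQ.pow 2)).const_mul (5 / 2))).sub ((lQ.pow 3).const_mul (2 / 3)))).congr_deriv ?_
    simp only [Pi.sub_apply, Pi.pow_apply]
    rw [r1, r2, r3, r4, eq_sub_of_add_eq (sub_eq_iff_eq_add.mp r5)]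
    generalize Real.log u = a
    generalize Real.log (1 + u) = b
    generalize Real.log (1 + u + u ^ 2) = q
    generalize 1 / (1 + u) = b'
    generalize (1 + 2 * u) / (1 + u + u ^ 2) = q'
    rw [one_div]
    generalize u⁻¹ = a'
    push_cast
    ring
  · have hb : (0 : ℝ) < 1 := one_pos
    have hj : 2 ≤ 3 := by norm_num
    refine (((((((((tendsto_pl_nhdsGT_zero hj ?_ (by norm_num) hb ?_).const_mul (-3)).add
      ((tendsto_pl_nhdsGT_zero hj ?_ (by norm_num) hb ?_).const_mul 3)).add
      ((tendsto_pl_nhdsGT_zero hj ?_ (by norm_num) hb ?_).const_mul 2)).sub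
      (tendsto_pl_nhdsGT_zero hj ?_ (by norm_num) hb ?_)).add
      (tendsto_pl_nhdsGT_zero hj ?_ (by norm_num) hb ?_)).sub
      ((tendsto_pl_nhdsGT_zero hj ?_ (by norm_num) hb ?_).const_mul 2)).sub
      (tendsto_nhdsGT_zero ?_ (by norm_num))).sub
      (tendsto_log_mul_nhdsGT_zero ?_ (by norm_num))).sub (tendsto_nhdsGT_zero ?_ (by norm_num))
    · exact ContinuousAt.div (by fun_prop) (by fun_prop) (by norm_num)
    · intro u hu _
      rw [abs_of_pos (by positivity), div_le_one (by positivity)]; nlinarith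
    · exact ContinuousAt.div (by fun_prop) (by fun_prop) (by norm_num)
    · intro u hu _
      rw [abs_of_pos (by positivity), div_le_one (by positivity)]; nlinarith
    · exact ContinuousAt.div (by fun_prop) (by fun_prop) (by norm_num)
    · intro u hu _
      rw [abs_of_pos (by positivity), div_le_one (by positivity)]; nlinarith
    · exact (ContinuousAt.div (by fun_prop) (by fun_prop) (by norm_num)).neg
    · intro u hu _
      rw [abs_neg, abs_of_pos (by positivity), div_le_one (by positivity)]; nlinarith
    · exact ContinuousAt.div (by fun_prop) (by fun_prop) (by norm_num)
    · intro u hu _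
      rw [abs_of_pos (by positivity), div_le_one (by positivity)]; nlinarith
    · exact ContinuousAt.div (by fun_prop) (by fun_prop) (by norm_num)
    · intro u hu _
      rw [abs_of_pos (by positivity), div_le_one (by positivity)]; nlinarith
    · have h1 : ContinuousAt (fun u : ℝ => Real.log (1 + u)) 0 :=
        ContinuousAt.log (by fun_prop) (by norm_num)
      have h2 : ContinuousAt (fun u : ℝ => Real.log (1 + u + u ^ 2)) 0 :=
        ContinuousAt.log (by fun_prop) (by norm_num)
      fun_prop
    · have h1 : DifferentiableAt ℝ (fun u : ℝ => Real.log (1 + u)) 0 :=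
        DifferentiableAt.log (by fun_prop) (by norm_num)
      have h2 : DifferentiableAt ℝ (fun u : ℝ => Real.log (1 + u + u ^ 2)) 0 :=
        DifferentiableAt.log (by fun_prop) (by norm_num)
      fun_prop
    · have h1 : ContinuousAt (fun u : ℝ => Real.log (1 + u)) 0 :=
        ContinuousAt.log (by fun_prop) (by norm_num)
      have h2 : ContinuousAt (fun u : ℝ => Real.log (1 + u + u ^ 2)) 0 :=
        ContinuousAt.log (by fun_prop) (by norm_num)
      fun_prop

end KummerRelations

/-! ### Functional equations of Legendre's chi function under y ↦ (1-y)/(1+y). -/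

section LegendreChi

open Filter Topology

lemma pl_two_neg_one : pl 2 (-1 : ℝ) = -(Real.pi ^ 2 / 12) := by
  have h := pl_add_pl_neg (𝕜 := ℝ) le_rfl (x := 1) (by simp)
  rw [one_pow, pl_two_one] at h
  linarith

lemma pl_three_neg_one : pl 3 (-1 : ℝ) = -(3 / 4) * pl 3 1 := by
  have h := pl_add_pl_neg (𝕜 := ℝ) (show 2 ≤ 3 by norm_num) (x := 1) (by simp)
  rw [one_pow] at h
  linarith

/-- The functional equation of Legendre's chi function of order two. -/
lemma pl_two_chi {y : ℝ} (h0 : 0 < y) (h1 : y < 1) :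
    pl 2 ((1 - y) / (1 + y)) - pl 2 (-((1 - y) / (1 + y))) + (pl 2 y - pl 2 (-y))
      = Real.pi ^ 2 / 4 - Real.log y * (Real.log (1 - y) - Real.log (1 + y)) := by
  have key := eq_of_hasDerivAt_zero (b := 1)
    (f := fun y : ℝ => pl 2 ((1 - y) / (1 + y)) - pl 2 (-((1 - y) / (1 + y)))
      + (pl 2 y - pl 2 (-y)) + Real.log y * (Real.log (1 - y) - Real.log (1 + y)))
    (c := pl 2 (1 : ℝ) - pl 2 (-1) + (pl 2 0 - pl 2 0) + 0) (fun u hu => ?_) ?_ ⟨h0, h1⟩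
  · rw [pl_two_neg_one, pl_two_one] at key
    linarith
  · have hu0 := hu.1
    have hA : 0 < 1 - u := by linarith [hu.2]
    have hB : 0 < 1 + u := by positivity
    have dA : HasDerivAt (fun v : ℝ => 1 - v) (-1) u := (hasDerivAt_id' u).const_sub 1
    have dB : HasDerivAt (fun v : ℝ => 1 + v) 1 u := (hasDerivAt_id' u).const_add 1
    have e1 := hasDerivAt_pl_two_comp (g := fun v => (1 - v) / (1 + v))
      (p := -1 / (1 - u) - 1 / (1 + u)) (u := u)
      ((dA.fun_div dB hB.ne').congr_deriv (by field_simp))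
      (by rw [abs_of_pos (by positivity), div_lt_one (by positivity)]; linarith) (by positivity)
    have e2 := hasDerivAt_pl_two_comp (g := fun v => -((1 - v) / (1 + v)))
      (p := -1 / (1 - u) - 1 / (1 + u)) (u := u)
      ((dA.fun_div dB hB.ne').fun_neg.congr_deriv (by field_simp))
      (by rw [abs_neg, abs_of_pos (by positivity), div_lt_one (by positivity)]; linarith)
      (neg_ne_zero.mpr (by positivity))
    have e3 := hasDerivAt_pl_two_comp (g := fun v => v) (p := 1 / u) (u := u)
      ((hasDerivAt_id' u).congr_deriv (by field_simp))
      (by rw [abs_of_pos (by positivity)]; exact hu.2) (by positivity)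
    have e4 := hasDerivAt_pl_two_comp (g := fun v => -v) (p := 1 / u) (u := u)
      ((hasDerivAt_id' u).fun_neg.congr_deriv (by field_simp))
      (by rw [abs_neg, abs_of_pos (by positivity)]; exact hu.2) (neg_ne_zero.mpr (by positivity))
    have l1 : Real.log (1 - (1 - u) / (1 + u))
        = Real.log 2 + Real.log u - Real.log (1 + u) := by
      rw [← Real.log_mul (by positivity) (by positivity),
        ← Real.log_div (by positivity) (by positivity)]
      congr 1; field_simp; ring
    have l2 : Real.log (1 - -((1 - u) / (1 + u))) = Real.log 2 - Real.log (1 + u) := by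
      rw [← Real.log_div (by positivity) (by positivity)]
      congr 1; field_simp; ring
    refine (((e1.sub e2).add (e3.sub e4)).add ((Real.hasDerivAt_log hu0.ne').mul
      ((dA.log hA.ne').sub (dB.log hB.ne')))).congr_deriv ?_
    rw [l1, l2, sub_neg_eq_add]
    simp only [Pi.sub_apply]
    ring
  · have hb : (0 : ℝ) < 1 := one_pos
    refine (((tendsto_pl_nhdsGT_zero le_rfl ?_ (by norm_num) hb ?_).sub
      (tendsto_pl_nhdsGT_zero le_rfl ?_ (by norm_num) hb ?_)).add
      ((tendsto_pl_nhdsGT_zero le_rfl ?_ (by norm_num) hb ?_).sub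
      (tendsto_pl_nhdsGT_zero le_rfl ?_ (by norm_num) hb ?_))).add
      (tendsto_log_mul_nhdsGT_zero ?_ (by norm_num))
    · exact ContinuousAt.div (by fun_prop) (by fun_prop) (by norm_num)
    · intro u hu hu1
      have : 0 < 1 - u := by linarith
      rw [abs_of_pos (by positivity), div_le_one (by positivity)]; linarith
    · exact (ContinuousAt.div (by fun_prop) (by fun_prop) (by norm_num)).neg
    · intro u hu hu1
      have : 0 < 1 - u := by linarith
      rw [abs_neg, abs_of_pos (by positivity), div_le_one (by positivity)]; linarith
    · fun_prop
    · intro u hu hu1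
      rw [abs_of_pos hu]; exact hu1.le
    · fun_prop
    · intro u hu hu1
      rw [abs_neg, abs_of_pos hu]; exact hu1.le
    · have h1 : DifferentiableAt ℝ (fun u : ℝ => Real.log (1 - u)) 0 :=
        DifferentiableAt.log (by fun_prop) (by norm_num)
      have h2 : DifferentiableAt ℝ (fun u : ℝ => Real.log (1 + u)) 0 :=
        DifferentiableAt.log (by fun_prop) (by norm_num)
      fun_prop

/-- The dilogarithm at `1 / (1 + y)`, by reflection and Landen's formula. -/
lemma pl_two_one_div_one_add {y : ℝ} (h0 : 0 < y) (h1 : y < 1) :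
    pl 2 (1 / (1 + y)) = Real.pi ^ 2 / 6 + Real.log (1 + y) * (Real.log y - Real.log (1 + y))
      + pl 2 (-y) + Real.log (1 + y) ^ 2 / 2 := by
  have hB : 0 < 1 + y := by positivity
  have r1 := pl_two_reflection (x := y / (1 + y)) (by positivity)
    (by rw [div_lt_one hB]; linarith)
  have r2 := pl_two_landen (x := y / (1 + y)) (by positivity)
    (by rw [div_lt_iff₀ hB]; linarith)
  rw [show 1 - y / (1 + y) = 1 / (1 + y) by field_simp; ring, Real.log_div h0.ne' hB.ne',
    Real.log_div one_ne_zero hB.ne', Real.log_one] at r1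
  rw [show 1 - y / (1 + y) = 1 / (1 + y) by field_simp; ring,
    show y / (1 + y) / (1 / (1 + y)) = y by field_simp,
    Real.log_div one_ne_zero hB.ne', Real.log_one] at r2
  linarith

/-- A functional equation of Legendre's chi function of order three. -/
lemma pl_three_chi {y : ℝ} (h0 : 0 < y) (h1 : y < 1) :
    pl 3 ((1 - y) / (1 + y)) - pl 3 (-((1 - y) / (1 + y))) - 2 * pl 3 (1 - y)
      - 2 * pl 3 (1 / (1 + y)) + 1 / 2 * pl 3 (1 - y ^ 2)
      = -(7 / 4) * pl 3 1 + (Real.pi ^ 2 / 6 * Real.log (1 + y) - Real.log (1 + y) ^ 3 / 3) := by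
  have key := eq_of_hasDerivAt_zero (b := 1)
    (f := fun y : ℝ => pl 3 ((1 - y) / (1 + y)) - pl 3 (-((1 - y) / (1 + y))) - 2 * pl 3 (1 - y)
      - 2 * pl 3 (1 / (1 + y)) + 1 / 2 * pl 3 (1 - y ^ 2)
      - (Real.pi ^ 2 / 6 * Real.log (1 + y) - Real.log (1 + y) ^ 3 / 3))
    (c := pl 3 (1 : ℝ) - pl 3 (-1) - 2 * pl 3 1 - 2 * pl 3 1 + 1 / 2 * pl 3 1 - 0)
    (fun u hu => ?_) ?_ ⟨h0, h1⟩
  · rw [pl_three_neg_one] at key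
    linarith
  · have hu0 := hu.1
    have hu1 := hu.2
    have hA : 0 < 1 - u := by linarith [hu.2]
    have hB : 0 < 1 + u := by positivity
    have hC : 0 < 1 - u ^ 2 := by nlinarith
    have dA : HasDerivAt (fun v : ℝ => 1 - v) (-1) u := (hasDerivAt_id' u).const_sub 1
    have dB : HasDerivAt (fun v : ℝ => 1 + v) 1 u := (hasDerivAt_id' u).const_add 1
    have dC : HasDerivAt (fun v : ℝ => 1 - v ^ 2) (-(2 * u)) u :=
      ((hasDerivAt_pow 2 u).const_sub 1).congr_deriv (by simp)
    have e1 := hasDerivAt_pl_three_comp (g := fun v => (1 - v) / (1 + v))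
      (p := -1 / (1 - u) - 1 / (1 + u)) (u := u)
      ((dA.fun_div dB hB.ne').congr_deriv (by field_simp))
      (by rw [abs_of_pos (by positivity), div_lt_one (by positivity)]; linarith) (by positivity)
    have e2 := hasDerivAt_pl_three_comp (g := fun v => -((1 - v) / (1 + v)))
      (p := -1 / (1 - u) - 1 / (1 + u)) (u := u)
      ((dA.fun_div dB hB.ne').fun_neg.congr_deriv (by field_simp))
      (by rw [abs_neg, abs_of_pos (by positivity), div_lt_one (by positivity)]; linarith)
      (neg_ne_zero.mpr (by positivity))
    have e3 := hasDerivAt_pl_three_comp (g := fun v => 1 - v) (p := -1 / (1 - u)) (u := u)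
      (dA.congr_deriv (by field_simp)) (by rw [abs_of_pos (by positivity)]; linarith)
      (by positivity)
    have e4 := hasDerivAt_pl_three_comp (g := fun v => 1 / (1 + v)) (p := -(1 / (1 + u))) (u := u)
      (((hasDerivAt_const u (1 : ℝ)).fun_div dB hB.ne').congr_deriv (by field_simp; ring))
      (by rw [abs_of_pos (by positivity), div_lt_one hB]; linarith) (by positivity)
    have e5 := hasDerivAt_pl_three_comp (g := fun v => 1 - v ^ 2)
      (p := -1 / (1 - u) + 1 / (1 + u)) (u := u)
      (dC.congr_deriv (by field_simp; ring)) (by rw [abs_of_pos hC]; nlinarith) hC.ne'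
    -- The dilogarithms at ±(1-u)/(1+u) enter only through their difference, so the χ_2 equation
    -- applies; the other relations bring everything down to Li_2(±u), which cancels.
    have r1 := pl_two_chi hu0 hu1
    have r2 := pl_two_reflection hu0 hu1
    have r3 := pl_two_one_div_one_add hu0 hu1
    have r4 := pl_two_reflection (x := u ^ 2) (by positivity) (by nlinarith)
    have r5 := pl_add_pl_neg (𝕜 := ℝ) le_rfl (x := u)
      (by rw [Real.norm_eq_abs, abs_of_pos hu0]; exact hu1.le)
    rw [show 1 - u ^ 2 = (1 - u) * (1 + u) by ring, Real.log_mul hA.ne' hB.ne', Real.log_pow] at r4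
    refine (((((e1.sub e2).sub (e3.const_mul 2)).sub (e4.const_mul 2)).add
      (e5.const_mul (1 / 2))).sub (((dB.log hB.ne').const_mul (Real.pi ^ 2 / 6)).sub
      (((dB.log hB.ne').pow 3).div_const 3))).congr_deriv ?_
    rw [show 1 - u ^ 2 = (1 - u) * (1 + u) by ring, r3, r4, r2,
      show pl 2 (u ^ 2) = 2 * (pl 2 u + pl 2 (-u)) by linarith,
      show pl 2 ((1 - u) / (1 + u)) = pl 2 (-((1 - u) / (1 + u))) - (pl 2 u - pl 2 (-u))
        + (Real.pi ^ 2 / 4 - Real.log u * (Real.log (1 - u) - Real.log (1 + u))) by linarith]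
    push_cast
    ring
  · have hb : (0 : ℝ) < 1 := one_pos
    have hj : 2 ≤ 3 := by norm_num
    refine (((((tendsto_pl_nhdsGT_zero hj ?_ (by norm_num) hb ?_).sub
      (tendsto_pl_nhdsGT_zero hj ?_ (by norm_num) hb ?_)).sub
      ((tendsto_pl_nhdsGT_zero hj ?_ (by norm_num) hb ?_).const_mul 2)).sub
      ((tendsto_pl_nhdsGT_zero hj ?_ (by norm_num) hb ?_).const_mul 2)).add
      ((tendsto_pl_nhdsGT_zero hj ?_ (by norm_num) hb ?_).const_mul (1 / 2))).sub
      (tendsto_nhdsGT_zero ?_ (by norm_num))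
    · exact ContinuousAt.div (by fun_prop) (by fun_prop) (by norm_num)
    · intro u hu hu1
      have : 0 < 1 - u := by linarith
      rw [abs_of_pos (by positivity), div_le_one (by positivity)]; linarith
    · exact (ContinuousAt.div (by fun_prop) (by fun_prop) (by norm_num)).neg
    · intro u hu hu1
      have : 0 < 1 - u := by linarith
      rw [abs_neg, abs_of_pos (by positivity), div_le_one (by positivity)]; linarith
    · fun_prop
    · intro u hu hu1
      rw [abs_of_pos (by linarith)]; linarith
    · exact ContinuousAt.div (by fun_prop) (by fun_prop) (by norm_num)
    · intro u hu hu1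
      rw [abs_of_pos (by positivity), div_le_one (by positivity)]; linarith
    · fun_prop
    · intro u hu hu1
      rw [abs_of_pos (by nlinarith)]; nlinarith
    · have h2 : ContinuousAt (fun u : ℝ => Real.log (1 + u)) 0 :=
        ContinuousAt.log (by fun_prop) (by norm_num)
      fun_prop

end LegendreChi

/-! ### The central binomial series as a function of x, where w = 4x/(1-x²). -/

section CentralBinomial

open Filter Topology

variable {𝕜 : Type*} [RCLike 𝕜]

lemma eq_of_hasDerivAt_zero_ball {f : 𝕜 → 𝕜} {c : ℝ} (hd : ∀ x, ‖x‖ < c → HasDerivAt f 0 x)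
    {x : 𝕜} (hx : ‖x‖ < c) : f x = f 0 := by
  let _ : NormedSpace ℝ 𝕜 := NormedSpace.restrictScalars ℝ 𝕜 𝕜
  have hb : ∀ z : 𝕜, z ∈ Metric.ball (0 : 𝕜) c ↔ ‖z‖ < c := fun z => by simp
  refine (convex_ball (0 : 𝕜) c).is_const_of_fderivWithin_eq_zero (𝕜 := 𝕜)
    (fun z hz => (hd z ((hb z).mp hz)).differentiableAt.differentiableWithinAt)
    (fun z hz => ?_) ((hb x).mpr hx) ((hb 0).mpr (by simpa using (norm_nonneg x).trans_lt hx))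
  rw [fderivWithin_of_isOpen Metric.isOpen_ball hz]
  ext
  simp [(hd z ((hb z).mp hz)).deriv]

/-- The coefficients `1 / ((2 * n + 1) ^ j * centralBinom n)`. -/
noncomputable def binomCoeff (𝕜 : Type*) [RCLike 𝕜] (j n : ℕ) : 𝕜 :=
  1 / ((2 * (n : 𝕜) + 1) ^ j * (Nat.centralBinom n : 𝕜))

/-- The odd power series `∑ (-1) ^ n * w ^ (2 * n + 1) / ((2 * n + 1) ^ j * centralBinom n)`. -/
noncomputable def binomSum (j : ℕ) (w : 𝕜) : 𝕜 := w * powerSum (binomCoeff 𝕜 j) (-w ^ 2)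

lemma two_mul_add_one_ne_zero (n : ℕ) : (2 * (n : 𝕜) + 1) ≠ 0 := by
  exact_mod_cast (2 * n).succ_ne_zero

lemma norm_two_mul_add_one (n : ℕ) : ‖2 * (n : 𝕜) + 1‖ = 2 * n + 1 := by
  have : (2 * (n : 𝕜) + 1) = ((2 * n + 1 : ℕ) : 𝕜) := by push_cast; ring
  rw [this, RCLike.norm_natCast]; push_cast; ring

/-- Bounding the central binomial below by 1 forgets the true radius of convergence 2 in w, but only
`‖w‖ ≤ 1` is ever used. -/
lemma norm_binomCoeff_le' (j n : ℕ) : ‖binomCoeff 𝕜 j n‖ ≤ 1 / (2 * (n : ℝ) + 1) ^ j := by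
  have h1 : (1 : ℝ) ≤ Nat.centralBinom n := by exact_mod_cast Nat.centralBinom_pos n
  rw [binomCoeff, norm_div, norm_mul, norm_pow, RCLike.norm_natCast, norm_two_mul_add_one, norm_one]
  exact one_div_le_one_div_of_le (by positivity) (le_mul_of_one_le_right (by positivity) h1)

lemma norm_binomCoeff_le (j n : ℕ) : ‖binomCoeff 𝕜 j n‖ ≤ 1 := by
  refine (norm_binomCoeff_le' j n).trans (div_le_one_of_le₀ (one_le_pow₀ ?_) (by positivity))
  linarith [(Nat.cast_nonneg n : (0 : ℝ) ≤ n)]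

lemma summable_binomCoeff {j : ℕ} (hj : 2 ≤ j) : Summable fun n => ‖binomCoeff 𝕜 j n‖ := by
  have h := (summable_nat_add_iff 1).mpr (Real.summable_one_div_nat_pow.mpr (by omega : 1 < j))
  refine Summable.of_nonneg_of_le (fun n => norm_nonneg _) (fun n => ?_) h
  refine (norm_binomCoeff_le' j n).trans (one_div_le_one_div_of_le (by positivity) ?_)
  refine pow_le_pow_left₀ (by positivity) ?_ j
  push_cast
  linarith [(Nat.cast_nonneg n : (0 : ℝ) ≤ n)]

lemma norm_neg_sq_lt {w : 𝕜} (hw : ‖w‖ < 1) : ‖-w ^ 2‖ < 1 := by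
  rw [norm_neg, norm_pow]
  exact pow_lt_one₀ (norm_nonneg _) hw (by norm_num)

/-- Differentiating w^(2n+1) cancels one factor 2n+1. The result is B_j(w)/w, written as a power
series so that it also makes sense at w = 0. -/
lemma hasDerivAt_binomSum (j : ℕ) {w : 𝕜} (hw : ‖w‖ < 1) :
    HasDerivAt (binomSum (j + 1)) (powerSum (binomCoeff 𝕜 j) (-w ^ 2)) w := by
  have hv := norm_neg_sq_lt hw
  have h1 := hasDerivAt_powerSum (norm_binomCoeff_le (𝕜 := 𝕜) (j + 1))
    (b := fun n => ((n : 𝕜) + 1) * binomCoeff 𝕜 (j + 1) (n + 1)) (fun _ => rfl) hv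
  have h2 : HasDerivAt (fun w : 𝕜 => -w ^ 2) (-(2 * w)) w :=
    (hasDerivAt_pow 2 w).fun_neg.congr_deriv (by simp)
  refine ((hasDerivAt_id' w).mul (h1.comp w h2)).congr_deriv ?_
  have hd : ∀ n : ℕ, (2 * (n : 𝕜) + 1) * binomCoeff 𝕜 (j + 1) n = binomCoeff 𝕜 j n := fun n => by
    have := two_mul_add_one_ne_zero (𝕜 := 𝕜) n
    unfold binomCoeff
    rw [pow_succ]
    by_cases hc : (Nat.centralBinom n : 𝕜) = 0
    · simp [hc]
    · field_simp
  have hb : ∀ n : ℕ, ‖(n : 𝕜) * binomCoeff 𝕜 (j + 1) n‖ ≤ 1 := fun n => by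
    refine le_trans ?_ (norm_binomCoeff_le (𝕜 := 𝕜) j n)
    rw [← hd, norm_mul, norm_mul, norm_two_mul_add_one, RCLike.norm_natCast]
    gcongr
    linarith [(Nat.cast_nonneg n : (0 : ℝ) ≤ n)]
  have h3 := mul_powerSum_succ (a := fun n : ℕ => ((n : 𝕜) + 1) * binomCoeff 𝕜 (j + 1) (n + 1))
    (b := fun n : ℕ => (n : 𝕜) * binomCoeff 𝕜 (j + 1) n) (x := -w ^ 2) (by simp)
    (fun n => by push_cast; rfl)
    (summable_norm_powerSum (C := 1) (fun n => by exact_mod_cast hb (n + 1)) hv).of_norm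
  have h4 : powerSum (binomCoeff 𝕜 j) (-w ^ 2) = powerSum (binomCoeff 𝕜 (j + 1)) (-w ^ 2)
      + 2 * powerSum (fun n : ℕ => (n : 𝕜) * binomCoeff 𝕜 (j + 1) n) (-w ^ 2) := by
    unfold powerSum
    rw [← tsum_mul_left, ← (summable_norm_powerSum (norm_binomCoeff_le _) hv).of_norm.tsum_add
      ((summable_norm_powerSum hb hv).of_norm.mul_left 2)]
    refine tsum_congr fun n => ?_
    rw [← hd]; ring
  rw [h4, ← h3]
  simp only [Function.comp_apply]
  ring

/-- The recursion (n+1) C(2n+2,n+1) = 2(2n+1) C(2n,n) says that 1/C(2n+2,n+1) = (1/4)(1 +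
1/(2n+1))/C(2n,n). Summed against (-w²)^(n+1), this is a first-order linear equation for B_1, whose
derivative is the first series. -/
lemma binomSum_ode {w : 𝕜} (hw : ‖w‖ < 1) :
    (1 + w ^ 2 / 4) * powerSum (binomCoeff 𝕜 0) (-w ^ 2) + w / 4 * binomSum 1 w = 1 := by
  have hv := norm_neg_sq_lt hw
  have s0 := (summable_norm_powerSum (norm_binomCoeff_le (𝕜 := 𝕜) 0) hv).of_norm
  have s1 := (summable_norm_powerSum (norm_binomCoeff_le (𝕜 := 𝕜) 1) hv).of_norm
  have h : powerSum (binomCoeff 𝕜 0) (-w ^ 2) = 1 + -w ^ 2 / 4 *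
      (powerSum (binomCoeff 𝕜 0) (-w ^ 2) + powerSum (binomCoeff 𝕜 1) (-w ^ 2)) := by
    unfold powerSum
    rw [← s0.tsum_add s1, ← tsum_mul_left]
    conv_lhs => rw [s0.tsum_eq_zero_add]
    congr 1
    · simp [binomCoeff]
    refine tsum_congr fun n => ?_
    have hn : ((n : 𝕜) + 1) ≠ 0 := by exact_mod_cast n.succ_ne_zero
    have hn2 := two_mul_add_one_ne_zero (𝕜 := 𝕜) n
    have hc : (Nat.centralBinom n : 𝕜) ≠ 0 := by exact_mod_cast Nat.centralBinom_ne_zero n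
    have hc' : (Nat.centralBinom (n + 1) : 𝕜) ≠ 0 := by
      exact_mod_cast Nat.centralBinom_ne_zero (n + 1)
    have hr : ((n : 𝕜) + 1) * (Nat.centralBinom (n + 1) : 𝕜)
        = 2 * (2 * n + 1) * (Nat.centralBinom n : 𝕜) := by
      exact_mod_cast Nat.succ_mul_centralBinom_succ n
    have he : (Nat.centralBinom (n + 1) : 𝕜)
        = 2 * (2 * n + 1) * (Nat.centralBinom n : 𝕜) / ((n : 𝕜) + 1) := by
      rw [eq_div_iff hn, ← hr]; ring
    unfold binomCoeff
    rw [he]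
    field_simp
    ring
  unfold binomSum
  linear_combination h

/-- Legendre's chi function. -/
noncomputable def chi (j : ℕ) (x : 𝕜) : 𝕜 := (pl j x - pl j (-x)) / 2

lemma chi_zero {j : ℕ} : chi j (0 : 𝕜) = 0 := by simp [chi]

lemma hasDerivAt_chi_one {x : 𝕜} (hx : ‖x‖ < 1) : HasDerivAt (chi 1) (1 / (1 - x ^ 2)) x := by
  have h1 := hasDerivAt_pl_one hx
  have h2 := (hasDerivAt_pl_one (x := -x) (by simpa)).comp x (hasDerivAt_neg x)
  refine ((h1.sub h2).div_const 2).congr_deriv ?_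
  have hx1 : 1 - x ≠ 0 := fun h => by
    rw [← sub_eq_zero.mp h, norm_one] at hx; exact lt_irrefl _ hx
  have hx2 : 1 + x ≠ 0 := fun h => by
    rw [eq_neg_of_add_eq_zero_right h, norm_neg, norm_one] at hx; exact lt_irrefl _ hx
  have hx3 : 1 - x ^ 2 ≠ 0 := by
    rw [show 1 - x ^ 2 = (1 - x) * (1 + x) by ring]; exact mul_ne_zero hx1 hx2
  rw [sub_neg_eq_add]
  field_simp
  ring

lemma hasDerivAt_chi_succ {j : ℕ} (hj : 1 ≤ j) {x : 𝕜} (hx : ‖x‖ < 1) (hx0 : x ≠ 0) :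
    HasDerivAt (chi (j + 1)) (chi j x / x) x := by
  have h1 := hasDerivAt_pl_succ hj hx hx0
  have h2 := (hasDerivAt_pl_succ hj (x := -x) (by simpa) (neg_ne_zero.mpr hx0)).comp x
    (hasDerivAt_neg x)
  refine ((h1.sub h2).div_const 2).congr_deriv ?_
  unfold chi
  field_simp

lemma hasDerivAt_pl_at_zero {j : ℕ} : HasDerivAt (pl (𝕜 := 𝕜) j) 1 0 := by
  have h := hasDerivAt_powerSum (norm_pl_coeff_le (𝕜 := 𝕜) j)
    (b := fun n => ((n : 𝕜) + 1) * (1 / ((n + 1 : ℕ) : 𝕜) ^ j)) (fun _ => rfl) (x := 0) (by simp)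
  refine h.congr_deriv ?_
  rw [powerSum_zero]
  simp

lemma hasDerivAt_chi_zero {j : ℕ} : HasDerivAt (chi (𝕜 := 𝕜) j) 1 0 := by
  have h2 := (show HasDerivAt (pl (𝕜 := 𝕜) j) 1 (-0) by
    rw [neg_zero]; exact hasDerivAt_pl_at_zero).comp (0 : 𝕜) (hasDerivAt_neg 0)
  exact ((hasDerivAt_pl_at_zero.sub h2).div_const 2).congr_deriv (by norm_num)

lemma continuousAt_chi {j : ℕ} {x : 𝕜} (hx : ‖x‖ < 1) : ContinuousAt (chi j) x := by
  have h2 : ContinuousAt (fun y : 𝕜 => pl j (-y)) x :=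
    ContinuousAt.comp' (continuousAt_pl j (by simpa)) continuousAt_neg
  exact ((continuousAt_pl j hx).sub h2).div_const 2

variable {c : ℝ}

lemma lt_one_of_quadratic (hc0 : 0 < c) (hc : 4 * c + c ^ 2 = 1) : c < 1 := by nlinarith

lemma one_sub_sq_ne_zero {x : 𝕜} (hx : ‖x‖ < 1) : 1 - x ^ 2 ≠ 0 := fun h => by
  have h1 : ‖x ^ 2‖ = 1 := by rw [← sub_eq_zero.mp h, norm_one]
  rw [norm_pow] at h1
  nlinarith [norm_nonneg x]

lemma one_add_sq_ne_zero {x : 𝕜} (hx : ‖x‖ < 1) : 1 + x ^ 2 ≠ 0 := fun h => by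
  have h1 : ‖x ^ 2‖ = 1 := by rw [eq_neg_of_add_eq_zero_right h, norm_neg, norm_one]
  rw [norm_pow] at h1
  nlinarith [norm_nonneg x]

lemma norm_four_mul_div_le {x : 𝕜} (hx : ‖x‖ < 1) :
    ‖4 * x / (1 - x ^ 2)‖ ≤ 4 * ‖x‖ / (1 - ‖x‖ ^ 2) := by
  have h1 : 0 < 1 - ‖x‖ ^ 2 := by nlinarith [norm_nonneg x]
  have h2 : 1 - ‖x‖ ^ 2 ≤ ‖1 - x ^ 2‖ := by
    have := norm_sub_norm_le (1 : 𝕜) (x ^ 2)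
    rwa [norm_one, norm_pow] at this
  rw [norm_div, norm_mul, RCLike.norm_ofNat]
  gcongr

/-- The equation for `c` says 4c/(1-c²) = 1, and r ↦ 4r/(1-r²) increases on [0,1). -/
lemma norm_four_mul_div_lt_one (hc0 : 0 < c) (hc : 4 * c + c ^ 2 = 1) {x : 𝕜} (hx : ‖x‖ < c) :
    ‖4 * x / (1 - x ^ 2)‖ < 1 := by
  have hx1 := hx.trans (lt_one_of_quadratic hc0 hc)
  refine (norm_four_mul_div_le hx1).trans_lt ?_
  rw [div_lt_one (by nlinarith [norm_nonneg x])]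
  nlinarith [norm_nonneg x]

lemma hasDerivAt_four_mul_div {x : 𝕜} (hx : 1 - x ^ 2 ≠ 0) :
    HasDerivAt (fun x : 𝕜 => 4 * x / (1 - x ^ 2)) (4 * (1 + x ^ 2) / (1 - x ^ 2) ^ 2) x := by
  have h1 : HasDerivAt (fun x : 𝕜 => 1 - x ^ 2) (-(2 * x)) x :=
    ((hasDerivAt_pow 2 x).const_sub 1).congr_deriv (by simp)
  refine (((hasDerivAt_id' x).const_mul 4).fun_div h1 hx).congr_deriv ?_
  field_simp
  ring

/-- Since 1 + w²/4 = ((1+x²)/(1-x²))², its square root (1+x²)/(1-x²) is a rational integrating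
factor for `binomSum_ode`, and the product has derivative 4/(1-x²) = 4 χ_1'(x). -/
lemma binomSum_one_eq_chi (hc0 : 0 < c) (hc : 4 * c + c ^ 2 = 1) {x : 𝕜} (hx : ‖x‖ < c) :
    binomSum 1 (4 * x / (1 - x ^ 2)) * ((1 + x ^ 2) / (1 - x ^ 2)) = 4 * chi 1 x := by
  have hc1 := lt_one_of_quadratic hc0 hc
  have key := eq_of_hasDerivAt_zero_ball (c := c)
    (f := fun x : 𝕜 => binomSum 1 (4 * x / (1 - x ^ 2)) * ((1 + x ^ 2) / (1 - x ^ 2)) - 4 * chi 1 x)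
    (fun y hy => ?_) hx
  · rw [sub_eq_iff_eq_add] at key
    rw [key]
    simp [chi_zero, binomSum]
  · have hy1 := hy.trans hc1
    have h1 := one_sub_sq_ne_zero hy1
    have hw := norm_four_mul_div_lt_one hc0 hc hy
    have d1 := (hasDerivAt_binomSum 0 hw).comp y (hasDerivAt_four_mul_div h1)
    have h3 : HasDerivAt (fun x : 𝕜 => 1 - x ^ 2) (-(2 * y)) y :=
      ((hasDerivAt_pow 2 y).const_sub 1).congr_deriv (by simp)
    have h4 : HasDerivAt (fun x : 𝕜 => 1 + x ^ 2) (2 * y) y :=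
      ((hasDerivAt_pow 2 y).const_add 1).congr_deriv (by simp)
    refine ((d1.mul (h4.fun_div h3 h1)).sub ((hasDerivAt_chi_one hy1).const_mul 4)).congr_deriv ?_
    have ode := binomSum_ode hw
    simp only [Function.comp_apply]
    generalize powerSum (binomCoeff 𝕜 0) (-(4 * y / (1 - y ^ 2)) ^ 2) = A at *
    generalize binomSum 1 (4 * y / (1 - y ^ 2)) = B at *
    have ode' : (1 + y ^ 2) ^ 2 * A + (1 - y ^ 2) * y * B - (1 - y ^ 2) ^ 2 = 0 := by
      field_simp at ode
      linear_combination ode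
    field_simp
    linear_combination 4 * ode'

lemma hasDerivAt_binomSum_comp (hc0 : 0 < c) (hc : 4 * c + c ^ 2 = 1) (j : ℕ) {x : 𝕜}
    (hx : ‖x‖ < c) (hx0 : x ≠ 0) :
    HasDerivAt (fun x : 𝕜 => binomSum (j + 1) (4 * x / (1 - x ^ 2)))
      (binomSum j (4 * x / (1 - x ^ 2)) * ((1 + x ^ 2) / (x * (1 - x ^ 2)))) x := by
  have h1 := one_sub_sq_ne_zero (hx.trans (lt_one_of_quadratic hc0 hc))
  have hw := norm_four_mul_div_lt_one hc0 hc hx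
  refine ((hasDerivAt_binomSum j hw).comp x (hasDerivAt_four_mul_div h1)).congr_deriv ?_
  unfold binomSum
  field_simp

lemma binomSum_two_eq_chi (hc0 : 0 < c) (hc : 4 * c + c ^ 2 = 1) {x : 𝕜} (hx : ‖x‖ < c) :
    binomSum 2 (4 * x / (1 - x ^ 2)) = 4 * chi 2 x := by
  have hc1 := lt_one_of_quadratic hc0 hc
  have key := eq_of_hasDerivAt_zero_ball (c := c)
    (f := fun x : 𝕜 => binomSum 2 (4 * x / (1 - x ^ 2)) - 4 * chi 2 x)
    (fun y hy => ?_) hx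
  · rw [sub_eq_iff_eq_add] at key
    rw [key]
    simp [chi_zero, binomSum]
  · have hy1 := hy.trans hc1
    have h1 := one_sub_sq_ne_zero hy1
    have h2 := one_add_sq_ne_zero hy1
    -- The derivative formulas divide by x, so the origin is separate; there both terms have
    -- derivative 4.
    by_cases hy0 : y = 0
    · subst hy0
      have hw := norm_four_mul_div_lt_one hc0 hc hy
      refine (((hasDerivAt_binomSum 1 hw).comp 0 (hasDerivAt_four_mul_div h1)).sub
        (hasDerivAt_chi_zero.const_mul 4)).congr_deriv ?_
      simp [powerSum_zero, binomCoeff]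
    · refine ((hasDerivAt_binomSum_comp hc0 hc 1 hy hy0).sub
        ((hasDerivAt_chi_succ le_rfl hy1 hy0).const_mul 4)).congr_deriv ?_
      have h3 := binomSum_one_eq_chi hc0 hc hy
      have h4 : chi 1 y = binomSum 1 (4 * y / (1 - y ^ 2)) * ((1 + y ^ 2) / (1 - y ^ 2)) / 4 := by
        rw [h3]; ring
      rw [h4]
      field_simp
      ring

lemma hasDerivAt_binomSum_three (hc0 : 0 < c) (hc : 4 * c + c ^ 2 = 1) {x : 𝕜}
    (hx : ‖x‖ < c) (hx0 : x ≠ 0) :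
    HasDerivAt (fun x : 𝕜 => binomSum 3 (4 * x / (1 - x ^ 2)))
      (4 * chi 2 x * ((1 + x ^ 2) / (x * (1 - x ^ 2)))) x := by
  rw [← binomSum_two_eq_chi hc0 hc hx]
  exact hasDerivAt_binomSum_comp hc0 hc 2 hx hx0

lemma continuousOn_binomSum_three :
    ContinuousOn (binomSum (𝕜 := 𝕜) 3) (Metric.closedBall 0 1) := by
  refine continuousOn_id.mul ((continuousOn_powerSum (summable_binomCoeff (by norm_num))).comp
    (by fun_prop) fun w hw => ?_)
  have hw' : ‖w‖ ≤ 1 := by simpa using hw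
  simpa using hw'

end CentralBinomial

/-! ### The closed form at w = 1. -/

section GoldenRatio

open Filter Topology

/-- A function with vanishing derivative on `(0, c)` has equal limits at both ends. -/
lemma eq_of_hasDerivAt_zero_of_tendsto {f : ℝ → ℝ} {c l r : ℝ} (hc : 0 < c)
    (hd : ∀ x ∈ Set.Ioo 0 c, HasDerivAt f 0 x) (hl : Tendsto f (𝓝[>] 0) (𝓝 l))
    (hr : Tendsto f (𝓝[<] c) (𝓝 r)) : r = l := by
  refine tendsto_nhds_unique hr (tendsto_const_nhds.congr' ?_)
  filter_upwards [Ioo_mem_nhdsLT hc] with x hx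
  exact (eq_of_hasDerivAt_zero hd hl hx).symm

/-- The right side, as a function of x in place of c, is a primitive of 4 χ_2(x)(1/x + 2x/(1-x²)).
The 1/x part gives 4 χ_3. Parts on the other leaves 2∫(log²(1+x) - log²(1-x))dx/x, whose primitives
are the polylogarithms at 1-x and 1/(1+x). At x = 0 the two copies of 4 Li_3(1) cancel. -/
lemma binomSum_three_one {c : ℝ} (hc0 : 0 < c) (hc : 4 * c + c ^ 2 = 1) :
    binomSum 3 (1 : ℝ) = 4 * chi 3 c - 4 * ((Real.log (1 - c) + Real.log (1 + c)) * chi 2 c)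
      - 2 * (Real.log c * (Real.log (1 - c) ^ 2 - Real.log (1 + c) ^ 2))
      - 4 * (Real.log (1 - c) * pl 2 (1 - c)) + 4 * pl 3 (1 - c) - 4 / 3 * Real.log (1 + c) ^ 3
      - 4 * (Real.log (1 + c) * pl 2 (1 / (1 + c))) - 4 * pl 3 (1 / (1 + c)) := by
  have hc1 := lt_one_of_quadratic hc0 hc
  have hj : 2 ≤ 3 := by norm_num
  set f : ℝ → ℝ := fun x => binomSum 3 (4 * x / (1 - x ^ 2))
    - (4 * chi 3 x - 4 * ((Real.log (1 - x) + Real.log (1 + x)) * chi 2 x)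
      - 2 * (Real.log x * (Real.log (1 - x) ^ 2 - Real.log (1 + x) ^ 2))
      - 4 * (Real.log (1 - x) * pl 2 (1 - x)) + 4 * pl 3 (1 - x) - 4 / 3 * Real.log (1 + x) ^ 3
      - 4 * (Real.log (1 + x) * pl 2 (1 / (1 + x))) - 4 * pl 3 (1 / (1 + x))) with hf
  have key := eq_of_hasDerivAt_zero_of_tendsto (f := f) (l := 0 - (4 * 0 - 4 * 0 - 2 * 0
      - 4 * (0 * pl 2 1) + 4 * pl 3 1 - 0 - 4 * (0 * pl 2 1) - 4 * pl 3 1)) (r := f c) hc0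
      (fun x hx => ?_) ?_ ?_
  · rw [hf] at key
    simp only [show 4 * c / (1 - c ^ 2) = 1 by
      rw [div_eq_one_iff_eq (by nlinarith)]; linarith] at key
    linarith
  · have hx0 := hx.1
    have hx1 := hx.2.trans hc1
    have hA : 0 < 1 - x := by linarith
    have hB : 0 < 1 + x := by linarith
    have hn : ‖x‖ < 1 := by rwa [Real.norm_eq_abs, abs_of_pos hx0]
    have hnc : ‖x‖ < c := by rw [Real.norm_eq_abs, abs_of_pos hx0]; exact hx.2
    have dA : HasDerivAt (fun v : ℝ => 1 - v) (-1) x := (hasDerivAt_id' x).const_sub 1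
    have dB : HasDerivAt (fun v : ℝ => 1 + v) 1 x := (hasDerivAt_id' x).const_add 1
    have lA := dA.log hA.ne'
    have lB := dB.log hB.ne'
    have e0 := hasDerivAt_binomSum_three hc0 hc hnc hx0.ne'
    have e1 := hasDerivAt_chi_succ (j := 2) (by norm_num) hn hx0.ne'
    have e2 := hasDerivAt_chi_succ (j := 1) le_rfl hn hx0.ne'
    have p1 : HasDerivAt (fun v : ℝ => 1 - v) ((1 - x) * (-1 / (1 - x))) x :=
      dA.congr_deriv (by field_simp)
    have p2 : HasDerivAt (fun v : ℝ => 1 / (1 + v)) (1 / (1 + x) * (-(1 / (1 + x)))) x :=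
      ((hasDerivAt_const x (1 : ℝ)).fun_div dB hB.ne').congr_deriv (by field_simp; ring)
    have b1 : |1 - x| < 1 := by rw [abs_of_pos hA]; linarith
    have b2 : |1 / (1 + x)| < 1 := by
      rw [abs_of_pos (by positivity), div_lt_one hB]; linarith
    have e3 := hasDerivAt_pl_two_comp p1 b1 hA.ne'
    have e4 := hasDerivAt_pl_three_comp p1 b1 hA.ne'
    have e5 := hasDerivAt_pl_two_comp p2 b2 (by positivity)
    have e6 := hasDerivAt_pl_three_comp p2 b2 (by positivity)
    have l1 : Real.log (1 - 1 / (1 + x)) = Real.log x - Real.log (1 + x) := by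
      rw [← Real.log_div hx0.ne' hB.ne']; congr 1; field_simp; ring
    have l2 : chi 1 x = (Real.log (1 + x) - Real.log (1 - x)) / 2 := by
      rw [chi, pl_one_eq_neg_log hn, pl_one_eq_neg_log (x := -x) (by rwa [abs_neg]), sub_neg_eq_add]
      ring
    refine (e0.sub ((((((((e1.const_mul 4).sub (((lA.add lB).mul e2).const_mul 4)).sub
      (((Real.hasDerivAt_log hx0.ne').mul ((lA.pow 2).sub (lB.pow 2))).const_mul 2)).sub
      ((lA.mul e3).const_mul 4)).add (e4.const_mul 4)).sub ((lB.pow 3).const_mul (4 / 3))).sub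
      ((lB.mul e5).const_mul 4)).sub (e6.const_mul 4))).congr_deriv ?_
    rw [l1, l2, sub_sub_cancel]
    simp only [Pi.sub_apply, Pi.add_apply, Pi.pow_apply]
    have h1 : (1 + x ^ 2) / (x * (1 - x ^ 2)) = 1 / x - (-1 / (1 - x) + 1 / (1 + x)) := by
      have : 1 - x ^ 2 ≠ 0 := by nlinarith
      field_simp
      ring
    rw [h1]
    push_cast
    ring_nf
  · refine (tendsto_nhdsGT_zero ?_ ?_).sub ((((((((tendsto_nhdsGT_zero ?_ ?_).const_mul 4).sub
      ((tendsto_nhdsGT_zero ?_ ?_).const_mul 4)).sub ((tendsto_log_mul_nhdsGT_zero ?_ ?_).const_mul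
      2)).sub (((tendsto_nhdsGT_zero ?_ ?_).mul (tendsto_pl_nhdsGT_zero le_rfl ?_ ?_ one_pos
      ?_)).const_mul 4)).add ((tendsto_pl_nhdsGT_zero hj ?_ ?_ one_pos ?_).const_mul 4)).sub
      (tendsto_nhdsGT_zero ?_ ?_)).sub (((tendsto_nhdsGT_zero ?_ ?_).mul
      (tendsto_pl_nhdsGT_zero le_rfl ?_ ?_ one_pos ?_)).const_mul 4) |>.sub
      ((tendsto_pl_nhdsGT_zero hj ?_ ?_ one_pos ?_).const_mul 4))
    · refine ContinuousAt.comp' (f := fun x : ℝ => 4 * x / (1 - x ^ 2)) (g := binomSum 3)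
        (HasDerivAt.continuousAt (hasDerivAt_binomSum 2 (by simp))) ?_
      exact ContinuousAt.div (by fun_prop) (by fun_prop) (by norm_num)
    · simp [binomSum]
    · exact continuousAt_chi (by simp)
    · exact chi_zero
    · have h1 : ContinuousAt (fun u : ℝ => Real.log (1 + u)) 0 :=
        ContinuousAt.log (by fun_prop) (by norm_num)
      have h2 : ContinuousAt (fun u : ℝ => Real.log (1 - u)) 0 :=
        ContinuousAt.log (by fun_prop) (by norm_num)
      exact (h2.add h1).mul (continuousAt_chi (by simp))
    · simp
    · have h1 : DifferentiableAt ℝ (fun u : ℝ => Real.log (1 - u)) 0 :=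
        DifferentiableAt.log (by fun_prop) (by norm_num)
      have h2 : DifferentiableAt ℝ (fun u : ℝ => Real.log (1 + u)) 0 :=
        DifferentiableAt.log (by fun_prop) (by norm_num)
      fun_prop
    · simp
    · exact ContinuousAt.log (by fun_prop) (by norm_num)
    · simp
    · fun_prop
    · simp
    · intro u hu hu1
      rw [abs_of_pos (by linarith)]; linarith
    · fun_prop
    · simp
    · intro u hu hu1
      rw [abs_of_pos (by linarith)]; linarith
    · exact ((ContinuousAt.log (by fun_prop) (by norm_num)).pow 3).const_mul (4 / 3)
    · simp
    · exact ContinuousAt.log (by fun_prop) (by norm_num)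
    · simp
    · exact ContinuousAt.div (by fun_prop) (by fun_prop) (by norm_num)
    · simp
    · intro u hu hu1
      rw [abs_of_pos (by positivity), div_le_one (by positivity)]; linarith
    · exact ContinuousAt.div (by fun_prop) (by fun_prop) (by norm_num)
    · simp
    · intro u hu hu1
      rw [abs_of_pos (by positivity), div_le_one (by positivity)]; linarith
  -- The point x = c corresponds to w = 1, where only continuity of B_3 on the closed unit disc is
  -- available.
  · refine Tendsto.sub ?_ (ContinuousAt.tendsto ?_ |>.mono_left nhdsWithin_le_nhds)
    · have hw : 4 * c / (1 - c ^ 2) = 1 := by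
        rw [div_eq_one_iff_eq (by nlinarith)]; linarith
      have h1 := (continuousOn_binomSum_three (𝕜 := ℝ)).continuousWithinAt
        (x := 4 * c / (1 - c ^ 2)) (by rw [hw]; simp)
      refine h1.tendsto.comp (tendsto_nhdsWithin_iff.mpr ⟨?_, ?_⟩)
      · refine (ContinuousAt.tendsto (f := fun x : ℝ => 4 * x / (1 - x ^ 2)) ?_).mono_left
          nhdsWithin_le_nhds
        exact ContinuousAt.div (by fun_prop) (by fun_prop) (by nlinarith)
      · filter_upwards [Ioo_mem_nhdsLT hc0] with x hx
        have := (norm_four_mul_div_lt_one hc0 hc (x := x)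
          (by rw [Real.norm_eq_abs, abs_of_pos hx.1]; exact hx.2)).le
        simpa using this
    · have hn : ‖c‖ < 1 := by rwa [Real.norm_eq_abs, abs_of_pos hc0]
      have hA : 0 < 1 - c := by linarith
      have hB : 0 < 1 + c := by linarith
      have h1 : ContinuousAt (fun u : ℝ => Real.log (1 - u)) c :=
        ContinuousAt.log (by fun_prop) hA.ne'
      have h2 : ContinuousAt (fun u : ℝ => Real.log (1 + u)) c :=
        ContinuousAt.log (by fun_prop) hB.ne'
      have h3 : ContinuousAt (fun u : ℝ => Real.log u) c := Real.continuousAt_log hc0.ne'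
      have h4 : ∀ j, ContinuousAt (fun u : ℝ => pl j (1 - u)) c := fun j =>
        ContinuousAt.comp' (f := fun u : ℝ => 1 - u)
          (continuousAt_pl j (by rw [Real.norm_eq_abs, abs_of_pos hA]; linarith)) (by fun_prop)
      have h5 : ∀ j, ContinuousAt (fun u : ℝ => pl j (1 / (1 + u))) c := fun j =>
        ContinuousAt.comp' (f := fun u : ℝ => 1 / (1 + u))
          (continuousAt_pl j (by
            rw [Real.norm_eq_abs, abs_of_pos (by positivity), div_lt_one hB]; linarith))
          (ContinuousAt.div (by fun_prop) (by fun_prop) hB.ne')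
      have h6 : ContinuousAt (chi 3 : ℝ → ℝ) c := continuousAt_chi hn
      have h7 : ContinuousAt (chi 2 : ℝ → ℝ) c := continuousAt_chi hn
      have h42 := h4 2
      have h43 := h4 3
      have h52 := h5 2
      have h53 := h5 3
      fun_prop

/-- The evaluation in terms of real polylogarithms at powers of `u = 1 / φ`. -/
lemma binomSum_three_one_eq {u : ℝ} (h0 : 0 < u) (hu : u ^ 2 = 1 - u) :
    binomSum 3 (1 : ℝ) = -(4 / 3) * pl 3 (u ^ 3) + 4 * pl 2 (u ^ 3) * Real.log u + pl 3 u
      + 25 / 3 * Real.log u ^ 3 + 6 * Real.log 2 * Real.log u ^ 2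
      - Real.pi ^ 2 / 10 * Real.log u + 12 / 5 * pl 3 1 - Real.pi ^ 2 / 3 * Real.log 2 := by
  have h1 : u < 1 := by nlinarith
  have hh : 1 / 2 < u := by nlinarith
  have hc : u ^ 3 = 2 * u - 1 := by linear_combination (u - 1) * hu
  have hc0 : 0 < u ^ 3 := by positivity
  have hc1 : u ^ 3 < 1 := by linarith
  have a1 : 1 + u = u⁻¹ := by field_simp; linarith
  have a2 : 1 - u = u ^ 2 := hu.symm
  have a3 : 1 + u + u ^ 2 = 2 := by linarith
  have a4 : 1 - u ^ 3 = 2 * u ^ 2 := by linarith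
  have a5 : 1 + u ^ 3 = 2 * u := by linarith
  have a6 : 1 - u ^ 2 = u := by linarith
  have a7 : u / u⁻¹ ^ 2 = u ^ 3 := by field_simp
  have a8 : u ^ 2 / u⁻¹ = u ^ 3 := by field_simp
  have a9 : 2 / u⁻¹ ^ 2 = 2 * u ^ 2 := by field_simp
  have a10 : u * u⁻¹ / 2 = 1 / 2 := by field_simp
  have a11 : u⁻¹ / 2 = 1 / (2 * u) := by field_simp
  have a12 : u ^ 2 / u = u := by field_simp
  have a13 : 1 / u⁻¹ = u := by field_simp
  have l4 : Real.log (2 * u ^ 2) = Real.log 2 + 2 * Real.log u := by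
    rw [Real.log_mul (by norm_num) (by positivity), Real.log_pow]; norm_num
  have l5 : Real.log (2 * u) = Real.log 2 + Real.log u := by
    rw [Real.log_mul (by norm_num) (by positivity)]
  have main := binomSum_three_one hc0 (by nlinarith)
  -- At this u the arguments of Kummer's equation are 1/(2u), 2u², ±u³ and 1/2, and those of the χ_3
  -- equation are ±u³, u² and u. Landen at u² with duplication at u determines Li_3(u²), and Landen
  -- at 1/2 determines Li_3(1/2).
  have kum := pl_three_kummer h0 h1
  have chi3 := pl_three_chi h0 h1
  have lan3 := pl_three_landen (x := u ^ 2) (by positivity) (by linarith)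
  have dup3 := pl_add_pl_neg (𝕜 := ℝ) (j := 3) (by norm_num) (x := u)
    (by rw [Real.norm_eq_abs, abs_of_pos h0]; exact h1.le)
  have half := pl_three_landen (x := 1 / 2) (by norm_num) le_rfl
  have chi2 := pl_two_chi h0 h1
  have ref2 := pl_two_reflection h0 h1
  have lan2 := pl_two_landen (x := u ^ 2) (by positivity) (by linarith)
  have dup2 := pl_add_pl_neg (𝕜 := ℝ) (j := 2) le_rfl (x := u)
    (by rw [Real.norm_eq_abs, abs_of_pos h0]; exact h1.le)
  have refc := pl_two_reflection hc0 hc1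
  have invc := pl_two_one_div_one_add hc0 hc1
  rw [a3] at kum
  simp only [a1, a7, a8, a9, a10, a11] at kum
  simp only [a6, a2, a1, a13, show u ^ 2 / u⁻¹ = u ^ 3 from a8] at chi3 chi2 ref2
  simp only [a6, a12, Real.log_pow] at lan3 lan2
  simp only [show (1 : ℝ) - 1 / 2 = 1 / 2 by norm_num,
    show (1 : ℝ) / 2 / (1 / 2) = 1 by norm_num, pl_three_neg_one] at half
  simp only [a4, a5, l4, l5, Real.log_pow] at refc invc main
  simp only [Real.log_inv, Real.log_pow] at kum chi3 chi2 ref2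
  rw [one_div, Real.log_inv] at half
  rw [← one_div] at half
  unfold chi at main
  rw [refc, invc] at main
  generalize pl 3 (2 * u ^ 2) = t1 at *
  generalize pl 3 (1 / (2 * u)) = t2 at *
  generalize pl 3 (u ^ 3) = t3 at *
  generalize pl 3 (-u ^ 3) = t4 at *
  generalize pl 3 (1 / 2 : ℝ) = t5 at *
  generalize pl 3 u = t6 at *
  generalize pl 3 (-u) = t7 at *
  generalize pl 3 (u ^ 2) = t8 at *
  generalize pl 3 (1 : ℝ) = z3 at *
  generalize pl 2 (u ^ 3) = d1 at *
  generalize pl 2 (-u ^ 3) = d2 at *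
  generalize pl 2 u = d3 at *
  generalize pl 2 (-u) = d4 at *
  generalize pl 2 (u ^ 2) = d5 at *
  generalize Real.log u = L at *
  generalize Real.log 2 = M at *
  generalize Real.pi = p at *
  push_cast at *
  -- The weight-two relations determine Li_2(±u), so the χ_2 equation ties Li_2(-u³) to Li_2(u³).
  -- The rest is linear elimination.
  have hd2 : d2 = d1 - (p ^ 2 / 12 - 3 / 2 * L ^ 2) := by linarith
  rw [main, hd2]
  linarith

end GoldenRatio

/-! ### Iterated integrals with roots of unity as letters, and their Taylor coefficients. -/

section CyclotomicValues

open Filter Topology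

/-- The coefficients of the iterated integral of the forms `a ds / (1 - a s)`, `a ∈ w`. -/
noncomputable def iterCoeff : List ℂ → ℕ → ℂ
  | [] => fun n => if n = 0 then 1 else 0
  | a :: w => fun n => (∑ m ∈ Finset.range n, a ^ (n - m) * iterCoeff w m) / n

/-- The iterated integral from `0` to `s` of the forms `a ds / (1 - a s)`, `a ∈ w`. -/
noncomputable def iterSum (w : List ℂ) : ℂ → ℂ := powerSum (iterCoeff w)

lemma norm_iterCoeff_le {w : List ℂ} (hw : ∀ a ∈ w, ‖a‖ = 1) (n : ℕ) : ‖iterCoeff w n‖ ≤ 1 := by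
  induction w generalizing n with
  | nil => unfold iterCoeff; split_ifs <;> simp
  | cons a w ih =>
    have ih' := ih fun b hb => hw b (List.mem_cons_of_mem _ hb)
    have ha : ‖a‖ = 1 := hw a List.mem_cons_self
    unfold iterCoeff
    rw [norm_div, Complex.norm_natCast]
    refine div_le_one_of_le₀ ?_ (Nat.cast_nonneg n)
    refine (norm_sum_le_of_le (Finset.range n) (f := fun m => a ^ (n - m) * iterCoeff w m)
      (n := fun _ => 1) fun m _ => ?_).trans (by simp)
    rw [norm_mul, norm_pow, ha, one_pow, one_mul]
    exact ih' m

lemma iterSum_nil (s : ℂ) : iterSum [] s = 1 := by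
  unfold iterSum powerSum
  rw [tsum_eq_single 0 (fun n hn => by simp [iterCoeff, hn])]
  simp [iterCoeff]

lemma iterSum_cons_zero (a : ℂ) (w : List ℂ) : iterSum (a :: w) 0 = 0 := by
  rw [iterSum, powerSum_zero]
  simp [iterCoeff]

/-- The recursion in `iterCoeff` is the Cauchy product with a/(1-as) = ∑ a^(k+1) s^k followed by
termwise integration. -/
lemma hasDerivAt_iterSum {a : ℂ} {w : List ℂ} (ha : ‖a‖ = 1) (hw : ∀ b ∈ w, ‖b‖ = 1) {s : ℂ}
    (hs : ‖s‖ < 1) : HasDerivAt (iterSum (a :: w)) (a / (1 - a * s) * iterSum w s) s := by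
  have hc := norm_iterCoeff_le hw
  have has : ‖a * s‖ < 1 := by rwa [norm_mul, ha, one_mul]
  have h := hasDerivAt_powerSum
    (norm_iterCoeff_le (w := a :: w) (List.forall_mem_cons.mpr ⟨ha, hw⟩))
    (b := fun n => a * ∑ m ∈ Finset.range (n + 1), a ^ (n - m) * iterCoeff w m) (fun n => ?_) hs
  · refine h.congr_deriv ?_
    have h1 : Summable fun n => ‖(a * s) ^ n‖ := by
      simp_rw [norm_pow]
      exact summable_geometric_of_lt_one (norm_nonneg _) has
    have h2 := summable_norm_powerSum hc hs
    have h3 := tsum_mul_tsum_eq_tsum_sum_range_of_summable_norm h2 h1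
    rw [tsum_geometric_of_norm_lt_one has] at h3
    rw [iterSum, div_eq_mul_inv, mul_assoc, mul_comm (1 - a * s)⁻¹]
    unfold powerSum
    rw [h3, ← tsum_mul_left]
    refine tsum_congr fun n => ?_
    rw [mul_assoc, Finset.sum_mul]
    congr 1
    refine Finset.sum_congr rfl fun m hm => ?_
    have hm' : m ≤ n := Nat.lt_succ_iff.mp (Finset.mem_range.mp hm)
    rw [mul_pow]
    rw [show s ^ n = s ^ m * s ^ (n - m) by rw [← pow_add]; congr 1; omega]
    ring
  · have hn : (n : ℂ) + 1 ≠ 0 := by exact_mod_cast n.succ_ne_zero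
    simp only [iterCoeff]
    push_cast
    rw [mul_div_cancel₀ _ hn, Finset.mul_sum]
    refine Finset.sum_congr rfl fun m hm => ?_
    have hm' : m ≤ n := Nat.lt_succ_iff.mp (Finset.mem_range.mp hm)
    rw [show n + 1 - m = (n - m) + 1 by omega, pow_succ]
    ring

/-- The index list of the multiple polylogarithm attached to a word of letters. -/
noncomputable def ratioIndex : ℂ → List ℂ → List (ℕ × ℂ)
  | _, [] => []
  | p, a :: w => (1, a / p) :: ratioIndex a w

/-- Since a^(n-m) b^m = a^n (b/a)^m, successive letters enter through their ratios. Thus words give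
multiple polylogarithms with every s_j = 1, the weight being the length. -/
lemma iterCoeff_eq {a : ℂ} {w : List ℂ} (ha : a ≠ 0) (hw : ∀ b ∈ w, b ≠ 0) (n : ℕ) :
    iterCoeff (a :: w) n = a ^ n / n * multiPolylogTrunc (ratioIndex a w) n := by
  induction w generalizing a n with
  | nil =>
    rcases Nat.eq_zero_or_pos n with rfl | hn
    · simp [iterCoeff]
    · simp only [iterCoeff, ratioIndex, multiPolylogTrunc]
      simp [hn]
  | cons b w ih =>
    have hb := hw b List.mem_cons_self
    have ih' := fun m => ih hb (fun c hc => hw c (List.mem_cons_of_mem _ hc)) m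
    rw [iterCoeff]
    simp_rw [ih']
    simp only [ratioIndex, multiPolylogTrunc]
    rw [div_mul_eq_mul_div, Finset.mul_sum]
    congr 1
    rcases Nat.eq_zero_or_pos n with rfl | hn
    · simp
    rw [Finset.range_eq_Ico, Finset.sum_eq_sum_Ico_succ_bot hn]
    simp only [Nat.cast_zero, div_zero, zero_mul, mul_zero, zero_add]
    refine Finset.sum_congr rfl fun m hm => ?_
    have hm' := Finset.mem_Ico.mp hm
    nth_rewrite 2 [show n = n - m + m by omega]
    rw [pow_add, div_pow, pow_one]
    field_simp

lemma multiPolylogTrunc_ratioIndex {a : ℂ} {w : List ℂ} (ha : a ≠ 0) (hw : ∀ b ∈ w, b ≠ 0)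
    (M : ℕ) : multiPolylogTrunc (ratioIndex 1 (a :: w)) M
      = ∑ n ∈ Finset.range M, iterCoeff (a :: w) n := by
  simp_rw [iterCoeff_eq ha hw]
  simp only [ratioIndex, multiPolylogTrunc]
  rcases Nat.eq_zero_or_pos M with rfl | hM
  · simp
  rw [Finset.range_eq_Ico, Finset.sum_eq_sum_Ico_succ_bot hM]
  simp

/-! ### Convergence at 1 by Dirichlet's test, and Abel limits. -/

/-- The constant 3 leaves slack: the induction step squares to 9n(n+1) ≥ (3n+1)², that is 3n ≥ 1,
whereas with 2 it would just fail. -/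
lemma sum_one_div_sqrt_le (n : ℕ) :
    ∑ k ∈ Finset.Ico 1 n, 1 / Real.sqrt k ≤ 3 * Real.sqrt n := by
  induction n with
  | zero => simp
  | succ n ih =>
    rcases Nat.eq_zero_or_pos n with rfl | hn
    · simp
    rw [Finset.sum_Ico_succ_top hn]
    have hn' : (1 : ℝ) ≤ n := by exact_mod_cast hn
    have h1 : 0 < Real.sqrt n := Real.sqrt_pos.mpr (by linarith)
    have h2 : Real.sqrt n ^ 2 = n := Real.sq_sqrt (by linarith)
    have h3 : Real.sqrt (n + 1) ^ 2 = n + 1 := Real.sq_sqrt (by linarith)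
    have h4 : 0 ≤ Real.sqrt ((n : ℝ) + 1) := Real.sqrt_nonneg _
    have h5 : 3 * Real.sqrt n + 1 / Real.sqrt n ≤ 3 * Real.sqrt ((n : ℝ) + 1) := by
      rw [← sub_nonneg]
      have : 3 * Real.sqrt ((n : ℝ) + 1) - (3 * Real.sqrt n + 1 / Real.sqrt n)
        = (3 * Real.sqrt n * Real.sqrt ((n : ℝ) + 1) - (3 * n + 1)) / Real.sqrt n := by
        have h6 : 1 / Real.sqrt n * Real.sqrt n = 1 := by field_simp
        rw [eq_div_iff h1.ne']
        linear_combination -3 * h2 - h6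
      rw [this]
      refine div_nonneg ?_ h1.le
      rw [sub_nonneg]
      refine abs_le_of_sq_le_sq' ?_ (by positivity) |>.2
      nlinarith
    push_cast
    linarith

/-- The growth is really a power of log n; a multiple of √n is cruder, but is reproduced by
summation against 1/k, so the induction needs no exponents. -/
lemma norm_multiPolylogTrunc_le (l : List (ℕ × ℂ)) (hl : ∀ p ∈ l, p.1 = 1 ∧ ‖p.2‖ = 1) :
    ∃ C : ℝ, 0 ≤ C ∧ ∀ n : ℕ, 1 ≤ n → ‖multiPolylogTrunc l n‖ ≤ C * Real.sqrt n := by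
  induction l with
  | nil =>
    refine ⟨1, zero_le_one, fun n hn => ?_⟩
    simp only [multiPolylogTrunc, norm_one, one_mul]
    exact Real.one_le_sqrt.mpr (by exact_mod_cast hn)
  | cons p l ih =>
    obtain ⟨C, hC, h⟩ := ih fun q hq => hl q (List.mem_cons_of_mem _ hq)
    obtain ⟨h1, h2⟩ := hl p List.mem_cons_self
    refine ⟨C * 3, by positivity, fun n hn => ?_⟩
    rw [mul_assoc]
    refine le_trans ?_ (mul_le_mul_of_nonneg_left (sum_one_div_sqrt_le n) hC)
    rw [Finset.mul_sum, multiPolylogTrunc]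
    refine norm_sum_le_of_le _ fun k hk => ?_
    have hk1 := (Finset.mem_Ico.mp hk).1
    have hk' : (0 : ℝ) < k := by exact_mod_cast hk1
    rw [norm_mul, norm_div, norm_pow, norm_pow, h1, h2, Complex.norm_natCast, one_pow, pow_one]
    calc 1 / (k : ℝ) * ‖multiPolylogTrunc l k‖ ≤ 1 / (k : ℝ) * (C * Real.sqrt k) := by
          gcongr; exact h k hk1
      _ = C * (1 / Real.sqrt k) := by
          have : (k : ℝ) = Real.sqrt k * Real.sqrt k := (Real.mul_self_sqrt hk'.le).symm
          have h0 : Real.sqrt k ≠ 0 := (Real.sqrt_pos.mpr hk').ne'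
          rw [mul_comm C, ← mul_assoc]
          nth_rewrite 1 [this]
          field_simp

lemma norm_multiPolylogTrunc_succ_sub_le (l : List (ℕ × ℂ))
    (hl : ∀ p ∈ l, p.1 = 1 ∧ ‖p.2‖ = 1) :
    ∃ C : ℝ, 0 ≤ C ∧ ∀ n : ℕ, 1 ≤ n →
      ‖multiPolylogTrunc l (n + 1) - multiPolylogTrunc l n‖ ≤ C * (Real.sqrt n / n) := by
  cases l with
  | nil => exact ⟨0, le_rfl, fun n _ => by simp [multiPolylogTrunc]⟩
  | cons p l =>
    obtain ⟨C, hC, h⟩ := norm_multiPolylogTrunc_le l fun q hq => hl q (List.mem_cons_of_mem _ hq)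
    obtain ⟨h1, h2⟩ := hl p List.mem_cons_self
    refine ⟨C, hC, fun n hn => ?_⟩
    simp only [multiPolylogTrunc]
    rw [Finset.sum_Ico_succ_top hn, add_sub_cancel_left, norm_mul, norm_div, norm_pow, norm_pow,
      h1, h2, Complex.norm_natCast, one_pow, pow_one]
    calc 1 / (n : ℝ) * ‖multiPolylogTrunc l n‖ ≤ 1 / (n : ℝ) * (C * Real.sqrt n) := by
          gcongr; exact h n hn
      _ = C * (Real.sqrt n / n) := by ring

/-- **Dirichlet's test** for coefficients of bounded variation. -/
lemma cauchySeq_series_mul_of_summable_variation {b z : ℕ → ℂ} {B : ℝ}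
    (hb : Tendsto b atTop (𝓝 0)) (hv : Summable fun n => ‖b (n + 1) - b n‖)
    (hz : ∀ n, ‖∑ i ∈ Finset.range n, z i‖ ≤ B) :
    CauchySeq fun n => ∑ i ∈ Finset.range n, b i • z i := by
  rw [← cauchySeq_shift 1]
  simp_rw [Finset.sum_range_by_parts _ _ (Nat.succ _), sub_eq_add_neg, Nat.succ_sub_succ_eq_sub,
    tsub_zero]
  apply (NormedField.tendsto_zero_smul_of_tendsto_zero_of_bounded hb
    ⟨B, eventually_map.mpr <| Eventually.of_forall fun n ↦ hz <| n + 1⟩).cauchySeq.add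
  refine CauchySeq.neg ?_
  refine cauchySeq_range_of_norm_bounded (hv.mul_left B).hasSum.tendsto_sum_nat.cauchySeq
    fun n => ?_
  rw [norm_smul, mul_comm, ← sub_eq_add_neg]
  exact mul_le_mul_of_nonneg_right (hz _) (norm_nonneg _)

lemma tendsto_sqrt_div_nat : Tendsto (fun n : ℕ => Real.sqrt n / n) atTop (𝓝 0) := by
  have h := (tendsto_inv_atTop_zero.comp (Real.tendsto_sqrt_atTop.comp
    (tendsto_natCast_atTop_atTop (R := ℝ))))
  refine h.congr fun n => ?_
  simp [Real.sqrt_div_self]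

lemma summable_sqrt_div_sq : Summable fun n : ℕ => Real.sqrt n / (n : ℝ) ^ 2 := by
  refine (Real.summable_one_div_nat_rpow.mpr (by norm_num : (1 : ℝ) < 3 / 2)).congr fun n => ?_
  rcases Nat.eq_zero_or_pos n with rfl | hn
  · simp
  have hn' : (0 : ℝ) < n := by exact_mod_cast hn
  rw [Real.sqrt_eq_rpow, ← Real.rpow_natCast, ← Real.rpow_sub hn', one_div, ← Real.rpow_neg hn'.le]
  norm_num

/-- Dirichlet's test: the powers of a ≠ 1 have partial sums bounded by 2/|a-1|, and T(n)/n tends to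
0 with variation O(√n/n²), which is summable. Only the first letter must avoid 1. -/
lemma exists_tendsto_sum_iterCoeff {a : ℂ} {w : List ℂ} (ha : ‖a‖ = 1) (ha1 : a ≠ 1)
    (hw : ∀ b ∈ w, ‖b‖ = 1) :
    ∃ x, Tendsto (fun M => ∑ n ∈ Finset.range M, iterCoeff (a :: w) n) atTop (𝓝 x) := by
  have ne0 : ∀ {b : ℂ}, ‖b‖ = 1 → b ≠ 0 := fun hb h => by simp [h] at hb
  have hl : ∀ (u : List ℂ) (p : ℂ), ‖p‖ = 1 → (∀ b ∈ u, ‖b‖ = 1) →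
      ∀ q ∈ ratioIndex p u, q.1 = 1 ∧ ‖q.2‖ = 1 := by
    intro u
    induction u with
    | nil => intro p _ _ q hq; simp [ratioIndex] at hq
    | cons b u ih =>
      intro p hp hu q hq
      rw [ratioIndex, List.mem_cons] at hq
      have hb := hu b List.mem_cons_self
      rcases hq with rfl | hq
      · simp [hp, hb]
      · exact ih b hb (fun c hc => hu c (List.mem_cons_of_mem _ hc)) q hq
  set T := multiPolylogTrunc (ratioIndex a w)
  obtain ⟨C, hC, h1⟩ := norm_multiPolylogTrunc_le _ (hl w a ha hw)
  obtain ⟨D, hD, h2⟩ := norm_multiPolylogTrunc_succ_sub_le _ (hl w a ha hw)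
  have hcs := cauchySeq_series_mul_of_summable_variation (b := fun n => T n / n)
    (z := fun n => a ^ n) (B := 2 / ‖a - 1‖) ?_ ?_ ?_
  · obtain ⟨x, hx⟩ := cauchySeq_tendsto_of_complete hcs
    refine ⟨x, hx.congr fun M => Finset.sum_congr rfl fun n _ => ?_⟩
    rw [iterCoeff_eq (ne0 ha) (fun b hb => ne0 (hw b hb))]
    rw [smul_eq_mul]
    ring
  · refine squeeze_zero_norm' ?_ (by simpa using tendsto_sqrt_div_nat.const_mul C)
    filter_upwards [eventually_ge_atTop 1] with n hn
    rw [norm_div, Complex.norm_natCast, ← mul_div_assoc]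
    gcongr
    exact h1 n hn
  · refine Summable.of_norm_bounded_eventually_nat (summable_sqrt_div_sq.mul_left (C + D)) ?_
    filter_upwards [eventually_ge_atTop 1] with n hn
    have hn' : (0 : ℝ) < n := by exact_mod_cast hn
    have hn0 : (n : ℂ) ≠ 0 := by exact_mod_cast hn'.ne'
    have hn1 : (n : ℂ) + 1 ≠ 0 := by exact_mod_cast n.succ_ne_zero
    rw [norm_norm]
    have e : T (n + 1) / ((n + 1 : ℕ) : ℂ) - T n / n
        = (T (n + 1) - T n) / ((n + 1 : ℕ) : ℂ) - T n / (n * ((n + 1 : ℕ) : ℂ)) := by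
      push_cast
      field_simp
      ring
    rw [e]
    refine (norm_sub_le _ _).trans ?_
    rw [norm_div, norm_div, norm_mul, Complex.norm_natCast, Complex.norm_natCast]
    have i1 : ‖T (n + 1) - T n‖ / ((n + 1 : ℕ) : ℝ) ≤ D * (Real.sqrt n / n) / n := by
      gcongr
      · exact h2 n hn
      · exact Nat.le_succ n
    have i2 : ‖T n‖ / (n * ((n + 1 : ℕ) : ℝ)) ≤ C * Real.sqrt n / (n * n) := by
      gcongr
      · exact h1 n hn
      · exact Nat.le_succ n
    refine (add_le_add i1 i2).trans (le_of_eq ?_)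
    field_simp
    ring
  · intro n
    rw [geom_sum_eq ha1, norm_div]
    gcongr
    refine (norm_sub_le _ _).trans ?_
    rw [norm_pow, ha, one_pow, norm_one]
    norm_num

lemma norm_eq_one_of_pow_ten {a : ℂ} (ha : a ^ 10 = 1) : ‖a‖ = 1 :=
  Complex.norm_eq_one_of_pow_eq_one ha (by norm_num)

lemma iterCoeff_map_mul (ζ : ℂ) (w : List ℂ) (n : ℕ) :
    iterCoeff (w.map (ζ * ·)) n = ζ ^ n * iterCoeff w n := by
  induction w generalizing n with
  | nil => by_cases hn : n = 0 <;> simp [iterCoeff, hn]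
  | cons a w ih =>
    simp only [List.map_cons, iterCoeff, ih]
    rw [← mul_div_assoc, Finset.mul_sum]
    congr 1
    refine Finset.sum_congr rfl fun m hm => ?_
    have hm' := Finset.mem_range.mp hm
    rw [show ζ ^ n = ζ ^ (n - m) * ζ ^ m by rw [← pow_add]; congr 1; omega, mul_pow]
    ring

lemma iterSum_mul (ζ : ℂ) (w : List ℂ) (s : ℂ) :
    iterSum w (ζ * s) = iterSum (w.map (ζ * ·)) s := by
  unfold iterSum powerSum
  refine tsum_congr fun n => ?_
  rw [iterCoeff_map_mul, mul_pow]
  ring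

/-- The value at `1` of the iterated integral attached to a word. -/
noncomputable def iterValue (w : List ℂ) : ℂ :=
  limUnder atTop fun M => ∑ n ∈ Finset.range M, iterCoeff w n

lemma tendsto_iterValue {a : ℂ} {w : List ℂ} (ha : ‖a‖ = 1) (ha1 : a ≠ 1)
    (hw : ∀ b ∈ w, ‖b‖ = 1) :
    Tendsto (fun M => ∑ n ∈ Finset.range M, iterCoeff (a :: w) n) atTop
      (𝓝 (iterValue (a :: w))) :=
  tendsto_nhds_limUnder (exists_tendsto_sum_iterCoeff ha ha1 hw)

/-- Abel's theorem for iterated integrals. -/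
lemma tendsto_iterSum_stolzCone {a : ℂ} {w : List ℂ} (ha : ‖a‖ = 1) (ha1 : a ≠ 1)
    (hw : ∀ b ∈ w, ‖b‖ = 1) {σ : ℝ} (hσ : 0 < σ) :
    Tendsto (iterSum (a :: w)) (𝓝[Complex.stolzCone σ] 1) (𝓝 (iterValue (a :: w))) :=
  Complex.tendsto_tsum_powerSeries_nhdsWithin_stolzCone (tendsto_iterValue ha ha1 hw) hσ

lemma tendsto_ofReal_stolzCone {σ : ℝ} (hσ : 0 < σ) :
    Tendsto (fun r : ℝ => (r : ℂ)) (𝓝[<] 1) (𝓝[Complex.stolzCone σ] 1) := by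
  refine tendsto_nhdsWithin_iff.mpr ⟨?_, ?_⟩
  · exact (Complex.continuous_ofReal.tendsto' 1 1 (by simp)).mono_left nhdsWithin_le_nhds
  · filter_upwards [self_mem_nhdsWithin] with r hr
    have hr' : r < 1 := hr
    simp only [Complex.stolzCone, Set.mem_ofPred_eq, Complex.ofReal_im, abs_zero,
      Complex.ofReal_re]
    exact mul_pos hσ (by linarith)

lemma tendsto_iterSum_ofReal {a : ℂ} {w : List ℂ} (ha : ‖a‖ = 1) (ha1 : a ≠ 1)
    (hw : ∀ b ∈ w, ‖b‖ = 1) :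
    Tendsto (fun r : ℝ => iterSum (a :: w) r) (𝓝[<] 1) (𝓝 (iterValue (a :: w))) :=
  (tendsto_iterSum_stolzCone ha ha1 hw one_pos).comp (tendsto_ofReal_stolzCone one_pos)

lemma eventually_norm_ofReal_lt_one : ∀ᶠ r : ℝ in 𝓝[<] 1, ‖(r : ℂ)‖ < 1 := by
  filter_upwards [Ioo_mem_nhdsLT (zero_lt_one' ℝ)] with r hr
  rw [Complex.norm_real, Real.norm_eq_abs, abs_of_pos hr.1]
  exact hr.2

/-! ### Shuffle products and the spaces they generate. -/

lemma iterSum_shuffle_one_one {a b s : ℂ} (ha : ‖a‖ = 1) (hb : ‖b‖ = 1) (hs : ‖s‖ < 1) :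
    iterSum [a] s * iterSum [b] s = iterSum [a, b] s + iterSum [b, a] s := by
  have key := eq_of_hasDerivAt_zero_ball (c := 1) (f := fun s => iterSum [a] s * iterSum [b] s
    - (iterSum [a, b] s + iterSum [b, a] s)) (fun s hs => ?_) hs
  · simp only [iterSum_cons_zero] at key
    linear_combination key
  · have h1 := hasDerivAt_iterSum ha (w := []) (by simp) hs
    have h2 := hasDerivAt_iterSum hb (w := []) (by simp) hs
    have h3 := hasDerivAt_iterSum ha (w := [b]) (by simpa) hs
    have h4 := hasDerivAt_iterSum hb (w := [a]) (by simpa) hs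
    refine ((h1.mul h2).sub (h3.add h4)).congr_deriv ?_
    rw [iterSum_nil]
    ring

/-- Both sides vanish at 0, and their derivatives agree by the shuffle of two single letters. -/
lemma iterSum_shuffle_one_two {a b c s : ℂ} (ha : ‖a‖ = 1) (hb : ‖b‖ = 1) (hc : ‖c‖ = 1)
    (hs : ‖s‖ < 1) :
    iterSum [a] s * iterSum [b, c] s
      = iterSum [a, b, c] s + iterSum [b, a, c] s + iterSum [b, c, a] s := by
  have key := eq_of_hasDerivAt_zero_ball (c := 1) (f := fun s => iterSum [a] s * iterSum [b, c] s
    - (iterSum [a, b, c] s + iterSum [b, a, c] s + iterSum [b, c, a] s)) (fun s hs => ?_) hs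
  · simp only [iterSum_cons_zero] at key
    linear_combination key
  · have h1 := hasDerivAt_iterSum ha (w := []) (by simp) hs
    have h2 := hasDerivAt_iterSum hb (w := [c]) (by simpa) hs
    have h3 := hasDerivAt_iterSum ha (w := [b, c]) (by simp [hb, hc]) hs
    have h4 := hasDerivAt_iterSum hb (w := [a, c]) (by simp [ha, hc]) hs
    have h5 := hasDerivAt_iterSum hb (w := [c, a]) (by simp [ha, hc]) hs
    have h6 := iterSum_shuffle_one_one ha hc hs
    refine ((h1.mul h2).sub ((h3.add h4).add h5)).congr_deriv ?_
    rw [iterSum_nil]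
    linear_combination (b / (1 - b * s)) * h6

lemma iterValue_shuffle_one_one {a b : ℂ} (ha : ‖a‖ = 1) (hb : ‖b‖ = 1) (ha1 : a ≠ 1)
    (hb1 : b ≠ 1) : iterValue [a] * iterValue [b] = iterValue [a, b] + iterValue [b, a] := by
  refine tendsto_nhds_unique ((tendsto_iterSum_ofReal ha ha1 (by simp)).mul
    (tendsto_iterSum_ofReal hb hb1 (by simp))) (((tendsto_iterSum_ofReal ha ha1 (w := [b])
    (by simpa)).add (tendsto_iterSum_ofReal hb hb1 (w := [a]) (by simpa))).congr' ?_)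
  filter_upwards [eventually_norm_ofReal_lt_one] with r hr
  exact (iterSum_shuffle_one_one ha hb hr).symm

lemma iterValue_shuffle_one_two {a b c : ℂ} (ha : ‖a‖ = 1) (hb : ‖b‖ = 1) (hc : ‖c‖ = 1)
    (ha1 : a ≠ 1) (hb1 : b ≠ 1) : iterValue [a] * iterValue [b, c]
      = iterValue [a, b, c] + iterValue [b, a, c] + iterValue [b, c, a] := by
  refine tendsto_nhds_unique ((tendsto_iterSum_ofReal ha ha1 (by simp)).mul
    (tendsto_iterSum_ofReal hb hb1 (w := [c]) (by simpa)))
    ((((tendsto_iterSum_ofReal ha ha1 (w := [b, c]) (by simp [hb, hc])).add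
    (tendsto_iterSum_ofReal hb hb1 (w := [a, c]) (by simp [ha, hc]))).add
    (tendsto_iterSum_ofReal hb hb1 (w := [c, a]) (by simp [ha, hc]))).congr' ?_)
  filter_upwards [eventually_norm_ofReal_lt_one] with r hr
  exact (iterSum_shuffle_one_two ha hb hc hr).symm

/-- The words in the tenth roots of unity of length `k` whose iterated integral converges at `1`. -/
def admissibleWords (k : ℕ) : Set (List ℂ) :=
  {w | w.length = k ∧ (∀ a ∈ w, a ^ 10 = 1) ∧ w.head? ≠ some 1}

/-- The `ℚ`-span of the values at `1` of the iterated integrals of weight `k`. -/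
noncomputable def iterSpace (k : ℕ) : Submodule ℚ ℂ :=
  Submodule.span ℚ (iterValue '' admissibleWords k)

lemma iterValue_mem {k : ℕ} {w : List ℂ} (hk : w.length = k) (hw : ∀ a ∈ w, a ^ 10 = 1)
    (h1 : w.head? ≠ some 1) : iterValue w ∈ iterSpace k :=
  Submodule.subset_span ⟨w, ⟨hk, hw, h1⟩, rfl⟩

lemma iterValue_one_mem {a : ℂ} (ha : a ^ 10 = 1) (h : a ≠ 1) : iterValue [a] ∈ iterSpace 1 :=
  iterValue_mem rfl (by simpa) (by simpa)

/-- Ratios of tenth roots of unity are again tenth roots of unity, and the leading ratio is the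
first letter itself, so the two convergence conditions coincide. -/
lemma iterSpace_le_cmzvSpace {k : ℕ} (hk : k ≠ 0) : iterSpace k ≤ cmzvSpace k 10 := by
  refine Submodule.span_le.mpr ?_
  rintro _ ⟨w, ⟨hl, hw, h1⟩, rfl⟩
  cases w with
  | nil => exact absurd hl.symm (by simpa using hk)
  | cons a w =>
    have ne0 : ∀ b ∈ a :: w, b ≠ 0 := fun b hb h => by
      have := hw b hb
      simp [h] at this
    have hn := fun b hb => norm_eq_one_of_pow_ten (hw b hb)
    refine Submodule.subset_span ⟨ratioIndex 1 (a :: w), ?_, ?_, ?_, ?_⟩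
    · have aux : ∀ (u : List ℂ) (p : ℂ), p ^ 10 = 1 → (∀ b ∈ u, b ^ 10 = 1) →
          ∀ q ∈ ratioIndex p u, 1 ≤ q.1 ∧ q.2 ^ 10 = 1 := by
        intro u
        induction u with
        | nil => intro p _ _ q hq; simp [ratioIndex] at hq
        | cons b u ih =>
          intro p hp hu q hq
          rw [ratioIndex, List.mem_cons] at hq
          have hb := hu b List.mem_cons_self
          rcases hq with rfl | hq
          · simp [div_pow, hp, hb]
          · exact ih b hb (fun c hc => hu c (List.mem_cons_of_mem _ hc)) q hq
      exact aux _ 1 (by simp) hw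
    · simpa [ratioIndex] using h1
    · have aux : ∀ (u : List ℂ) (p : ℂ), ((ratioIndex p u).map Prod.fst).sum = u.length := by
        intro u
        induction u with
        | nil => intro p; simp [ratioIndex]
        | cons b u ih => intro p; simp [ratioIndex, ih, add_comm]
      rw [aux, hl]
    · refine (tendsto_iterValue (hn a List.mem_cons_self) (by simpa using h1)
        fun b hb => hn b (List.mem_cons_of_mem _ hb)).congr fun M => ?_
      exact (multiPolylogTrunc_ratioIndex (ne0 a List.mem_cons_self)
        (fun b hb => ne0 b (List.mem_cons_of_mem _ hb)) M).symm

lemma iterSpace_one_mul_one {x y : ℂ} (hx : x ∈ iterSpace 1) (hy : y ∈ iterSpace 1) :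
    x * y ∈ iterSpace 2 := by
  have h : iterSpace 1 * iterSpace 1 ≤ iterSpace 2 := by
    unfold iterSpace
    rw [Submodule.span_mul_span]
    refine Submodule.span_le.mpr (Set.mul_subset_iff.mpr ?_)
    rintro _ ⟨w, ⟨hl, hw, h1⟩, rfl⟩ _ ⟨w', ⟨hl', hw', h1'⟩, rfl⟩
    obtain ⟨a, rfl⟩ := List.length_eq_one_iff.mp hl
    obtain ⟨b, rfl⟩ := List.length_eq_one_iff.mp hl'
    simp only [List.mem_singleton, forall_eq, List.head?_cons, ne_eq, Option.some.injEq]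
      at hw h1 hw' h1'
    rw [iterValue_shuffle_one_one (norm_eq_one_of_pow_ten hw) (norm_eq_one_of_pow_ten hw') h1 h1']
    exact add_mem (iterValue_mem rfl (by simp [hw, hw']) (by simpa))
      (iterValue_mem rfl (by simp [hw, hw']) (by simpa))
  exact h (Submodule.mul_mem_mul hx hy)

lemma iterSpace_one_mul_two {x y : ℂ} (hx : x ∈ iterSpace 1) (hy : y ∈ iterSpace 2) :
    x * y ∈ iterSpace 3 := by
  have h : iterSpace 1 * iterSpace 2 ≤ iterSpace 3 := by
    unfold iterSpace
    rw [Submodule.span_mul_span]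
    refine Submodule.span_le.mpr (Set.mul_subset_iff.mpr ?_)
    rintro _ ⟨w, ⟨hl, hw, h1⟩, rfl⟩ _ ⟨w', ⟨hl', hw', h1'⟩, rfl⟩
    obtain ⟨a, rfl⟩ := List.length_eq_one_iff.mp hl
    obtain ⟨b, c, rfl⟩ := List.length_eq_two.mp hl'
    simp only [forall_eq, List.head?_cons, ne_eq, Option.some.injEq, List.mem_cons,
      List.not_mem_nil, or_false, forall_eq_or_imp] at hw h1 hw' h1'
    rw [iterValue_shuffle_one_two (norm_eq_one_of_pow_ten hw) (norm_eq_one_of_pow_ten hw'.1)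
      (norm_eq_one_of_pow_ten hw'.2) h1 h1']
    exact add_mem (add_mem (iterValue_mem rfl (by simp [hw, hw']) (by simpa))
      (iterValue_mem rfl (by simp [hw, hw']) (by simpa)))
      (iterValue_mem rfl (by simp [hw, hw']) (by simpa))
  exact h (Submodule.mul_mem_mul hx hy)

/-! ### Primitives of weight three and their limits at 1 and ζ. -/

/-- The functions `h` for which `h(s) a ds / (1 - a s)` has a primitive on the unit disc with limits
in `iterSpace 3` at `1` and at `ζ`. -/
noncomputable def primitiveSpace (ζ a : ℂ) : Submodule ℚ (ℂ → ℂ) where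
  carrier := {h | ∃ F : ℂ → ℂ, (∀ s, ‖s‖ < 1 → HasDerivAt F (h s * (a / (1 - a * s))) s) ∧
    (∃ v ∈ iterSpace 3, ∀ σ > 0, Tendsto F (𝓝[Complex.stolzCone σ] 1) (𝓝 v)) ∧
    (∃ v ∈ iterSpace 3, ∀ σ > 0,
      Tendsto (fun s => F (ζ * s)) (𝓝[Complex.stolzCone σ] 1) (𝓝 v))}
  zero_mem' := ⟨fun _ => 0, fun s _ => by simpa using hasDerivAt_const s (0 : ℂ),
    ⟨0, zero_mem _, fun _ _ => tendsto_const_nhds⟩, ⟨0, zero_mem _, fun _ _ => tendsto_const_nhds⟩⟩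
  add_mem' := by
    rintro h k ⟨F, hF, ⟨v, hv, hv'⟩, ⟨u, hu, hu'⟩⟩ ⟨G, hG, ⟨v₂, hv₂, hv₂'⟩, ⟨u₂, hu₂, hu₂'⟩⟩
    refine ⟨fun s => F s + G s, fun s hs => ((hF s hs).add (hG s hs)).congr_deriv ?_,
      ⟨_, add_mem hv hv₂, fun σ hσ => (hv' σ hσ).add (hv₂' σ hσ)⟩,
      ⟨_, add_mem hu hu₂, fun σ hσ => (hu' σ hσ).add (hu₂' σ hσ)⟩⟩
    rw [Pi.add_apply]
    ring
  smul_mem' := by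
    rintro q h ⟨F, hF, ⟨v, hv, hv'⟩, ⟨u, hu, hu'⟩⟩
    refine ⟨fun s => (q : ℂ) * F s, fun s hs => ((hF s hs).const_mul (q : ℂ)).congr_deriv ?_,
      ⟨q • v, Submodule.smul_mem _ _ hv, fun σ hσ => ?_⟩,
      ⟨q • u, Submodule.smul_mem _ _ hu, fun σ hσ => ?_⟩⟩
    · rw [Pi.smul_apply, Rat.smul_def]
      ring
    · rw [Rat.smul_def]
      exact (hv' σ hσ).const_mul _
    · rw [Rat.smul_def]
      exact (hu' σ hσ).const_mul _

/-- The functions of weight one. -/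
noncomputable def weightOne : Submodule ℚ (ℂ → ℂ) :=
  Submodule.span ℚ ({f | ∃ k ∈ iterSpace 1, f = fun _ => k} ∪
    {f | ∃ b : ℂ, b ^ 10 = 1 ∧ f = iterSum [b]})

lemma const_mem_weightOne {k : ℂ} (hk : k ∈ iterSpace 1) : (fun _ => k) ∈ weightOne :=
  Submodule.subset_span (Or.inl ⟨k, hk, rfl⟩)

lemma iterSum_mem_weightOne {b : ℂ} (hb : b ^ 10 = 1) : iterSum [b] ∈ weightOne :=
  Submodule.subset_span (Or.inr ⟨b, hb, rfl⟩)

/-- The limit at ζ is the limit at 1 for the word with all letters multiplied by ζ; hence the two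
conditions on the first letter, a ≠ 1 and ζa ≠ 1. -/
lemma limits_const_mul_iterSum {ζ a k : ℂ} {w : List ℂ} {n : ℕ} (hζ : ζ ^ 10 = 1)
    (hw : ∀ b ∈ a :: w, b ^ 10 = 1) (hn : (a :: w).length = n) (ha1 : a ≠ 1) (ha2 : ζ * a ≠ 1)
    (hk : ∀ v ∈ iterSpace n, k * v ∈ iterSpace 3) :
    (∃ v ∈ iterSpace 3, ∀ σ > 0, Tendsto (fun s => k * iterSum (a :: w) s)
      (𝓝[Complex.stolzCone σ] 1) (𝓝 v)) ∧
    (∃ v ∈ iterSpace 3, ∀ σ > 0, Tendsto (fun s => k * iterSum (a :: w) (ζ * s))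
      (𝓝[Complex.stolzCone σ] 1) (𝓝 v)) := by
  have hn1 := fun b hb => norm_eq_one_of_pow_ten (hw b hb)
  have hw2 : ∀ b ∈ (a :: w).map (ζ * ·), b ^ 10 = 1 := fun b hb => by
    obtain ⟨c, hc, rfl⟩ := List.mem_map.mp hb
    rw [mul_pow, hζ, hw c hc, one_mul]
  have hn2 := fun b hb => norm_eq_one_of_pow_ten (hw2 b hb)
  refine ⟨⟨k * iterValue (a :: w), hk _ (iterValue_mem hn hw (by simpa)), fun σ hσ =>
    (tendsto_iterSum_stolzCone (hn1 a List.mem_cons_self) ha1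
      (fun b hb => hn1 b (List.mem_cons_of_mem _ hb)) hσ).const_mul k⟩,
    ⟨k * iterValue ((a :: w).map (ζ * ·)), hk _ (iterValue_mem (by simpa using hn) hw2 (by simpa)),
      fun σ hσ => ?_⟩⟩
  simp_rw [iterSum_mul]
  rw [List.map_cons] at hn2 ⊢
  exact (tendsto_iterSum_stolzCone (hn2 _ List.mem_cons_self) ha2
      (fun b hb => hn2 b (List.mem_cons_of_mem _ hb)) hσ).const_mul k

/-- Expand the product by shuffles and prefix the letter `a` to every word. The inner letters are
unrestricted, so the letter 1 may occur in `f` and `g`; this is what the integrations by parts aim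
for. -/
lemma mul_mem_primitiveSpace {ζ a : ℂ} (hζ : ζ ^ 10 = 1) (ha : a ^ 10 = 1) (ha1 : a ≠ 1)
    (ha2 : ζ * a ≠ 1) {f g : ℂ → ℂ} (hf : f ∈ weightOne) (hg : g ∈ weightOne) :
    f * g ∈ primitiveSpace ζ a := by
  have hna := norm_eq_one_of_pow_ten ha
  have mixed : ∀ k ∈ iterSpace 1, ∀ b : ℂ, b ^ 10 = 1 →
      (fun s => k * iterSum [b] s) ∈ primitiveSpace ζ a := fun k hk b hb => by
    have hnb := norm_eq_one_of_pow_ten hb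
    refine ⟨fun s => k * iterSum [a, b] s, fun s hs => ?_, limits_const_mul_iterSum hζ
      (by simp [ha, hb]) rfl ha1 ha2 fun v hv => iterSpace_one_mul_two hk hv⟩
    refine ((hasDerivAt_iterSum hna (w := [b]) (by simpa) hs).const_mul k).congr_deriv ?_
    ring
  have h : weightOne * weightOne ≤ primitiveSpace ζ a := by
    unfold weightOne
    rw [Submodule.span_mul_span]
    refine Submodule.span_le.mpr (Set.mul_subset_iff.mpr ?_)
    rintro _ (⟨k, hk, rfl⟩ | ⟨b, hb, rfl⟩) _ (⟨l, hl, rfl⟩ | ⟨c, hc, rfl⟩)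
    · refine ⟨fun s => (k * l) * iterSum [a] s, fun s hs => ?_, limits_const_mul_iterSum hζ
        (by simpa) rfl ha1 ha2 fun v hv => ?_⟩
      · refine ((hasDerivAt_iterSum hna (w := []) (by simp) hs).const_mul (k * l)).congr_deriv ?_
        rw [iterSum_nil, Pi.mul_apply]
        ring
      · rw [mul_assoc]
        exact iterSpace_one_mul_two hk (iterSpace_one_mul_one hl hv)
    · exact mixed k hk c hc
    · rw [mul_comm]
      exact mixed l hl b hb
    · have hnb := norm_eq_one_of_pow_ten hb
      have hnc := norm_eq_one_of_pow_ten hc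
      have l1 := limits_const_mul_iterSum (k := 1) hζ (w := [b, c]) (a := a)
        (by simp [ha, hb, hc]) rfl ha1 ha2 fun v hv => by rwa [one_mul]
      have l2 := limits_const_mul_iterSum (k := 1) hζ (w := [c, b]) (a := a)
        (by simp [ha, hb, hc]) rfl ha1 ha2 fun v hv => by rwa [one_mul]
      simp only [one_mul] at l1 l2
      obtain ⟨⟨v, hv, hv'⟩, ⟨u, hu, hu'⟩⟩ := l1
      obtain ⟨⟨v₂, hv₂, hv₂'⟩, ⟨u₂, hu₂, hu₂'⟩⟩ := l2
      refine ⟨fun s => iterSum [a, b, c] s + iterSum [a, c, b] s, fun s hs => ?_,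
        ⟨_, add_mem hv hv₂, fun σ hσ => (hv' σ hσ).add (hv₂' σ hσ)⟩,
        ⟨_, add_mem hu hu₂, fun σ hσ => (hu' σ hσ).add (hu₂' σ hσ)⟩⟩
      refine ((hasDerivAt_iterSum hna (w := [b, c]) (by simp [hnb, hnc]) hs).add
        (hasDerivAt_iterSum hna (w := [c, b]) (by simp [hnb, hnc]) hs)).congr_deriv ?_
      rw [Pi.mul_apply, iterSum_shuffle_one_one hnb hnc hs]
      ring
  exact h (Submodule.mul_mem_mul hf hg)

lemma one_sub_mem_slitPlane {z : ℂ} (hz : ‖z‖ ≤ 1) (h1 : z ≠ 1) : 1 - z ∈ Complex.slitPlane := by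
  by_cases h : z.re = 1
  · exfalso
    apply h1
    have h2 : z.re ^ 2 + z.im ^ 2 ≤ 1 := by
      have := Complex.sq_norm z
      rw [Complex.normSq_apply] at this
      nlinarith [norm_nonneg z]
    refine Complex.ext h ?_
    rw [Complex.one_im]
    rw [h] at h2
    nlinarith
  · left
    rw [Complex.sub_re, Complex.one_re, sub_pos]
    exact lt_of_le_of_ne ((Complex.re_le_norm z).trans hz) h

lemma iterSum_singleton {a s : ℂ} (ha : ‖a‖ = 1) (hs : ‖s‖ < 1) :
    iterSum [a] s = -Complex.log (1 - a * s) := by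
  have key := eq_of_hasDerivAt_zero_ball (c := 1)
    (f := fun s => iterSum [a] s + Complex.log (1 - a * s)) (fun s hs => ?_) hs
  · simp only [iterSum_cons_zero, mul_zero, sub_zero, Complex.log_one] at key
    linear_combination key
  · have has : ‖a * s‖ < 1 := by rwa [norm_mul, ha, one_mul]
    have h1 : HasDerivAt (fun s => 1 - a * s) (-a) s := by
      simpa using ((hasDerivAt_id' s).const_mul a).const_sub 1
    have h2 := h1.clog (one_sub_mem_slitPlane has.le fun h => by simp [h] at has)
    refine ((hasDerivAt_iterSum ha (w := []) (by simp) hs).add h2).congr_deriv ?_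
    rw [iterSum_nil]
    ring

lemma iterValue_singleton {a : ℂ} (ha : ‖a‖ = 1) (ha1 : a ≠ 1) :
    iterValue [a] = -Complex.log (1 - a) := by
  refine tendsto_nhds_unique (tendsto_iterSum_ofReal ha ha1 (by simp)) ?_
  have h1 : Tendsto (fun r : ℝ => 1 - a * (r : ℂ)) (𝓝[<] 1) (𝓝 (1 - a)) := by
    refine Tendsto.mono_left (Continuous.tendsto' ?_ _ _ (by simp)) nhdsWithin_le_nhds
    fun_prop
  refine (h1.clog (one_sub_mem_slitPlane ha.le ha1)).neg.congr' ?_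
  filter_upwards [eventually_norm_ofReal_lt_one] with r hr
  exact (iterSum_singleton ha hr).symm

end CyclotomicValues

/-! ### Pullback of the integral to the chord from 1 to ζ. -/

section GoldenSegment

open Filter Topology

/-- A rational parameter on the disc whose values at the letters `1, -1, ζ², ζ³` are
`0, ∞, -1, 1`, where `ζ` is a primitive fifth root of unity. -/
noncomputable def segX (ζ s : ℂ) : ℂ := (1 + ζ ^ 2) / (1 - ζ ^ 2) * ((1 - s) / (1 + s))

/-- The logarithm of `segX ζ`. -/
noncomputable def logSegX (ζ s : ℂ) : ℂ :=
  iterValue [ζ ^ 2] - iterValue [-ζ ^ 2] - iterSum [1] s + iterSum [-1] s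

/-- The logarithm of `1 + segX ζ` for `z = ζ²` and of `1 - segX ζ` for `z = ζ³`. -/
noncomputable def logOneSegX (z s : ℂ) : ℂ :=
  iterValue [z] - iterSum [z] s - iterValue [-1] + iterSum [-1] s

/-- The function obtained from `binomSum 3` by two integrations by parts. -/
noncomputable def partsRemainder (M X l₀ lm lp : ℂ) : ℂ :=
  binomSum 3 (4 * X / (1 - X ^ 2)) - 4 * (chi 2 X * (l₀ + (M - lp - lm)))
    - (lm - lp) * l₀ ^ 2 - 2 * ((lm - lp) * (M - lp - lm) * l₀)

/-- With M = log 4, the sum l₀ + M - lp - lm is log w. Subtracting 4 χ_2 log w from B_3 leaves -4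
log w · χ_1 dl₀ = 2(lm - lp)(l₀ + M - lp - lm) dl₀. A second integration by parts, on dl₀, leaves
only dlp and dlm as outer forms. -/
lemma hasDerivAt_partsRemainder {c : ℝ} (hc0 : 0 < c) (hc : 4 * c + c ^ 2 = 1) (M : ℂ)
    {x l₀ lm lp : ℂ → ℂ} {s X' : ℂ} (hX : HasDerivAt x X' s) (h0 : HasDerivAt l₀ (X' / x s) s)
    (hm : HasDerivAt lm (-X' / (1 - x s)) s) (hp : HasDerivAt lp (X' / (1 + x s)) s)
    (hxc : ‖x s‖ < c) (hx0 : x s ≠ 0) (hchi : lp s - lm s = 2 * chi 1 (x s)) :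
    HasDerivAt (fun s => partsRemainder M (x s) (l₀ s) (lm s) (lp s))
      (l₀ s * (l₀ s + 2 * M) * (X' / (1 + x s) - -X' / (1 - x s))
        + 4 * l₀ s * (lm s * (-X' / (1 - x s)) - lp s * (X' / (1 + x s)))) s := by
  have hx1 := hxc.trans (lt_one_of_quadratic hc0 hc)
  have n1 := one_sub_sq_ne_zero hx1
  have n2 : 1 - x s ≠ 0 := fun h => n1 (by linear_combination (1 + x s) * h)
  have n3 : 1 + x s ≠ 0 := fun h => n1 (by linear_combination (1 - x s) * h)
  have d1 := (hasDerivAt_binomSum_three hc0 hc hxc hx0).comp s hX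
  have d2 := (hasDerivAt_chi_succ le_rfl hx1 hx0).comp s hX
  have d3 := (hp.const_sub M).sub hm
  refine (((d1.sub ((d2.mul (h0.add d3)).const_mul 4)).sub ((hm.sub hp).mul (h0.pow 2))).sub
    ((((hm.sub hp).mul d3).mul h0).const_mul 2)).congr_deriv ?_
  have hchi' : chi 1 (x s) = (lp s - lm s) / 2 := by rw [hchi]; ring
  simp only [Function.comp_apply, Pi.sub_apply, Pi.mul_apply, Pi.add_apply, Pi.pow_apply]
  rw [hchi']
  push_cast
  field_simp
  ring

variable {ζ : ℂ}

lemma fifth_root_pow_five (hζ : ζ ^ 4 + ζ ^ 3 + ζ ^ 2 + ζ + 1 = 0) : ζ ^ 5 = 1 := by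
  linear_combination (ζ - 1) * hζ

lemma fifth_root_pow_ten (hζ : ζ ^ 4 + ζ ^ 3 + ζ ^ 2 + ζ + 1 = 0) : ζ ^ 10 = 1 := by
  rw [show ζ ^ 10 = (ζ ^ 5) ^ 2 by ring, fifth_root_pow_five hζ, one_pow]

lemma fifth_root_ne (hζ : ζ ^ 4 + ζ ^ 3 + ζ ^ 2 + ζ + 1 = 0) :
    ζ ≠ 1 ∧ ζ ^ 2 ≠ 1 ∧ ζ ^ 3 ≠ 1 ∧ ζ ^ 4 ≠ 1 ∧ -ζ ≠ 1 ∧ -ζ ^ 2 ≠ 1 := by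
  have h5 := fifth_root_pow_five hζ
  have h1 : ζ ≠ 1 := fun h => by rw [h] at hζ; norm_num at hζ
  refine ⟨h1, fun h => h1 ?_, fun h => h1 ?_, fun h => h1 ?_, fun h => ?_, fun h => ?_⟩
  · linear_combination h5 - (ζ ^ 3 + ζ) * h
  · linear_combination -ζ * h5 + (ζ ^ 3 + 1) * h
  · linear_combination h5 - ζ * h
  · have : ζ = -1 := by linear_combination -h
    rw [this] at hζ; norm_num at hζ
  · have h2 : ζ ^ 2 = -1 := by linear_combination -h
    have h3 : ζ = 1 := by linear_combination h5 - (ζ ^ 3 - ζ) * h2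
    exact h1 h3

lemma fifth_root_re (hζ : ζ ^ 4 + ζ ^ 3 + ζ ^ 2 + ζ + 1 = 0) :
    ζ ^ 2 + 1 = 2 * (ζ.re : ℂ) * ζ := by
  have hn : ‖ζ‖ = 1 := norm_eq_one_of_pow_ten (fifth_root_pow_ten hζ)
  have h1 : ζ * (starRingEnd ℂ) ζ = 1 := by
    rw [Complex.mul_conj, Complex.normSq_eq_norm_sq, hn]; simp
  have h2 : ζ + (starRingEnd ℂ) ζ = 2 * (ζ.re : ℂ) := by
    rw [Complex.add_conj]; push_cast; ring
  rw [← h2]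
  linear_combination -h1

lemma fifth_root_re_quadratic (hζ : ζ ^ 4 + ζ ^ 3 + ζ ^ 2 + ζ + 1 = 0) :
    4 * ζ.re ^ 2 + 2 * ζ.re = 1 := by
  have h1 := fifth_root_re hζ
  have h0 : ζ ≠ 0 := fun h => by rw [h] at hζ; norm_num at hζ
  have h2 : ζ ^ 2 * (4 * (ζ.re : ℂ) ^ 2 + 2 * (ζ.re : ℂ) - 1) = 0 := by
    linear_combination hζ - (ζ ^ 2 + 1 + 2 * (ζ.re : ℂ) * ζ + ζ) * h1
  have h3 := (mul_eq_zero.mp h2).resolve_left (pow_ne_zero 2 h0)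
  have h4 : 4 * ζ.re ^ 2 + 2 * ζ.re - 1 = 0 := by exact_mod_cast h3
  linarith

lemma fifth_root_re_sq_add_im_sq (hζ : ζ ^ 4 + ζ ^ 3 + ζ ^ 2 + ζ + 1 = 0) :
    ζ.re ^ 2 + ζ.im ^ 2 = 1 := by
  have hn : ‖ζ‖ = 1 := norm_eq_one_of_pow_ten (fifth_root_pow_ten hζ)
  have := Complex.sq_norm ζ
  rw [Complex.normSq_apply, hn] at this
  nlinarith

lemma golden_quadratic {g : ℝ} (hg : 0 < g) (hq : 4 * g ^ 2 + 2 * g = 1) :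
    4 * (g / (1 + g)) + (g / (1 + g)) ^ 2 = 1 := by
  field_simp
  nlinarith

/-- The value is (1+ζ²)/(1+ζ)², and ζ² + 1 = 2 Re(ζ) ζ. By `golden_quadratic` this is the x at which
w = 1. -/
lemma segX_self (hζ : ζ ^ 4 + ζ ^ 3 + ζ ^ 2 + ζ + 1 = 0) (hg : 0 < ζ.re) :
    segX ζ ζ = ((ζ.re / (1 + ζ.re) : ℝ) : ℂ) := by
  obtain ⟨h1, h2, -⟩ := fifth_root_ne hζ
  have h0 : ζ ≠ 0 := fun h => by rw [h] at hζ; norm_num at hζ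
  have hr := fifth_root_re hζ
  have n1 : 1 - ζ ^ 2 ≠ 0 := sub_ne_zero.mpr h2.symm
  have n2 : 1 + ζ ≠ 0 := fun h => n1 (by linear_combination (1 - ζ) * h)
  have n3 : (1 + (ζ.re : ℂ)) ≠ 0 := by exact_mod_cast (by linarith : (1 + ζ.re) ≠ 0)
  unfold segX
  push_cast
  rw [← mul_div_assoc, div_mul_eq_mul_div, div_div, div_eq_div_iff (mul_ne_zero n1 n2) n3]
  linear_combination (1 - ζ) * hr

lemma one_sub_mul_ne_zero {a s : ℂ} (ha : ‖a‖ = 1) (hs : ‖s‖ < 1) : 1 - a * s ≠ 0 := fun h => by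
  have h1 : ‖a * s‖ = 1 := by rw [← sub_eq_zero.mp h, norm_one]
  rw [norm_mul, ha, one_mul] at h1
  exact hs.ne h1

lemma one_add_ne_zero_of_norm_lt {s : ℂ} (hs : ‖s‖ < 1) : 1 + s ≠ 0 := by
  simpa using one_sub_mul_ne_zero (a := -1) (by simp) hs

lemma one_sub_ne_zero_of_norm_lt {s : ℂ} (hs : ‖s‖ < 1) : 1 - s ≠ 0 := by
  simpa using one_sub_mul_ne_zero (a := 1) (by simp) hs

lemma hasDerivAt_segX {s : ℂ} (hs : 1 + s ≠ 0) :
    HasDerivAt (segX ζ) ((1 + ζ ^ 2) / (1 - ζ ^ 2) * (-2 / (1 + s) ^ 2)) s := by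
  have h1 := ((hasDerivAt_id' s).const_sub 1).fun_div ((hasDerivAt_id' s).const_add 1) hs
  refine (h1.const_mul _).congr_deriv ?_
  ring

lemma hasDerivAt_iterSum_singleton {a s : ℂ} (ha : ‖a‖ = 1) (hs : ‖s‖ < 1) :
    HasDerivAt (iterSum [a]) (a / (1 - a * s)) s :=
  (hasDerivAt_iterSum ha (w := []) (by simp) hs).congr_deriv (by rw [iterSum_nil, mul_one])

lemma hasDerivAt_logSegX (hζ : ζ ^ 4 + ζ ^ 3 + ζ ^ 2 + ζ + 1 = 0) {s : ℂ} (hs : ‖s‖ < 1) :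
    HasDerivAt (logSegX ζ)
      ((1 + ζ ^ 2) / (1 - ζ ^ 2) * (-2 / (1 + s) ^ 2) / segX ζ s) s := by
  obtain ⟨-, h2, -, -, -, h6⟩ := fifth_root_ne hζ
  have n1 : 1 - ζ ^ 2 ≠ 0 := sub_ne_zero.mpr h2.symm
  have n2 : 1 + ζ ^ 2 ≠ 0 := fun h => h6 (by linear_combination -h)
  have n3 := one_add_ne_zero_of_norm_lt hs
  have n4 := one_sub_ne_zero_of_norm_lt hs
  have d1 := hasDerivAt_iterSum_singleton (a := 1) (by simp) hs
  have d2 := hasDerivAt_iterSum_singleton (a := -1) (by simp) hs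
  refine ((d1.const_sub (iterValue [ζ ^ 2] - iterValue [-ζ ^ 2])).add d2).congr_deriv ?_
  rw [show (1 : ℂ) - -1 * s = 1 + s by ring, one_mul]
  unfold segX
  field_simp
  ring

lemma hasDerivAt_logOneSegX {z s : ℂ} (hz : ‖z‖ = 1) (hs : ‖s‖ < 1) :
    HasDerivAt (logOneSegX z) (-(z / (1 - z * s)) - 1 / (1 + s)) s := by
  have d1 := hasDerivAt_iterSum_singleton hz hs
  have d2 := hasDerivAt_iterSum_singleton (a := -1) (by simp) hs
  refine (((d1.const_sub (iterValue [z])).sub_const (iterValue [-1])).add d2).congr_deriv ?_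
  rw [show (1 : ℂ) - -1 * s = 1 + s by ring]
  ring

lemma one_add_segX (hζ : ζ ^ 2 ≠ 1) {s : ℂ} (hs : 1 + s ≠ 0) :
    1 + segX ζ s = 2 * (1 - ζ ^ 2 * s) / ((1 - ζ ^ 2) * (1 + s)) := by
  have n1 : 1 - ζ ^ 2 ≠ 0 := sub_ne_zero.mpr hζ.symm
  unfold segX
  field_simp
  ring

lemma one_sub_segX (hζ : ζ ^ 2 ≠ 1) (h5 : ζ ^ 5 = 1) {s : ℂ} (hs : 1 + s ≠ 0) :
    1 - segX ζ s = -2 * ζ ^ 2 * (1 - ζ ^ 3 * s) / ((1 - ζ ^ 2) * (1 + s)) := by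
  have n1 : 1 - ζ ^ 2 ≠ 0 := sub_ne_zero.mpr hζ.symm
  unfold segX
  field_simp
  linear_combination (-2 * s) * h5

lemma hasDerivAt_logOneSegX_add (hζ : ζ ^ 4 + ζ ^ 3 + ζ ^ 2 + ζ + 1 = 0) {s : ℂ} (hs : ‖s‖ < 1) :
    HasDerivAt (logOneSegX (ζ ^ 2))
      ((1 + ζ ^ 2) / (1 - ζ ^ 2) * (-2 / (1 + s) ^ 2) / (1 + segX ζ s)) s := by
  have hn : ‖ζ‖ = 1 := norm_eq_one_of_pow_ten (fifth_root_pow_ten hζ)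
  obtain ⟨-, h2, -⟩ := fifth_root_ne hζ
  have n1 : 1 - ζ ^ 2 ≠ 0 := sub_ne_zero.mpr h2.symm
  have n3 := one_add_ne_zero_of_norm_lt hs
  have n4 := one_sub_mul_ne_zero (a := ζ ^ 2) (by simp [hn]) hs
  refine (hasDerivAt_logOneSegX (by simp [hn]) hs).congr_deriv ?_
  rw [one_add_segX h2 n3]
  field_simp
  ring

lemma hasDerivAt_logOneSegX_sub (hζ : ζ ^ 4 + ζ ^ 3 + ζ ^ 2 + ζ + 1 = 0) {s : ℂ} (hs : ‖s‖ < 1) :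
    HasDerivAt (logOneSegX (ζ ^ 3))
      (-((1 + ζ ^ 2) / (1 - ζ ^ 2) * (-2 / (1 + s) ^ 2)) / (1 - segX ζ s)) s := by
  have hn : ‖ζ‖ = 1 := norm_eq_one_of_pow_ten (fifth_root_pow_ten hζ)
  obtain ⟨-, h2, -⟩ := fifth_root_ne hζ
  have h0 : ζ ≠ 0 := fun h => by rw [h] at hζ; norm_num at hζ
  have h5 := fifth_root_pow_five hζ
  have n1 : 1 - ζ ^ 2 ≠ 0 := sub_ne_zero.mpr h2.symm
  have n3 := one_add_ne_zero_of_norm_lt hs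
  have n4 := one_sub_mul_ne_zero (a := ζ ^ 3) (by simp [hn]) hs
  refine (hasDerivAt_logOneSegX (by simp [hn]) hs).congr_deriv ?_
  rw [one_sub_segX h2 h5 n3]
  field_simp
  linear_combination (-1 : ℂ) * h5

lemma logSegX_mem_weightOne (hζ : ζ ^ 4 + ζ ^ 3 + ζ ^ 2 + ζ + 1 = 0) :
    logSegX ζ ∈ weightOne := by
  obtain ⟨-, h2, -, -, -, h6⟩ := fifth_root_ne hζ
  have h10 := fifth_root_pow_ten hζ
  have e : logSegX ζ = (fun _ => iterValue [ζ ^ 2] - iterValue [-ζ ^ 2]) - iterSum [1]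
      + iterSum [-1] := rfl
  rw [e]
  refine add_mem (sub_mem (const_mem_weightOne (sub_mem (iterValue_one_mem ?_ h2)
    (iterValue_one_mem ?_ h6))) (iterSum_mem_weightOne (by norm_num)))
    (iterSum_mem_weightOne (by norm_num))
  · rw [← pow_mul, mul_comm, pow_mul, h10, one_pow]
  · rw [Even.neg_pow (by decide), ← pow_mul, mul_comm, pow_mul, h10, one_pow]

lemma logOneSegX_mem_weightOne {z : ℂ} (hz : z ^ 10 = 1) (hz1 : z ≠ 1) :
    logOneSegX z ∈ weightOne := by
  have e : logOneSegX z = (fun _ => iterValue [z] - iterValue [-1]) - iterSum [z]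
      + iterSum [-1] := by
    funext s
    simp only [logOneSegX, Pi.add_apply, Pi.sub_apply]
    ring
  rw [e]
  exact add_mem (sub_mem (const_mem_weightOne (sub_mem (iterValue_one_mem hz hz1)
    (iterValue_one_mem (by norm_num) (by norm_num)))) (iterSum_mem_weightOne hz))
    (iterSum_mem_weightOne (by norm_num))

/-- A primitive on the unit disc of the derivative of `partsRemainder`. -/
lemma exists_primitive_partsRemainder (hζ : ζ ^ 4 + ζ ^ 3 + ζ ^ 2 + ζ + 1 = 0) :
    ∃ F : ℂ → ℂ, (∀ s, ‖s‖ < 1 → HasDerivAt F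
      (logSegX ζ s * (logSegX ζ s + 2 * (-2 * iterValue [-1]))
          * ((1 + ζ ^ 2) / (1 - ζ ^ 2) * (-2 / (1 + s) ^ 2) / (1 + segX ζ s)
            - -((1 + ζ ^ 2) / (1 - ζ ^ 2) * (-2 / (1 + s) ^ 2)) / (1 - segX ζ s))
        + 4 * logSegX ζ s * (logOneSegX (ζ ^ 3) s
            * (-((1 + ζ ^ 2) / (1 - ζ ^ 2) * (-2 / (1 + s) ^ 2)) / (1 - segX ζ s))
          - logOneSegX (ζ ^ 2) s
            * ((1 + ζ ^ 2) / (1 - ζ ^ 2) * (-2 / (1 + s) ^ 2) / (1 + segX ζ s)))) s) ∧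
    (∃ v ∈ iterSpace 3, ∀ σ > 0, Tendsto F (𝓝[Complex.stolzCone σ] 1) (𝓝 v)) ∧
    (∃ v ∈ iterSpace 3, ∀ σ > 0,
      Tendsto (fun s => F (ζ * s)) (𝓝[Complex.stolzCone σ] 1) (𝓝 v)) := by
  obtain ⟨h1, h2, h3, h4, h5, h6⟩ := fifth_root_ne hζ
  have hn : ‖ζ‖ = 1 := norm_eq_one_of_pow_ten (fifth_root_pow_ten hζ)
  have h10 := fifth_root_pow_ten hζ
  have t2 : (ζ ^ 2) ^ 10 = 1 := by rw [← pow_mul, mul_comm, pow_mul, h10, one_pow]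
  have t3 : (ζ ^ 3) ^ 10 = 1 := by rw [← pow_mul, mul_comm, pow_mul, h10, one_pow]
  have m0 := logSegX_mem_weightOne hζ
  have mp := logOneSegX_mem_weightOne t2 h2
  have mm := logOneSegX_mem_weightOne t3 h3
  have mM : (fun _ : ℂ => iterValue [-1]) ∈ weightOne :=
    const_mem_weightOne (iterValue_one_mem (by norm_num) (by norm_num))
  have int : ∀ (n : ℤ) {f : ℂ → ℂ}, f ∈ weightOne → n • f ∈ weightOne := fun n f hf =>
    zsmul_mem hf n
  -- The form is sorted by its outer letters ζ², ζ³ and -1. None of them is 1 or ζ⁻¹, so the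
  -- primitives converge at both ends; here 4 `iterValue [-1]` is -2M.
  obtain ⟨F₁, hF₁, ⟨v₁, hv₁, hv₁'⟩, ⟨u₁, hu₁, hu₁'⟩⟩ := mul_mem_primitiveSpace h10 t2 h2
    (by rwa [← pow_succ'] : ζ * ζ ^ 2 ≠ 1) m0 (add_mem (sub_mem (int 4 mM) m0) (int 4 mp))
  obtain ⟨F₂, hF₂, ⟨v₂, hv₂, hv₂'⟩, ⟨u₂, hu₂, hu₂'⟩⟩ := mul_mem_primitiveSpace h10 t3 h3
    (by rwa [← pow_succ'] : ζ * ζ ^ 3 ≠ 1) m0 (sub_mem (sub_mem m0 (int 4 mM)) (int 4 mm))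
  obtain ⟨F₃, hF₃, ⟨v₃, hv₃, hv₃'⟩, ⟨u₃, hu₃, hu₃'⟩⟩ := mul_mem_primitiveSpace
    (a := -1) h10 (by norm_num) (by norm_num)
    (by rwa [mul_neg_one]) m0 (sub_mem (int 4 mm) (int 4 mp))
  refine ⟨fun s => F₁ s + F₂ s + F₃ s, fun s hs => ?_,
    ⟨_, add_mem (add_mem hv₁ hv₂) hv₃, fun σ hσ =>
      ((hv₁' σ hσ).add (hv₂' σ hσ)).add (hv₃' σ hσ)⟩,
    ⟨_, add_mem (add_mem hu₁ hu₂) hu₃, fun σ hσ =>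
      ((hu₁' σ hσ).add (hu₂' σ hσ)).add (hu₃' σ hσ)⟩⟩
  refine (((hF₁ s hs).add (hF₂ s hs)).add (hF₃ s hs)).congr_deriv ?_
  rw [← (hasDerivAt_logOneSegX_add hζ hs).unique (hasDerivAt_logOneSegX (by simp [hn]) hs) |>.symm,
    ← (hasDerivAt_logOneSegX_sub hζ hs).unique (hasDerivAt_logOneSegX (by simp [hn]) hs) |>.symm]
  simp only [Pi.mul_apply, Pi.add_apply, Pi.sub_apply, Pi.smul_apply]
  simp only [zsmul_eq_mul]
  rw [show (1 : ℂ) - -1 * s = 1 + s by ring]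
  push_cast
  ring

/-! ### Geometry of the chord and limits along it. -/

/-- The point dividing the segment from `1` to `ζ` in the ratio `t`. -/
noncomputable def seg (ζ : ℂ) (t : ℝ) : ℂ := 1 + t * (ζ - 1)

lemma seg_zero : seg ζ 0 = 1 := by simp [seg]

lemma seg_one : seg ζ 1 = ζ := by simp [seg]

lemma seg_re (t : ℝ) : (seg ζ t).re = 1 - t * (1 - ζ.re) := by
  simp [seg]
  ring

lemma seg_im (t : ℝ) : (seg ζ t).im = t * ζ.im := by
  simp [seg]

lemma hasDerivAt_seg (t : ℝ) : HasDerivAt (seg ζ) (ζ - 1) t := by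
  have h := ((Complex.ofRealCLM.hasDerivAt (x := t)).mul_const (ζ - 1)).const_add (1 : ℂ)
  refine HasDerivAt.congr_deriv (f := seg ζ) h ?_
  simp

lemma continuous_seg : Continuous (seg ζ) := by
  unfold seg
  fun_prop

lemma sq_norm_eq (z : ℂ) : ‖z‖ ^ 2 = z.re ^ 2 + z.im ^ 2 := by
  rw [Complex.sq_norm, Complex.normSq_apply]
  ring

lemma norm_seg_lt (hn : ζ.re ^ 2 + ζ.im ^ 2 = 1) (hr : ζ.re < 1) {t : ℝ} (h0 : 0 < t)
    (h1 : t < 1) : ‖seg ζ t‖ < 1 := by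
  have h := sq_norm_eq (seg ζ t)
  rw [seg_re, seg_im] at h
  have h2 : ‖seg ζ t‖ ^ 2 = 1 - 2 * (t * (1 - t) * (1 - ζ.re)) := by
    rw [h]
    linear_combination t ^ 2 * hn
  have h3 : 0 < t * (1 - t) * (1 - ζ.re) :=
    mul_pos (mul_pos h0 (by linarith)) (by linarith)
  nlinarith [norm_nonneg (seg ζ t)]

/-- On the chord X = c t (1+ζ)/(1+s), and |1+s|² - |1+ζ|² = 2(1-t)²(1 - Re ζ) ≥ 0. So X stays in the
disc of radius c, where the formulas for B_j are valid. -/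
lemma norm_segX_seg_le (hζ : ζ ^ 4 + ζ ^ 3 + ζ ^ 2 + ζ + 1 = 0) (hg : 0 < ζ.re) {t : ℝ}
    (h0 : 0 ≤ t) :
    ‖segX ζ (seg ζ t)‖ ≤ t * (ζ.re / (1 + ζ.re)) := by
  obtain ⟨hz1, h2, -⟩ := fifth_root_ne hζ
  have hn := fifth_root_re_sq_add_im_sq hζ
  have n1 : 1 - ζ ≠ 0 := sub_ne_zero.mpr hz1.symm
  have n2 : 1 + ζ ≠ 0 := fun h => h2 (by linear_combination -(1 - ζ) * h)
  have hc : 0 < ζ.re / (1 + ζ.re) := by positivity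
  have e1 : ‖segX ζ ζ‖ = ζ.re / (1 + ζ.re) := by
    rw [segX_self hζ hg, Complex.norm_real, Real.norm_eq_abs, abs_of_pos hc]
  have e2 : segX ζ (seg ζ t) = segX ζ ζ * t * ((1 + ζ) / (1 + seg ζ t)) := by
    unfold segX
    rw [show 1 - seg ζ t = t * (1 - ζ) by unfold seg; ring]
    field_simp
  have e3 : ‖1 + ζ‖ ≤ ‖1 + seg ζ t‖ := by
    refine abs_le_of_sq_le_sq' ?_ (norm_nonneg _) |>.2
    rw [sq_norm_eq, sq_norm_eq]
    simp only [Complex.add_re, Complex.add_im, Complex.one_re, Complex.one_im, seg_re, seg_im]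
    have h3 : ζ.re ≤ 1 := by nlinarith [sq_nonneg ζ.im]
    have h4 : 0 ≤ (1 - t) ^ 2 * (1 - ζ.re) := by
      have : 0 ≤ 1 - ζ.re := by linarith
      positivity
    nlinarith
  have e4 : 0 < ‖1 + ζ‖ := norm_pos_iff.mpr n2
  rw [e2, norm_mul, norm_mul, e1, Complex.norm_real, Real.norm_eq_abs, abs_of_nonneg h0, norm_div,
    mul_comm _ t]
  exact mul_le_of_le_one_right (by positivity) (div_le_one_of_le₀ e3 (norm_nonneg _))

/-- The chord leaves 1 non-radially but non-tangentially, with |Im s|/(1 - Re s) constant and equal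
to |Im ζ|/(1 - Re ζ); the extra +1 in the slope makes the cone inequality strict. -/
lemma tendsto_seg_stolzCone (hr : ζ.re < 1) :
    Tendsto (seg ζ) (𝓝[>] 0) (𝓝[Complex.stolzCone ((|ζ.im| + 1) / (1 - ζ.re))] 1) := by
  have hd : 0 < 1 - ζ.re := by linarith
  refine tendsto_nhdsWithin_iff.mpr
    ⟨(continuous_seg.tendsto' 0 1 seg_zero).mono_left nhdsWithin_le_nhds, ?_⟩
  filter_upwards [self_mem_nhdsWithin] with t ht
  have ht' : 0 < t := ht
  simp only [Complex.stolzCone, Set.mem_ofPred_eq]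
  rw [seg_re, seg_im, abs_mul, abs_of_pos ht', show (|ζ.im| + 1) / (1 - ζ.re)
    * (1 - (1 - t * (1 - ζ.re))) = t * (|ζ.im| + 1) by field_simp; ring]
  exact mul_lt_mul_of_pos_left (lt_add_one _) ht'

lemma tendsto_inv_mul_seg_stolzCone (hn : ζ.re ^ 2 + ζ.im ^ 2 = 1) (hr : ζ.re < 1) :
    Tendsto (fun t => ζ⁻¹ * seg ζ t) (𝓝[<] 1)
      (𝓝[Complex.stolzCone ((|ζ.im| + 1) / (1 - ζ.re))] 1) := by
  have hd : 0 < 1 - ζ.re := by linarith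
  have h0 : ζ ≠ 0 := fun h => by rw [h] at hn; norm_num at hn
  have hsq : Complex.normSq ζ = 1 := by rw [Complex.normSq_apply]; linarith
  refine tendsto_nhdsWithin_iff.mpr ⟨((continuous_const.mul continuous_seg).tendsto' 1 1
    (by rw [Pi.mul_apply, seg_one, inv_mul_cancel₀ h0])).mono_left nhdsWithin_le_nhds, ?_⟩
  filter_upwards [self_mem_nhdsWithin] with t ht
  have ht' : 0 < 1 - t := by have : t < 1 := ht; linarith
  have e : ζ⁻¹ * seg ζ t = t + (1 - t) * ζ⁻¹ := by
    unfold seg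
    field_simp
    ring
  have er : (ζ⁻¹ * seg ζ t).re = 1 - (1 - t) * (1 - ζ.re) := by
    rw [e]
    simp [Complex.inv_re, Complex.inv_im, hsq]
    ring
  have ei : (ζ⁻¹ * seg ζ t).im = -((1 - t) * ζ.im) := by
    rw [e]
    simp [Complex.inv_re, Complex.inv_im, hsq]
  simp only [Complex.stolzCone, Set.mem_ofPred_eq]
  rw [er, ei, abs_neg, abs_mul, abs_of_pos ht', show (|ζ.im| + 1) / (1 - ζ.re)
    * (1 - (1 - (1 - t) * (1 - ζ.re))) = (1 - t) * (|ζ.im| + 1) by field_simp; ring]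
  exact mul_lt_mul_of_pos_left (lt_add_one _) ht'

lemma stolz_slope_pos (hr : ζ.re < 1) : 0 < (|ζ.im| + 1) / (1 - ζ.re) := by
  have : 0 < 1 - ζ.re := by linarith
  positivity

lemma tendsto_iterSum_seg_zero (hr : ζ.re < 1) {a : ℂ} (ha : ‖a‖ = 1) (ha1 : a ≠ 1) :
    Tendsto (fun t => iterSum [a] (seg ζ t)) (𝓝[>] 0) (𝓝 (iterValue [a])) :=
  (tendsto_iterSum_stolzCone ha ha1 (by simp) (stolz_slope_pos hr)).comp (tendsto_seg_stolzCone hr)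

lemma tendsto_iterSum_seg_one (hn : ζ.re ^ 2 + ζ.im ^ 2 = 1) (hr : ζ.re < 1) {a : ℂ}
    (ha : ‖ζ * a‖ = 1) (ha1 : ζ * a ≠ 1) :
    Tendsto (fun t => iterSum [a] (seg ζ t)) (𝓝[<] 1) (𝓝 (iterValue [ζ * a])) := by
  have h0 : ζ ≠ 0 := fun h => by rw [h] at hn; norm_num at hn
  refine ((tendsto_iterSum_stolzCone ha ha1 (by simp) (stolz_slope_pos hr)).comp
    (tendsto_inv_mul_seg_stolzCone hn hr)).congr fun t => ?_
  have := iterSum_mul ζ [a] (ζ⁻¹ * seg ζ t)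
  rw [← mul_assoc, mul_inv_cancel₀ h0, one_mul] at this
  rw [this]
  rfl

lemma eq_of_hasDerivAt_zero_complex {f : ℝ → ℂ} {l r : ℂ}
    (hd : ∀ t, 0 < t → t < 1 → HasDerivAt f 0 t) (hl : Tendsto f (𝓝[>] 0) (𝓝 l))
    (hr : Tendsto f (𝓝[<] 1) (𝓝 r)) : l = r := by
  have h1 : ∀ t ∈ Set.Ioo (0 : ℝ) 1, f t = f (1 / 2) := fun t ht =>
    (convex_Ioo (0 : ℝ) 1).is_const_of_fderivWithin_eq_zero (𝕜 := ℝ)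
      (fun z hz => (hd z hz.1 hz.2).differentiableAt.differentiableWithinAt)
      (fun z hz => by
        rw [fderivWithin_of_isOpen isOpen_Ioo hz]
        ext
        simp [(hd z hz.1 hz.2).deriv]) ht ⟨by norm_num, by norm_num⟩
  have h2 : l = f (1 / 2) := by
    refine tendsto_nhds_unique hl (tendsto_const_nhds.congr' ?_)
    filter_upwards [Ioo_mem_nhdsGT (zero_lt_one' ℝ)] with t ht using (h1 t ht).symm
  have h3 : r = f (1 / 2) := by
    refine tendsto_nhds_unique hr (tendsto_const_nhds.congr' ?_)
    filter_upwards [Ioo_mem_nhdsLT (zero_lt_one' ℝ)] with t ht using (h1 t ht).symm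
  rw [h2, h3]

lemma eq_limit_of_hasDerivAt_zero_complex {f : ℝ → ℂ} {l : ℂ}
    (hd : ∀ t, 0 < t → t < 1 → HasDerivAt f 0 t) (hl : Tendsto f (𝓝[>] 0) (𝓝 l))
    {t : ℝ} (h0 : 0 < t) (h1 : t < 1) : f t = l := by
  refine tendsto_nhds_unique (tendsto_const_nhds.congr' ?_) hl
  filter_upwards [Ioo_mem_nhdsGT (zero_lt_one' ℝ)] with u hu
  exact (convex_Ioo (0 : ℝ) 1).is_const_of_fderivWithin_eq_zero (𝕜 := ℝ)
      (fun z hz => (hd z hz.1 hz.2).differentiableAt.differentiableWithinAt)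
      (fun z hz => by
        rw [fderivWithin_of_isOpen isOpen_Ioo hz]
        ext
        simp [(hd z hz.1 hz.2).deriv]) ⟨h0, h1⟩ hu

lemma hasDerivAt_comp_seg {f : ℂ → ℂ} {f' : ℂ} {t : ℝ} (hf : HasDerivAt f f' (seg ζ t)) :
    HasDerivAt (fun t => f (seg ζ t)) (f' * (ζ - 1)) t :=
  hf.comp t (hasDerivAt_seg t)

lemma fifth_root_re_lt_one (hζ : ζ ^ 4 + ζ ^ 3 + ζ ^ 2 + ζ + 1 = 0) : ζ.re < 1 := by
  nlinarith [fifth_root_re_quadratic hζ]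

lemma segX_one : segX ζ 1 = 0 := by simp [segX]

lemma tendsto_logOneSegX_zero (hr : ζ.re < 1) {z : ℂ} (hz : ‖z‖ = 1) (hz1 : z ≠ 1) :
    Tendsto (fun t => logOneSegX z (seg ζ t)) (𝓝[>] 0) (𝓝 0) := by
  have h := (((tendsto_iterSum_seg_zero hr hz hz1).const_sub (iterValue [z])).sub_const
    (iterValue [-1])).add (tendsto_iterSum_seg_zero hr (a := -1) (by simp) (by norm_num))
  refine h.trans_eq ?_
  congr 1
  ring

/-- Both sides are log((1+X)/(1-X)). No branch needs tracking: the derivatives along the chord agree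
and both sides tend to 0 at t = 0. -/
lemma two_mul_chi_one_segX (hζ : ζ ^ 4 + ζ ^ 3 + ζ ^ 2 + ζ + 1 = 0) (hg : 0 < ζ.re) {t : ℝ}
    (h0 : 0 < t) (h1 : t < 1) :
    logOneSegX (ζ ^ 2) (seg ζ t) - logOneSegX (ζ ^ 3) (seg ζ t)
      = 2 * chi 1 (segX ζ (seg ζ t)) := by
  have hr := fifth_root_re_lt_one hζ
  have hn := fifth_root_re_sq_add_im_sq hζ
  have hn1 : ‖ζ‖ = 1 := norm_eq_one_of_pow_ten (fifth_root_pow_ten hζ)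
  obtain ⟨-, hz2, hz3, -⟩ := fifth_root_ne hζ
  have hc : ζ.re / (1 + ζ.re) < 1 := by rw [div_lt_one (by linarith)]; linarith
  have key := eq_limit_of_hasDerivAt_zero_complex (f := fun t => logOneSegX (ζ ^ 2) (seg ζ t)
    - logOneSegX (ζ ^ 3) (seg ζ t) - 2 * chi 1 (segX ζ (seg ζ t))) (l := 0 - 0 - 2 * 0)
    (fun u hu0 hu1 => ?_) ?_ h0 h1
  · linear_combination key
  · have hs := norm_seg_lt hn hr hu0 hu1
    have hx : ‖segX ζ (seg ζ u)‖ < 1 := by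
      refine (norm_segX_seg_le hζ hg hu0.le).trans_lt ?_
      have : 0 < ζ.re / (1 + ζ.re) := by positivity
      nlinarith
    have n1 := one_sub_sq_ne_zero hx
    have n2 : 1 - segX ζ (seg ζ u) ≠ 0 := fun h => n1 (by
      linear_combination (1 + segX ζ (seg ζ u)) * h)
    have n3 : 1 + segX ζ (seg ζ u) ≠ 0 := fun h => n1 (by
      linear_combination (1 - segX ζ (seg ζ u)) * h)
    have d3 : HasDerivAt (fun s => chi 1 (segX ζ s)) _ (seg ζ u) :=
      (hasDerivAt_chi_one hx).comp _ (hasDerivAt_segX (one_add_ne_zero_of_norm_lt hs))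
    refine (((hasDerivAt_comp_seg (hasDerivAt_logOneSegX_add hζ hs)).sub
      (hasDerivAt_comp_seg (hasDerivAt_logOneSegX_sub hζ hs))).sub
      ((hasDerivAt_comp_seg d3).const_mul 2)).congr_deriv ?_
    generalize (1 + ζ ^ 2) / (1 - ζ ^ 2) * (-2 / (1 + seg ζ u) ^ 2) = X'
    field_simp
    ring
  · refine ((tendsto_logOneSegX_zero hr (by simp [hn1]) hz2).sub
      (tendsto_logOneSegX_zero hr (by simp [hn1]) hz3)).sub (Tendsto.const_mul 2 ?_)
    have hc : ContinuousAt (fun t => chi 1 (segX ζ (seg ζ t))) 0 := by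
      have c1 : ContinuousAt (chi (𝕜 := ℂ) 1) (segX ζ (seg ζ 0)) := by
        rw [seg_zero, segX_one]; exact continuousAt_chi (by simp)
      have c2 : ContinuousAt (segX ζ) (seg ζ 0) :=
        (hasDerivAt_segX (by rw [seg_zero]; norm_num)).continuousAt
      exact ContinuousAt.comp' c1 (ContinuousAt.comp' c2 continuous_seg.continuousAt)
    have := hc.tendsto
    rw [seg_zero, segX_one, chi_zero] at this
    exact this.mono_left nhdsWithin_le_nhds

lemma tendsto_mul_log_add {k : ℝ → ℂ} {l : ℂ} (hk : Tendsto k (𝓝[>] 0) (𝓝 l)) :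
    Tendsto (fun t : ℝ => (t : ℂ) * (k t + (Real.log t : ℂ))) (𝓝[>] 0) (𝓝 0) ∧
    Tendsto (fun t : ℝ => (t : ℂ) * (k t + (Real.log t : ℂ)) ^ 2) (𝓝[>] 0) (𝓝 0) := by
  have h0 : Tendsto (fun t : ℝ => (t : ℂ)) (𝓝[>] 0) (𝓝 0) :=
    (Complex.continuous_ofReal.tendsto' 0 0 (by simp)).mono_left nhdsWithin_le_nhds
  have h1 : Tendsto (fun t : ℝ => (t : ℂ) * (Real.log t : ℂ)) (𝓝[>] 0) (𝓝 0) := by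
    have h := (Complex.continuous_ofReal.tendsto' (0 : ℝ) 0 (by simp)).comp
      (tendsto_log_mul_rpow_nhdsGT_zero one_pos)
    refine h.congr fun t => ?_
    simp [mul_comm]
  have h2 : Tendsto (fun t : ℝ => (t : ℂ) * (Real.log t : ℂ) ^ 2) (𝓝[>] 0) (𝓝 0) := by
    have h := (Complex.continuous_ofReal.tendsto' (0 : ℝ) 0 (by simp)).comp
      (tendsto_log_mul_rpow_nhdsGT_zero (one_half_pos (α := ℝ)))
    have h' := h.mul h
    rw [mul_zero] at h'
    refine h'.congr' ?_
    filter_upwards [self_mem_nhdsWithin] with t ht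
    have e : t ^ (1 / 2 : ℝ) * t ^ (1 / 2 : ℝ) = t := by
      rw [← Real.rpow_add ht]; norm_num
    simp only [Function.comp_apply]
    rw [← Complex.ofReal_mul, ← Complex.ofReal_pow, ← Complex.ofReal_mul]
    congr 1
    linear_combination Real.log t ^ 2 * e
  constructor
  · have h := (h0.mul hk).add h1
    simp only [zero_mul, add_zero] at h
    exact h.congr fun t => by ring
  · have h := ((h0.mul (hk.pow 2)).add ((h1.mul hk).const_mul 2)).add h2
    simp only [zero_mul, mul_zero, add_zero] at h
    exact h.congr fun t => by ring

/-- On the chord 1 - s = t(1-ζ) exactly, so log(1-s) splits off log t; the other terms converge. -/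
lemma tendsto_logSegX_sub_log (hn : ζ.re ^ 2 + ζ.im ^ 2 = 1) (hr : ζ.re < 1) :
    ∃ l : ℂ, Tendsto (fun t => logSegX ζ (seg ζ t) - (Real.log t : ℂ)) (𝓝[>] 0) (𝓝 l) := by
  refine ⟨_, ((tendsto_iterSum_seg_zero hr (a := -1) (by simp) (by norm_num)).const_add
    (iterValue [ζ ^ 2] - iterValue [-ζ ^ 2] + Complex.log (1 - ζ))).congr' ?_⟩
  filter_upwards [Ioo_mem_nhdsGT (zero_lt_one' ℝ)] with t ht
  have hz : 1 - ζ ≠ 0 := fun h => by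
    rw [← sub_eq_zero.mp h, Complex.one_re] at hr; exact lt_irrefl _ hr
  unfold logSegX
  rw [iterSum_singleton (a := 1) (by simp) (norm_seg_lt hn hr ht.1 ht.2), one_mul,
    show 1 - seg ζ t = t * (1 - ζ) by unfold seg; ring, Complex.log_ofReal_mul ht.1 hz]
  ring

lemma hasDerivAt_chi_segX_seg_zero (j : ℕ) :
    ∃ d : ℂ, HasDerivAt (fun t => chi j (segX ζ (seg ζ t))) d 0 := by
  have h1 : HasDerivAt (segX ζ) _ (seg ζ 0) := hasDerivAt_segX (by rw [seg_zero]; norm_num)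
  have h2 : HasDerivAt (chi (𝕜 := ℂ) j) 1 (segX ζ (seg ζ 0)) := by
    rw [seg_zero, segX_one]; exact hasDerivAt_chi_zero
  exact ⟨_, hasDerivAt_comp_seg (h2.comp _ h1)⟩

lemma tendsto_chi_mul_logSegX (hn : ζ.re ^ 2 + ζ.im ^ 2 = 1) (hr : ζ.re < 1) (j : ℕ) :
    Tendsto (fun t => chi j (segX ζ (seg ζ t)) * logSegX ζ (seg ζ t)) (𝓝[>] 0) (𝓝 0) ∧
    Tendsto (fun t => chi j (segX ζ (seg ζ t)) * logSegX ζ (seg ζ t) ^ 2) (𝓝[>] 0) (𝓝 0) := by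
  obtain ⟨d, hd⟩ := hasDerivAt_chi_segX_seg_zero (ζ := ζ) j
  obtain ⟨l, hl⟩ := tendsto_logSegX_sub_log hn hr
  obtain ⟨h1, h2⟩ := tendsto_mul_log_add hl
  have hs := hd.tendsto_slope_zero_right
  rw [← mul_zero d]
  constructor
  · refine (hs.mul h1).congr' ?_
    filter_upwards [self_mem_nhdsWithin] with t ht
    have ht' : (t : ℂ) ≠ 0 := Complex.ofReal_ne_zero.mpr (ne_of_gt ht)
    rw [zero_add, seg_zero, segX_one, chi_zero, Complex.real_smul, Complex.ofReal_inv]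
    field_simp
    ring
  · refine (hs.mul h2).congr' ?_
    filter_upwards [self_mem_nhdsWithin] with t ht
    have ht' : (t : ℂ) ≠ 0 := Complex.ofReal_ne_zero.mpr (ne_of_gt ht)
    rw [zero_add, seg_zero, segX_one, chi_zero, Complex.real_smul, Complex.ofReal_inv]
    field_simp
    ring

lemma tendsto_chi_segX_zero (j : ℕ) :
    Tendsto (fun t => chi j (segX ζ (seg ζ t))) (𝓝[>] 0) (𝓝 0) := by
  obtain ⟨d, hd⟩ := hasDerivAt_chi_segX_seg_zero (ζ := ζ) j
  have h := hd.continuousAt.tendsto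
  rw [seg_zero, segX_one, chi_zero] at h
  exact h.mono_left nhdsWithin_le_nhds

lemma continuousAt_binomSum_three_zero : ContinuousAt (binomSum (𝕜 := ℂ) 3) 0 :=
  continuousOn_binomSum_three.continuousAt (Metric.closedBall_mem_nhds 0 one_pos)

lemma tendsto_segX_zero : Tendsto (fun t => segX ζ (seg ζ t)) (𝓝[>] 0) (𝓝 0) := by
  have h : ContinuousAt (fun t => segX ζ (seg ζ t)) 0 :=
    (hasDerivAt_comp_seg (hasDerivAt_segX (by rw [seg_zero]; norm_num))).continuousAt
  have := h.tendsto
  rw [seg_zero, segX_one] at this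
  exact this.mono_left nhdsWithin_le_nhds

/-- Replacing lm - lp by -2 χ_1(X) attaches a factor χ_1 or χ_2 to every power of the divergent l₀.
These factors vanish to first order in t, which beats log² t. -/
lemma tendsto_partsRemainder_zero (hζ : ζ ^ 4 + ζ ^ 3 + ζ ^ 2 + ζ + 1 = 0) (hg : 0 < ζ.re)
    (M : ℂ) :
    Tendsto (fun t => partsRemainder M (segX ζ (seg ζ t)) (logSegX ζ (seg ζ t))
      (logOneSegX (ζ ^ 3) (seg ζ t)) (logOneSegX (ζ ^ 2) (seg ζ t))) (𝓝[>] 0) (𝓝 0) := by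
  have hr := fifth_root_re_lt_one hζ
  have hn := fifth_root_re_sq_add_im_sq hζ
  have hn1 : ‖ζ‖ = 1 := norm_eq_one_of_pow_ten (fifth_root_pow_ten hζ)
  obtain ⟨-, hz2, hz3, -⟩ := fifth_root_ne hζ
  have hp := tendsto_logOneSegX_zero hr (z := ζ ^ 2) (by simp [hn1]) hz2
  have hm := tendsto_logOneSegX_zero hr (z := ζ ^ 3) (by simp [hn1]) hz3
  have hx := tendsto_segX_zero (ζ := ζ)
  obtain ⟨c1, c2⟩ := tendsto_chi_mul_logSegX hn hr 1
  obtain ⟨e1, -⟩ := tendsto_chi_mul_logSegX hn hr 2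
  have hB : Tendsto (fun t => binomSum 3 (4 * segX ζ (seg ζ t) / (1 - segX ζ (seg ζ t) ^ 2)))
      (𝓝[>] 0) (𝓝 0) := by
    have hw := (hx.const_mul 4).div ((hx.pow 2).const_sub 1) (by norm_num)
    have h0 : binomSum 3 (0 : ℂ) = 0 := by simp [binomSum]
    have := continuousAt_binomSum_three_zero.tendsto
    rw [h0] at this
    refine this.comp ?_
    rwa [mul_zero, zero_div] at hw
  have hML := (hp.const_sub M).sub hm
  have h := ((hB.sub ((e1.add ((tendsto_chi_segX_zero (ζ := ζ) 2).mul hML)).const_mul 4)).add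
    (c2.const_mul 2)).add ((c1.mul hML).const_mul 4)
  simp only [zero_mul, mul_zero, add_zero, sub_zero] at h
  refine h.congr' ?_
  filter_upwards [Ioo_mem_nhdsGT (zero_lt_one' ℝ)] with t ht
  have hchi := two_mul_chi_one_segX hζ hg ht.1 ht.2
  unfold partsRemainder
  linear_combination (-logSegX ζ (seg ζ t) ^ 2 - 2 * logSegX ζ (seg ζ t) *
    (M - logOneSegX (ζ ^ 2) (seg ζ t) - logOneSegX (ζ ^ 3) (seg ζ t))) * hchi

lemma abs_arg_one_sub_lt {z : ℂ} (hz : ‖z‖ = 1) (h1 : z ≠ 1) :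
    |(Complex.log (1 - z)).im| < Real.pi / 2 := by
  rw [Complex.log_im, Complex.abs_arg_lt_pi_div_two_iff]
  left
  rw [Complex.sub_re, Complex.one_re, sub_pos]
  refine lt_of_le_of_ne ((Complex.re_le_norm z).trans hz.le) fun h => h1 ?_
  have h2 := Complex.sq_norm z
  rw [Complex.normSq_apply, hz, h] at h2
  refine Complex.ext h ?_
  rw [Complex.one_im]
  nlinarith

/-- This is the logarithm of 1 - ζ⁴ = (1+ζ²)(1-ζ)(1+ζ). The four arguments are each below π/2 in
absolute value, so the ambiguity 2πn has |2πn| < 2π and n = 0. -/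
lemma iterValue_fifth_root_relation (hζ : ζ ^ 4 + ζ ^ 3 + ζ ^ 2 + ζ + 1 = 0) :
    iterValue [ζ ^ 4] = iterValue [-ζ ^ 2] + iterValue [ζ] + iterValue [-ζ] := by
  obtain ⟨h1, h2, h3, h4, h5, h6⟩ := fifth_root_ne hζ
  have hn : ‖ζ‖ = 1 := norm_eq_one_of_pow_ten (fifth_root_pow_ten hζ)
  have n4 : ‖ζ ^ 4‖ = 1 := by simp [hn]
  have n2 : ‖-ζ ^ 2‖ = 1 := by simp [hn]
  have n1 : ‖-ζ‖ = 1 := by simp [hn]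
  rw [iterValue_singleton n4 h4, iterValue_singleton n2 h6, iterValue_singleton hn h1,
    iterValue_singleton n1 h5]
  have a4 := abs_lt.mp (abs_arg_one_sub_lt n4 h4)
  have a2 := abs_lt.mp (abs_arg_one_sub_lt n2 h6)
  have a0 := abs_lt.mp (abs_arg_one_sub_lt hn h1)
  have a1 := abs_lt.mp (abs_arg_one_sub_lt n1 h5)
  have ne : ∀ {z : ℂ}, z ≠ 1 → 1 - z ≠ 0 := fun h => sub_ne_zero.mpr h.symm
  have he : Complex.exp (Complex.log (1 - -ζ ^ 2) + Complex.log (1 - ζ) + Complex.log (1 - -ζ)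
      - Complex.log (1 - ζ ^ 4)) = 1 := by
    rw [Complex.exp_sub, Complex.exp_add, Complex.exp_add, Complex.exp_log (ne h6),
      Complex.exp_log (ne h1), Complex.exp_log (ne h5), Complex.exp_log (ne h4),
      div_eq_one_iff_eq (ne h4)]
    ring
  obtain ⟨n, hn⟩ := Complex.exp_eq_one_iff.mp he
  have him := congrArg Complex.im hn
  simp only [Complex.sub_im, Complex.add_im] at him
  rw [show ((n : ℂ) * (2 * Real.pi * Complex.I)).im = n * (2 * Real.pi) by simp] at him
  have hpi := Real.pi_pos
  have l1 : (n : ℝ) < 1 := by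
    by_contra h
    have : (1 : ℝ) ≤ n := not_lt.mp h
    nlinarith
  have l2 : (-1 : ℝ) < n := by
    by_contra h
    have : (n : ℝ) ≤ -1 := not_lt.mp h
    nlinarith
  have l1' : n < 1 := by exact_mod_cast l1
  have l2' : -1 < n := by exact_mod_cast l2
  obtain rfl : n = 0 := by omega
  rw [Int.cast_zero, zero_mul] at hn
  linear_combination hn

lemma tendsto_logSegX_one (hζ : ζ ^ 4 + ζ ^ 3 + ζ ^ 2 + ζ + 1 = 0) :
    Tendsto (fun t => logSegX ζ (seg ζ t)) (𝓝[<] 1)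
      (𝓝 (iterValue [ζ ^ 2] - iterValue [-ζ ^ 2] - iterValue [ζ] + iterValue [-ζ])) := by
  obtain ⟨h1, -, -, -, h5, -⟩ := fifth_root_ne hζ
  have hn : ‖ζ‖ = 1 := norm_eq_one_of_pow_ten (fifth_root_pow_ten hζ)
  have hr := fifth_root_re_lt_one hζ
  have hq := fifth_root_re_sq_add_im_sq hζ
  have d1 := tendsto_iterSum_seg_one hq hr (a := 1) (by simp [hn]) (by simpa)
  have d2 := tendsto_iterSum_seg_one hq hr (a := -1) (by simp [hn]) (by simpa)
  rw [mul_one] at d1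
  rw [mul_neg_one] at d2
  exact (d1.const_sub _).add d2

lemma tendsto_logOneSegX_one (hζ : ζ ^ 4 + ζ ^ 3 + ζ ^ 2 + ζ + 1 = 0) {z : ℂ} (hz : ‖z‖ = 1)
    (hz1 : ζ * z ≠ 1) :
    Tendsto (fun t => logOneSegX z (seg ζ t)) (𝓝[<] 1)
      (𝓝 (iterValue [z] - iterValue [ζ * z] - iterValue [-1] + iterValue [-ζ])) := by
  obtain ⟨-, -, -, -, h5, -⟩ := fifth_root_ne hζ
  have hn : ‖ζ‖ = 1 := norm_eq_one_of_pow_ten (fifth_root_pow_ten hζ)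
  have hr := fifth_root_re_lt_one hζ
  have hq := fifth_root_re_sq_add_im_sq hζ
  have d1 := tendsto_iterSum_seg_one hq hr (a := z) (by simp [hn, hz]) hz1
  have d2 := tendsto_iterSum_seg_one hq hr (a := -1) (by simp [hn]) (by simpa)
  rw [mul_neg_one] at d2
  exact ((d1.const_sub _).sub_const _).add d2

lemma tendsto_binomSum_segX_one (hζ : ζ ^ 4 + ζ ^ 3 + ζ ^ 2 + ζ + 1 = 0) (hg : 0 < ζ.re) :
    Tendsto (fun t => binomSum 3 (4 * segX ζ (seg ζ t) / (1 - segX ζ (seg ζ t) ^ 2)))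
      (𝓝[<] 1) (𝓝 (binomSum 3 1)) ∧
    Tendsto (fun t => chi 2 (segX ζ (seg ζ t))) (𝓝[<] 1) (𝓝 (chi 2 (segX ζ ζ))) := by
  obtain ⟨-, -, -, -, h5, -⟩ := fifth_root_ne hζ
  have hc0 : 0 < ζ.re / (1 + ζ.re) := by positivity
  have hc := golden_quadratic hg (fifth_root_re_quadratic hζ)
  have hx : Tendsto (fun t => segX ζ (seg ζ t)) (𝓝[<] 1) (𝓝 (segX ζ ζ)) := by
    have h : ContinuousAt (fun t => segX ζ (seg ζ t)) 1 :=
      (hasDerivAt_comp_seg (hasDerivAt_segX (by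
        rw [seg_one]; exact fun h => h5 (by linear_combination -h)))).continuousAt
    have := h.tendsto
    rw [seg_one] at this
    exact this.mono_left nhdsWithin_le_nhds
  have hx1 : ‖segX ζ ζ‖ < 1 := by
    rw [segX_self hζ hg, Complex.norm_real, Real.norm_eq_abs, abs_of_pos hc0]
    exact lt_one_of_quadratic hc0 hc
  refine ⟨?_, (continuousAt_chi hx1).tendsto.comp hx⟩
  have hval : 4 * segX ζ ζ / (1 - segX ζ ζ ^ 2) = 1 := by
    rw [div_eq_one_iff_eq (one_sub_sq_ne_zero hx1), segX_self hζ hg]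
    have : 4 * ((ζ.re / (1 + ζ.re) : ℝ) : ℂ) + ((ζ.re / (1 + ζ.re) : ℝ) : ℂ) ^ 2 = 1 := by
      exact_mod_cast hc
    linear_combination this
  have hw := (hx.const_mul 4).div ((hx.pow 2).const_sub 1) (one_sub_sq_ne_zero hx1)
  rw [hval] at hw
  refine (continuousOn_binomSum_three (𝕜 := ℂ) 1 (by simp)).tendsto.comp
    (tendsto_nhdsWithin_iff.mpr ⟨hw, ?_⟩)
  filter_upwards [Ioo_mem_nhdsLT (zero_lt_one' ℝ)] with t ht
  rw [mem_closedBall_zero_iff]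
  refine (norm_four_mul_div_lt_one hc0 hc ((norm_segX_seg_le hζ hg ht.1.le).trans_lt ?_)).le
  nlinarith [ht.2]

/-- The central binomial sum at `1` has weight three and level ten. -/
lemma binomSum_three_one_mem (hζ : ζ ^ 4 + ζ ^ 3 + ζ ^ 2 + ζ + 1 = 0) (hg : 0 < ζ.re) :
    binomSum 3 (1 : ℂ) ∈ iterSpace 3 := by
  obtain ⟨h1, h2, h3, h4, h5, h6⟩ := fifth_root_ne hζ
  have h10 := fifth_root_pow_ten hζ
  have hn : ‖ζ‖ = 1 := norm_eq_one_of_pow_ten h10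
  have hr := fifth_root_re_lt_one hζ
  have hq := fifth_root_re_sq_add_im_sq hζ
  have hσ := stolz_slope_pos hr
  have hc0 : 0 < ζ.re / (1 + ζ.re) := by positivity
  have hc := golden_quadratic hg (fifth_root_re_quadratic hζ)
  obtain ⟨F, hF, ⟨v, hv, hv'⟩, ⟨u, hu, hu'⟩⟩ := exists_primitive_partsRemainder hζ
  have hz0 : ζ ≠ 0 := fun h => by rw [h] at hn; simp at hn
  have hp := tendsto_logOneSegX_one hζ (z := ζ ^ 2) (by simp [hn]) (by rwa [← pow_succ'])
  have hm := tendsto_logOneSegX_one hζ (z := ζ ^ 3) (by simp [hn]) (by rwa [← pow_succ'])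
  have hl := tendsto_logSegX_one hζ
  obtain ⟨hB, hC⟩ := tendsto_binomSum_segX_one hζ hg
  rw [← pow_succ'] at hp hm
  have hF1 : Tendsto (fun t => F (seg ζ t)) (𝓝[<] 1) (𝓝 u) := by
    refine ((hu' _ hσ).comp (tendsto_inv_mul_seg_stolzCone hq hr)).congr fun t => ?_
    rw [Function.comp_apply, ← mul_assoc, mul_inv_cancel₀ hz0, one_mul]
  have hML := (hp.const_sub (-2 * iterValue [-1])).sub hm
  -- The primitive minus `partsRemainder` is constant along the chord; its limits at s = 1 and s = ζ
  -- are compared.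
  have key := eq_of_hasDerivAt_zero_complex (fun t h0 h1' => ?_)
    (((hv' _ hσ).comp (tendsto_seg_stolzCone hr)).sub
      (tendsto_partsRemainder_zero hζ hg (-2 * iterValue [-1])))
    (hF1.sub (((hB.sub ((hC.mul (hl.add hML)).const_mul 4)).sub
      ((hm.sub hp).mul (hl.pow 2))).sub ((((hm.sub hp).mul hML).mul hl).const_mul 2)))
  · have m1 : ∀ {a : ℂ}, a ^ 10 = 1 → a ≠ 1 → iterValue [a] ∈ iterSpace 1 := iterValue_one_mem
    have pw : ∀ n : ℕ, (ζ ^ n) ^ 10 = 1 := fun n => by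
      rw [← pow_mul, mul_comm, pow_mul, h10, one_pow]
    have mneg : iterValue [-1] ∈ iterSpace 1 := m1 (by norm_num) (by norm_num)
    have mz := m1 h10 h1
    have m2 := m1 (pw 2) h2
    have m3 := m1 (pw 3) h3
    have m4 := m1 (pw 4) h4
    have mnz := m1 (by rw [Even.neg_pow (by decide), h10]) h5
    have mn2 := m1 (by rw [Even.neg_pow (by decide), pw]) h6
    have rel := iterValue_fifth_root_relation hζ
    generalize hLm : iterValue [ζ ^ 3] - iterValue [ζ ^ 4] - iterValue [-1] + iterValue [-ζ] = Lm
      at key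
    generalize hLp : iterValue [ζ ^ 2] - iterValue [ζ ^ 3] - iterValue [-1] + iterValue [-ζ] = Lp
      at key
    generalize hL : iterValue [ζ ^ 2] - iterValue [-ζ ^ 2] - iterValue [ζ] + iterValue [-ζ] = L
      at key
    have mLm : Lm ∈ iterSpace 1 := hLm ▸ add_mem (sub_mem (sub_mem m3 m4) mneg) mnz
    have mLp : Lp ∈ iterSpace 1 := hLp ▸ add_mem (sub_mem (sub_mem m2 m3) mneg) mnz
    have mL : L ∈ iterSpace 1 := hL ▸ add_mem (sub_mem (sub_mem m2 mn2) mz) mnz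
    -- This is log w = 0 at s = ζ. It kills the term with χ_2(c), not otherwise known to lie in the
    -- space, and turns the other boundary terms into (Lm - Lp)L².
    have hsum : L + (-2 * iterValue [-1] - Lp - Lm) = 0 := by
      rw [← hLm, ← hLp, ← hL]
      linear_combination rel
    have hb : binomSum 3 (1 : ℂ) = u - v - (Lm - Lp) * (L * L) := by
      linear_combination key + (4 * chi 2 (segX ζ ζ) + 2 * (Lm - Lp) * L) * hsum
    rw [hb]
    exact sub_mem (sub_mem hu hv)
      (iterSpace_one_mul_two (sub_mem mLm mLp) (iterSpace_one_mul_one mL mL))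
  · have hs := norm_seg_lt hq hr h0 h1'
    have n1 := one_add_ne_zero_of_norm_lt hs
    have hxc : ‖segX ζ (seg ζ t)‖ < ζ.re / (1 + ζ.re) :=
      (norm_segX_seg_le hζ hg h0.le).trans_lt (by nlinarith)
    have hx0 : segX ζ (seg ζ t) ≠ 0 := by
      unfold segX
      exact mul_ne_zero (div_ne_zero (fun h => h6 (by linear_combination -h))
        (sub_ne_zero.mpr h2.symm)) (div_ne_zero (one_sub_ne_zero_of_norm_lt hs) n1)
    have d := hasDerivAt_partsRemainder hc0 hc (-2 * iterValue [-1]) (hasDerivAt_segX n1)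
      (hasDerivAt_logSegX hζ hs) (hasDerivAt_logOneSegX_sub hζ hs)
      (hasDerivAt_logOneSegX_add hζ hs) hxc hx0 (two_mul_chi_one_segX hζ hg h0 h1')
    exact ((hasDerivAt_comp_seg (hF _ hs)).sub (hasDerivAt_comp_seg d)).congr_deriv
      (sub_self _)

end GoldenSegment

/-! ### The choice of ζ, and the series as the value at w = 1. -/

section Specialization

lemma exists_fifth_root_re_pos :
    ∃ ζ : ℂ, ζ ^ 4 + ζ ^ 3 + ζ ^ 2 + ζ + 1 = 0 ∧ 0 < ζ.re := by
  have h := Complex.isPrimitiveRoot_exp 5 (by norm_num)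
  refine ⟨Complex.exp (2 * Real.pi * Complex.I / (5 : ℕ)), ?_, ?_⟩
  · have := h.geom_sum_eq_zero (by norm_num)
    simp only [Finset.sum_range_succ, Finset.sum_range_zero] at this
    linear_combination this
  · rw [show 2 * (Real.pi : ℂ) * Complex.I / ((5 : ℕ) : ℂ)
      = ((2 * Real.pi / 5 : ℝ) : ℂ) * Complex.I by push_cast; ring, Complex.exp_ofReal_mul_I_re]
    have := Real.pi_pos
    exact Real.cos_pos_of_mem_Ioo ⟨by linarith, by linarith⟩

lemma hasSum_binomSum_one {𝕜 : Type*} [RCLike 𝕜] {j : ℕ} (hj : 2 ≤ j) :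
    HasSum (fun n : ℕ => (-1 : 𝕜) ^ n / ((2 * (n : 𝕜) + 1) ^ j * ((Nat.choose (2 * n) n : ℕ) : 𝕜)))
      (binomSum j 1) := by
  have h : Summable fun n => binomCoeff 𝕜 j n * (-1) ^ n := by
    refine Summable.of_norm_bounded (summable_binomCoeff (𝕜 := 𝕜) hj) fun n => ?_
    simp
  have e : binomSum j (1 : 𝕜) = ∑' n, binomCoeff 𝕜 j n * (-1) ^ n := by
    simp [binomSum, powerSum]
  rw [e]
  refine h.hasSum.congr_fun fun n => ?_
  rw [binomCoeff, Nat.centralBinom_eq_two_mul_choose]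
  ring

end Specialization

theorem theorem2 :
    HasSum
      (fun n : ℕ => (-1 : ℂ) ^ n / ((2 * (n : ℂ) + 1) ^ 3 * ((Nat.choose (2 * n) n : ℕ) : ℂ)))
      (-(4 / 3) * polylog 3 (1 / (Real.goldenRatio : ℂ) ^ 3)
        - 4 * polylog 2 (1 / (Real.goldenRatio : ℂ) ^ 3) * (Real.log Real.goldenRatio : ℂ)
        + polylog 3 (1 / (Real.goldenRatio : ℂ))
        - 25 / 3 * (Real.log Real.goldenRatio : ℂ) ^ 3
        + 6 * (Real.log 2 : ℂ) * (Real.log Real.goldenRatio : ℂ) ^ 2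
        + (Real.pi : ℂ) ^ 2 / 10 * (Real.log Real.goldenRatio : ℂ)
        + 12 / 5 * riemannZeta 3
        - (Real.pi : ℂ) ^ 2 / 3 * (Real.log 2 : ℂ)) ∧
    (∑' n : ℕ, (-1 : ℂ) ^ n / ((2 * (n : ℂ) + 1) ^ 3 * ((Nat.choose (2 * n) n : ℕ) : ℂ)))
      ∈ cmzvSpace 3 10 := by
  have hsum : HasSum (fun n : ℕ => (-1 : ℂ) ^ n
      / ((2 * (n : ℂ) + 1) ^ 3 * ((Nat.choose (2 * n) n : ℕ) : ℂ))) (binomSum 3 1) :=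
    hasSum_binomSum_one (by norm_num)
  obtain ⟨ζ, hζ, hg⟩ := exists_fifth_root_re_pos
  refine ⟨?_, ?_⟩
  · have hreal : HasSum (fun n : ℕ => (-1 : ℂ) ^ n
        / ((2 * (n : ℂ) + 1) ^ 3 * ((Nat.choose (2 * n) n : ℕ) : ℂ)))
        ((binomSum 3 (1 : ℝ) : ℝ) : ℂ) := by
      have h := Complex.hasSum_ofReal.mpr
        (hasSum_binomSum_one (𝕜 := ℝ) (j := 3) (by norm_num))
      refine h.congr_fun fun n => ?_
      push_cast
      rfl
    have hφ := Real.goldenRatio_pos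
    have hφ1 := Real.one_lt_goldenRatio
    set u : ℝ := 1 / Real.goldenRatio with hu
    have hu0 : 0 < u := by positivity
    have hu1 : u < 1 := by rw [hu, div_lt_one hφ]; exact hφ1
    have huq : u ^ 2 = 1 - u := by
      have h1 : u * Real.goldenRatio = 1 := one_div_mul_cancel hφ.ne'
      linear_combination (u * Real.goldenRatio + 1 - u) * h1 - u ^ 2 * Real.goldenRatio_sq
    have hlog : Real.log u = -Real.log Real.goldenRatio := by
      rw [hu, one_div, Real.log_inv]
    have hu3 : |u ^ 3| ≤ 1 := by
      rw [abs_of_pos (by positivity)]; exact pow_le_one₀ hu0.le hu1.le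
    have inv : ∀ x : ℝ, 1 / (x : ℂ) = ((1 / x : ℝ) : ℂ) := fun x => by push_cast; rfl
    have c1 : 1 / (Real.goldenRatio : ℂ) = (u : ℂ) := inv _
    have c3 : 1 / (Real.goldenRatio : ℂ) ^ 3 = ((u ^ 3 : ℝ) : ℂ) := by
      rw [Complex.ofReal_pow, ← c1, div_pow, one_pow]
    have hz : riemannZeta 3 = ((pl 3 (1 : ℝ) : ℝ) : ℂ) := by
      rw [pl_one_eq_riemannZeta (by norm_num)]; norm_num
    rw [c3, c1, polylog_ofReal (by norm_num) hu3, polylog_ofReal (by norm_num) hu3,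
      polylog_ofReal (by norm_num) (by rw [abs_of_pos hu0]; exact hu1.le), hz]
    convert hreal using 1
    rw [binomSum_three_one_eq hu0 huq, hlog]
    push_cast
    ring
  · rw [hsum.tsum_eq]
    exact iterSpace_le_cmzvSpace (by norm_num) (binomSum_three_one_mem hζ hg)
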